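/- Let $(\Omega,d)$ be a metric space with its Borel $\sigma$-algebra, $\nu$ a Borel probability measure on $\Omega$, $T:\Omega\to\Omega$ a measurable $\nu$-preserving map, and $\eta\in(0,1]$. For bounded $\eta$-Hölder $f:\Omega\to\mathbf C$ let $\|f\|_\infty$ be its supremum norm and $C_f=\sup_{x\ne y}|f(x)-f(y)|/d(x,y)^\eta$; let $\mathrm{Cov}_\nu(f,g)=\int fg\,d\nu-\int f\,d\nu\int g\,d\nu$. For $r\ge 1$, property $(\mathcal P_r)$ says: there are a polynomial $P_r$ with nonnegative real coefficients and $\delta_r\in(0,1)$ such that for all integers $m,m'\ge1$, all bounded $\eta$-Hölder $f_1,\dots,f_{m+m'}:\Omega\to\mathbf C$, all increasing sequences of nonnegative integers $(k_1,\dots,k_m)$, $(l_1,\dots,l_{m'})$ and all integers $n\ge0$, $$\Big|\mathrm{Cov}_\nu\Big(\prod_{i=1}^m f_i\circ T^{k_i},\prod_{j=1}^{m'}f_{m+j}\circ T^{n+l_j}\Big)\Big|\le\Big(\prod_{i=1}^{m+m'}\|f_i\|_\infty+\sum_{i=1}^{m+m'}C_{f_i}\prod_{j\ne i}\|f_j\|_\infty\Big)P_r(l_{m'})\,\delta_r^{\,n-rk_m}.$$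 Endow $\mathbf R^d$ with the supremum norm and let $F:\mathbf R^d\times\Omega\to\mathbf R^d$. Assume: 1. $(\mathcal P_{r_0})$ holds for some real $r_0\ge1$; 2. $F$ is uniformly $\eta$-Hölder continuous in the second variable; 3. $F$ is measurable, uniformly bounded, $C^2$ in the first variable, and its first two differentials $D_1F$, $D_1^2F$ in the first variable are measurable and uniformly bounded. Put $\bar F(x)=\int_\Omega F(x,\omega)\,d\nu(\omega)$ and $\tilde F=F-\bar F$. For $\varepsilon>0$, $x\in\mathbf R^d$, $\omega\in\Omega$, let $(x_t^\varepsilon(x,\omega))_{t\ge0}$ be the continuous solution of $$\frac{dx_t^\varepsilon}{dt}=F\big(x_t^\varepsilon,T^{\lfloor t/\varepsilon\rfloor}(\omega)\big)\ \ (t\in[0,\infty)\setminus\varepsilon\mathbf N),\qquad x_0^\varepsilon=x,$$ let $(w_t(x))_{t\ge0}$ be the solution of $\frac{dw_t}{dt}=\bar F(w_t)$, $w_0=x$, and let $e_t^\varepsilon(x,\omega)=x_t^\varepsilon(x,\omega)-w_t(x)$. For $0\le s\le t$ let $R_{t,s}(x)$ be the resolvent of the equation linearized along $w(x)$, that is,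 $\partial_tR_{t,s}(x)=D\bar F(w_t(x))\,R_{t,s}(x)$ and $R_{s,s}(x)=\mathrm{Id}$ (the time-ordered exponential of $\int_s^tD\bar F(w_r(x))\,dr$), and let $$y_t^\varepsilon(x,\omega)=\frac1{\sqrt\varepsilon}\int_0^tR_{t,s}(x)\,\tilde F\big(w_s(x),T^{\lfloor s/\varepsilon\rfloor}(\omega)\big)\,ds .$$ Let $T_0>0$. Then for every real $p\in[1,\infty)$, as $\varepsilon\to0^+$, $$\sup_{0\le t\le T_0}\ \sup_{x\in\mathbf R^d}\Big\|\frac{e_t^\varepsilon(x,\cdot)}{\sqrt\varepsilon}-y_t^\varepsilon(x,\cdot)\Big\|_{L^p(\nu)}=O(\varepsilon^{1/4}).$$ If, moreover, $D_1F$ is uniformly $\eta$-Hölder continuous in the second variable, then for every real $p\in[1,\infty)$, as $\varepsilon\to0^+$, $$\sup_{0\le t\le T_0}\ \sup_{x\in\mathbf R^d}\Big\|\frac{e_t^\varepsilon(x,\cdot)}{\sqrt\varepsilon}-y_t^\varepsilon(x,\cdot)\Big\|_{L^p(\nu)}=O(\sqrt\varepsilon).$$ -/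

import Mathlib

open MeasureTheory Set Filter Topology

noncomputable section

namespace Averaging

/-- `f` is `η`-Hölder continuous. -/
def IsHolder {Ω : Type*} [MetricSpace Ω] (η : ℝ) (f : Ω → ℂ) : Prop :=
  ∃ C : ℝ, ∀ x y, ‖f x - f y‖ ≤ C * dist x y ^ η

/-- `f` is uniformly bounded. -/
def IsBdd {Ω : Type*} (f : Ω → ℂ) : Prop :=
  ∃ C : ℝ, ∀ x, ‖f x‖ ≤ C

/-- The supremum norm of a (bounded) function. -/
def supNorm {Ω : Type*} (f : Ω → ℂ) : ℝ :=
  ⨆ x, ‖f x‖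

/-- The Hölder coefficient of order `η > 0` of an `η`-Hölder continuous function; the pairs
with equal entries contribute `0 / 0 = 0` and do not change the supremum. -/
def holderCoeff {Ω : Type*} [MetricSpace Ω] (η : ℝ) (f : Ω → ℂ) : ℝ :=
  ⨆ q : Ω × Ω, ‖f q.1 - f q.2‖ / dist q.1 q.2 ^ η

/-- The covariance `E[f g] - E[f] E[g]` (no complex conjugation). -/
def cov {Ω : Type*} [MeasurableSpace Ω] (ν : Measure Ω) (f g : Ω → ℂ) : ℂ :=
  (∫ ω, f ω * g ω ∂ν) - (∫ ω, f ω ∂ν) * ∫ ω, g ω ∂ν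

/-- The multiple decorrelation property with parameter `r`, for `η`-Hölder observables.
The two (nonempty) families are `f 0, …, f m` at the times `k 0 < … < k m` and
`g 0, …, g m'` at the times `n + l 0 < … < n + l m'`. -/
def MultipleDecorrelation {Ω : Type*} [MetricSpace Ω] [MeasurableSpace Ω]
    (ν : Measure Ω) (T : Ω → Ω) (η r : ℝ) : Prop :=
  ∃ (P : Polynomial ℝ) (δ : ℝ), (∀ i, 0 ≤ P.coeff i) ∧ 0 < δ ∧ δ < 1 ∧
    ∀ (m m' : ℕ) (f : Fin (m + 1) → Ω → ℂ) (g : Fin (m' + 1) → Ω → ℂ),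
      (∀ i, IsBdd (f i) ∧ IsHolder η (f i)) → (∀ j, IsBdd (g j) ∧ IsHolder η (g j)) →
      ∀ (k : Fin (m + 1) → ℕ) (l : Fin (m' + 1) → ℕ), StrictMono k → StrictMono l →
      ∀ n : ℕ,
        ‖cov ν (fun ω => ∏ i, f i (T^[k i] ω)) (fun ω => ∏ j, g j (T^[n + l j] ω))‖ ≤
          ((∏ i, supNorm (f i)) * (∏ j, supNorm (g j))
            + (∑ i, holderCoeff η (f i) * ∏ i' ∈ Finset.univ.erase i, supNorm (f i'))
                * (∏ j, supNorm (g j))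
            + (∏ i, supNorm (f i))
                * ∑ j, holderCoeff η (g j) * ∏ j' ∈ Finset.univ.erase j, supNorm (g j'))
          * P.eval (l (Fin.last m') : ℝ) * δ ^ ((n : ℝ) - r * (k (Fin.last m) : ℝ))

/-- The differential with respect to the first parameter. -/
def D₁ {d : ℕ} {Ω : Type*} {G : Type*} [NormedAddCommGroup G] [NormedSpace ℝ G]
    (F : (Fin d → ℝ) → Ω → G) (x : Fin d → ℝ) (ω : Ω) : (Fin d → ℝ) →L[ℝ] G :=
  fderiv ℝ (fun x' => F x' ω) x

/-- `F` is uniformly `η`-Hölder continuous in the second parameter. -/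
def UniformlyHolderSnd {d : ℕ} {Ω : Type*} [MetricSpace Ω] {G : Type*} [NormedAddCommGroup G]
    (η : ℝ) (F : (Fin d → ℝ) → Ω → G) : Prop :=
  ∃ C : ℝ, ∀ x ω ω', ‖F x ω - F x ω'‖ ≤ C * dist ω ω' ^ η

/-- `F` is measurable and uniformly bounded, `C²` in the first parameter, and its first and
second differentials in the first parameter are measurable and uniformly bounded. -/
structure IsCbTwo {d : ℕ} {Ω : Type*} [MeasurableSpace Ω]
    (F : (Fin d → ℝ) → Ω → (Fin d → ℝ)) : Prop where
  measurable : Measurable fun q : (Fin d → ℝ) × Ω => F q.1 q.2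
  bounded : ∃ C : ℝ, ∀ x ω, ‖F x ω‖ ≤ C
  contDiff : ∀ ω, ContDiff ℝ 2 fun x => F x ω
  measurable_D₁ : Measurable fun q : (Fin d → ℝ) × Ω => D₁ F q.1 q.2
  bounded_D₁ : ∃ C : ℝ, ∀ x ω, ‖D₁ F x ω‖ ≤ C
  measurable_D₁D₁ : Measurable fun q : (Fin d → ℝ) × Ω => D₁ (D₁ F) q.1 q.2
  bounded_D₁D₁ : ∃ C : ℝ, ∀ x ω, ‖D₁ (D₁ F) x ω‖ ≤ C

/-- The standing hypotheses: multiple decorrelation for some `r₀ ≥ 1`, Hölder regularity of `F`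
in the second parameter and `C²`-regularity with bounds in the first one. -/
structure Hypotheses {d : ℕ} {Ω : Type*} [MetricSpace Ω] [MeasurableSpace Ω]
    (ν : Measure Ω) (T : Ω → Ω) (η : ℝ) (F : (Fin d → ℝ) → Ω → (Fin d → ℝ)) : Prop where
  decorrelation : ∃ r₀ : ℝ, 1 ≤ r₀ ∧ MultipleDecorrelation ν T η r₀
  holder : UniformlyHolderSnd η F
  cbTwo : IsCbTwo F

/-- The averaged vector field. -/
def Fbar {d : ℕ} {Ω : Type*} [MeasurableSpace Ω] (ν : Measure Ω)
    (F : (Fin d → ℝ) → Ω → (Fin d → ℝ)) (x : Fin d → ℝ) : Fin d → ℝ :=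
  ∫ ω, F x ω ∂ν

/-- The centered vector field. -/
def Ftilde {d : ℕ} {Ω : Type*} [MeasurableSpace Ω] (ν : Measure Ω)
    (F : (Fin d → ℝ) → Ω → (Fin d → ℝ)) (x : Fin d → ℝ) (ω : Ω) : Fin d → ℝ :=
  F x ω - Fbar ν F x

/-- `u` is, on `[0, ∞)`, the continuous solution of `u' = F(u, T^⌊t/ε⌋ ω)` off `εℕ`, `u(0) = x`. -/
structure IsPerturbedSolution {d : ℕ} {Ω : Type*} (T : Ω → Ω)
    (F : (Fin d → ℝ) → Ω → (Fin d → ℝ)) (ε : ℝ) (x : Fin d → ℝ) (ω : Ω)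
    (u : ℝ → (Fin d → ℝ)) : Prop where
  continuousOn : ContinuousOn u (Ici 0)
  initial : u 0 = x
  deriv : ∀ t : ℝ, 0 ≤ t → (∀ n : ℕ, t ≠ ε * n) →
    HasDerivAt u (F (u t) (T^[⌊t / ε⌋₊] ω)) t

/-- `w` is, on `[0, ∞)`, the solution of the averaged equation `w' = Fbar(w)`, `w(0) = x`. -/
structure IsAveragedSolution {d : ℕ} {Ω : Type*} [MeasurableSpace Ω] (ν : Measure Ω)
    (F : (Fin d → ℝ) → Ω → (Fin d → ℝ)) (x : Fin d → ℝ) (w : ℝ → (Fin d → ℝ)) : Prop where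
  initial : w 0 = x
  deriv : ∀ t : ℝ, 0 ≤ t → HasDerivWithinAt w (Fbar ν F (w t)) (Ici 0) t

/-- `R t s`, for `0 ≤ s ≤ t`, is the resolvent (time-ordered exponential of `∫_s^t A_r dr`) of the
linear equation `z' = A_t z`; it is `exp (∫_s^t A_r dr)` as soon as the `A_r` commute. -/
structure IsResolvent {d : ℕ} (A : ℝ → (Fin d → ℝ) →L[ℝ] (Fin d → ℝ))
    (R : ℝ → ℝ → (Fin d → ℝ) →L[ℝ] (Fin d → ℝ)) : Prop where
  diag : ∀ s : ℝ, 0 ≤ s → R s s = ContinuousLinearMap.id ℝ (Fin d → ℝ)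
  deriv : ∀ s t : ℝ, 0 ≤ s → s ≤ t →
    HasDerivWithinAt (fun t' => R t' s) ((A t).comp (R t s)) (Ici s) t

/-- `y_t^ε(x, ω) = ε^{-1/2} ∫_0^t R(t, s) Ftilde(w_s, T^⌊s/ε⌋ ω) ds`, where `w` is the averaged
trajectory started at `x` and `R` the resolvent of the equation linearized along it. -/
def yProc {d : ℕ} {Ω : Type*} [MeasurableSpace Ω] (ν : Measure Ω) (T : Ω → Ω)
    (F : (Fin d → ℝ) → Ω → (Fin d → ℝ)) (w : ℝ → (Fin d → ℝ))
    (R : ℝ → ℝ → (Fin d → ℝ) →L[ℝ] (Fin d → ℝ)) (ε t : ℝ) (ω : Ω) : Fin d → ℝ :=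
  (Real.sqrt ε)⁻¹ • ∫ s in (0 : ℝ)..t, R t s (Ftilde ν F (w s) (T^[⌊s / ε⌋₊] ω))

end Averaging

end

namespace Averaging

/-- A bounded Hölder observable, with explicit constants. -/
structure IsObservable {Ω : Type*} [MetricSpace Ω] (η Q K : ℝ) (f : Ω → ℝ) : Prop where
  bound : ∀ x, |f x| ≤ Q
  holder : ∀ x y, |f x - f y| ≤ K * dist x y ^ η

/-- Finitely many integers with minimum `0` and maximum `D` can be separated by a gap which is
long with respect to the part below it. -/
theorem exists_gap {ι : Type*} [Fintype ι] {r : ℝ} (hr : 1 ≤ r) (u : ι → ℕ) (i₀ i₁ : ι)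
    (h₀ : u i₀ = 0) (h₁ : 0 < u i₁) :
    ∃ b : ℝ, 0 ≤ b ∧ b < u i₁ ∧ ∀ i, b < u i →
      r * b + (∑ l ∈ Finset.range (Fintype.card ι), r ^ l)⁻¹ * u i₁ ≤ u i := by
  classical
  set m := Fintype.card ι with hm
  have hmpos : 0 < m := Fintype.card_pos_iff.2 ⟨i₀⟩
  have hr0 : 0 < r := by linarith
  set Z : ℕ → ℝ := fun j => ∑ l ∈ Finset.range j, r ^ l with hZ
  have hZpos : 0 < Z m := Finset.sum_pos (fun l _ => pow_pos hr0 l) ⟨0, by simpa using hmpos⟩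
  set D : ℝ := ((u i₁ : ℕ) : ℝ) with hD
  have hDpos : 0 < D := by rw [hD]; exact_mod_cast h₁
  set c : ℝ := (Z m)⁻¹ with hc
  have hcpos : 0 < c := inv_pos.2 hZpos
  set b : ℕ → ℝ := fun j => c * D * Z j with hb
  have hb_succ : ∀ j, b (j + 1) = r * b j + c * D := by
    intro j
    simp only [hb, hZ, geom_sum_succ]
    ring
  have hb_nonneg : ∀ j, 0 ≤ b j := fun j =>
    mul_nonneg (by positivity) (Finset.sum_nonneg fun l _ => (pow_pos hr0 l).le)
  have hb_mono : StrictMono b := by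
    refine strictMono_nat_of_lt_succ fun j => ?_
    simp only [hb, hZ, Finset.sum_range_succ]
    have := pow_pos hr0 j
    have : 0 < c * D * r ^ j := by positivity
    nlinarith
  have hbm : b m = D := by
    simp only [hb, hc]
    field_simp
  have hblt : ∀ j, j < m → b j < D := fun j hj => hbm ▸ hb_mono hj
  by_contra hcon
  push Not at hcon
  have key : ∀ j, j < m → j + 1 ≤ (Finset.univ.filter fun i => (u i : ℝ) ≤ b j).card := by
    intro j
    induction j with
    | zero =>
      intro _
      refine Finset.card_pos.2 ⟨i₀, ?_⟩
      simp [h₀, hb_nonneg 0]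
    | succ j ih =>
      intro hj
      have h1 := ih (by omega)
      obtain ⟨i, hi, hi'⟩ := hcon (b j) (hb_nonneg j) (hblt j (by omega))
      rw [← hb_succ] at hi'
      have : (Finset.univ.filter fun i => (u i : ℝ) ≤ b j) ⊂
          (Finset.univ.filter fun i => (u i : ℝ) ≤ b (j + 1)) := by
        refine (Finset.ssubset_iff_of_subset ?_).2 ⟨i, by simpa using hi'.le, by simpa using hi⟩
        intro x hx
        simp only [Finset.mem_filter, Finset.mem_univ, true_and] at hx ⊢
        exact hx.trans (hb_mono (Nat.lt_succ_self j)).le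
      have := Finset.card_lt_card this
      omega
  have h2 := key (m - 1) (by omega)
  have h3 : (Finset.univ.filter fun i => (u i : ℝ) ≤ b (m - 1)) = Finset.univ := by
    refine Finset.eq_univ_of_card _ (le_antisymm (Finset.card_le_univ _) ?_)
    omega
  have h4 : i₁ ∈ (Finset.univ.filter fun i => (u i : ℝ) ≤ b (m - 1)) := by rw [h3]; simp
  have h5 := hblt (m - 1) (by omega)
  simp only [Finset.mem_filter, Finset.mem_univ, true_and] at h4
  linarith

/-- A polynomial times a decaying exponential decays exponentially. -/
theorem exists_polynomial_mul_pow_le (P : Polynomial ℝ) {ρ : ℝ} (h₀ : 0 < ρ) (h₁ : ρ < 1) :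
    ∃ C : ℝ, 0 ≤ C ∧ ∀ n : ℕ, P.eval (n : ℝ) * ρ ^ n ≤ C := by
  have h : Tendsto (fun n : ℕ => P.eval (n : ℝ) * ρ ^ n) atTop (𝓝 0) := by
    have : ∀ n : ℕ, P.eval (n : ℝ) * ρ ^ n
        = ∑ i ∈ Finset.range (P.natDegree + 1), P.coeff i * ((n : ℝ) ^ i * ρ ^ n) := by
      intro n
      rw [Polynomial.eval_eq_sum_range, Finset.sum_mul]
      exact Finset.sum_congr rfl fun i _ => by ring
    simp_rw [this]
    have h0 : (0 : ℝ) = ∑ i ∈ Finset.range (P.natDegree + 1), P.coeff i * 0 := by simp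
    rw [h0]
    refine tendsto_finsetSum _ fun i _ => ?_
    exact (tendsto_pow_const_mul_const_pow_of_abs_lt_one i
      (by rw [abs_of_pos h₀]; exact h₁)).const_mul _
  obtain ⟨C, hC⟩ := h.bddAbove_range
  exact ⟨max C 0, le_max_right _ _, fun n => (hC ⟨n, rfl⟩).trans (le_max_left _ _)⟩

namespace IsObservable

variable {Ω : Type*} [MetricSpace Ω] {η : ℝ}

theorem mono {Q K Q' K' : ℝ} {f : Ω → ℝ} (h : IsObservable η Q K f) (hQ : Q ≤ Q') (hK : K ≤ K') :
    IsObservable η Q' K' f :=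
  ⟨fun x => (h.bound x).trans hQ, fun x y => (h.holder x y).trans
    (mul_le_mul_of_nonneg_right hK (Real.rpow_nonneg dist_nonneg _))⟩

theorem continuous {Q K : ℝ} {f : Ω → ℝ} (hη : 0 < η) (h : IsObservable η Q K f) :
    Continuous f := by
  rw [continuous_iff_continuousAt]
  intro x
  rw [ContinuousAt, tendsto_iff_dist_tendsto_zero]
  have h1 : Tendsto (fun y => K * dist y x ^ η) (𝓝 x) (𝓝 0) := by
    have h2 : Continuous fun y => K * dist y x ^ η :=
      continuous_const.mul ((continuous_id.dist continuous_const).rpow_const fun _ => Or.inr hη.le)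
    have := h2.tendsto x
    simpa [Real.zero_rpow hη.ne'] using this
  refine squeeze_zero (fun _ => dist_nonneg) (fun y => ?_) h1
  rw [Real.dist_eq]
  exact h.holder y x

theorem measurable [MeasurableSpace Ω] [BorelSpace Ω] {Q K : ℝ} {f : Ω → ℝ} (hη : 0 < η)
    (h : IsObservable η Q K f) : Measurable f :=
  (h.continuous hη).measurable

theorem mul {Q K Q' K' : ℝ} {f g : Ω → ℝ} (hQ : 0 ≤ Q)
    (hf : IsObservable η Q K f) (hg : IsObservable η Q' K' g) :
    IsObservable η (Q * Q') (Q * K' + Q' * K) fun x => f x * g x := by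
  refine ⟨fun x => ?_, fun x y => ?_⟩
  · rw [abs_mul]
    exact mul_le_mul (hf.bound x) (hg.bound x) (abs_nonneg _) hQ
  · have h1 : f x * g x - f y * g y = f x * (g x - g y) + g y * (f x - f y) := by ring
    rw [h1]
    refine (abs_add_le _ _).trans ?_
    rw [abs_mul, abs_mul, add_mul, mul_assoc, mul_assoc]
    exact add_le_add
      (mul_le_mul (hf.bound x) (hg.holder x y) (abs_nonneg _) hQ)
      (mul_le_mul (hg.bound y) (hf.holder x y) (abs_nonneg _) ((abs_nonneg _).trans (hg.bound y)))

theorem prod {ι : Type*} {Q K : ℝ} (hQ : 1 ≤ Q) (hK : 0 ≤ K) (s : Finset ι) (f : ι → Ω → ℝ)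
    (hf : ∀ i ∈ s, IsObservable η Q K (f i)) :
    IsObservable η (Q ^ s.card) (s.card * Q ^ s.card * K) fun x => ∏ i ∈ s, f i x := by
  classical
  induction s using Finset.induction_on with
  | empty => exact ⟨by simp, by simp⟩
  | insert a s ha ih =>
    have h1 := ih fun i hi => hf i (Finset.mem_insert_of_mem hi)
    have h2 := (hf a (Finset.mem_insert_self a s)).mul (by linarith) h1
    simp_rw [Finset.prod_insert ha, Finset.card_insert_of_notMem ha]
    refine h2.mono (by rw [pow_succ']) ?_
    push_cast
    have h3 : Q ^ s.card * K ≤ Q * Q ^ s.card * K := by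
      have : 0 ≤ Q ^ s.card * K := by positivity
      nlinarith
    rw [pow_succ']
    nlinarith

theorem supNorm_le [Nonempty Ω] {Q K : ℝ} {f : Ω → ℝ} (h : IsObservable η Q K f) :
    supNorm (fun x => (f x : ℂ)) ≤ Q :=
  ciSup_le fun x => by simpa using h.bound x

theorem holderCoeff_le [Nonempty Ω] {Q K : ℝ} {f : Ω → ℝ} (hK : 0 ≤ K)
    (h : IsObservable η Q K f) : holderCoeff η (fun x => (f x : ℂ)) ≤ K := by
  refine ciSup_le fun q => ?_
  have h1 : ‖((f q.1 : ℝ) : ℂ) - (f q.2 : ℂ)‖ = |f q.1 - f q.2| := by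
    rw [← Complex.ofReal_sub, Complex.norm_real, Real.norm_eq_abs]
  rw [h1]
  exact div_le_of_le_mul₀ (Real.rpow_nonneg dist_nonneg _) hK (h.holder _ _)

theorem isBdd {Q K : ℝ} {f : Ω → ℝ} (h : IsObservable η Q K f) : IsBdd fun x => (f x : ℂ) :=
  ⟨Q, fun x => by simpa using h.bound x⟩

theorem isHolder {Q K : ℝ} {f : Ω → ℝ} (h : IsObservable η Q K f) :
    IsHolder η fun x => (f x : ℂ) :=
  ⟨K, fun x y => by
    rw [← Complex.ofReal_sub, Complex.norm_real, Real.norm_eq_abs]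
    exact h.holder x y⟩

end IsObservable

/-- Merging the factors taken at equal times, a product of observables along an orbit becomes
a product over strictly increasing times. -/
theorem exists_strictMono_group {Ω : Type*} [MetricSpace Ω] {η Q K : ℝ} (hQ : 1 ≤ Q) (hK : 0 ≤ K)
    {ι : Type*} [Fintype ι] [Nonempty ι] (u : ι → ℕ) (f : ι → Ω → ℝ)
    (hf : ∀ i, IsObservable η Q K (f i)) {m : ℕ} (hm : Fintype.card ι ≤ m) :
    ∃ (c : ℕ) (k : Fin (c + 1) → ℕ) (g : Fin (c + 1) → Ω → ℝ), c + 1 ≤ m ∧ StrictMono k ∧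
      (∀ i, ∃ a, k i = u a) ∧ (∀ i, IsObservable η (Q ^ m) (m * Q ^ m * K) (g i)) ∧
      ∀ p : ℕ → Ω, ∏ i, g i (p (k i)) = ∏ a, f a (p (u a)) := by
  classical
  set U := Finset.univ.image u with hU
  have hUne : U.Nonempty := Finset.univ_nonempty.image u
  obtain ⟨c, hc⟩ : ∃ c, U.card = c + 1 := ⟨U.card - 1, by have := hUne.card_pos; omega⟩
  refine ⟨c, U.orderEmbOfFin hc,
    fun i x => ∏ a ∈ Finset.univ.filter (fun a => u a = U.orderEmbOfFin hc i), f a x,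
    ?_, (U.orderEmbOfFin hc).strictMono, ?_, ?_, ?_⟩
  · rw [← hc]
    exact Finset.card_image_le.trans (by simpa using hm)
  · intro i
    have := U.orderEmbOfFin_mem hc i
    obtain ⟨a, _, ha⟩ := Finset.mem_image.1 this
    exact ⟨a, ha.symm⟩
  · intro i
    set s := Finset.univ.filter (fun a => u a = U.orderEmbOfFin hc i)
    have hs : s.card ≤ m := (Finset.card_le_univ s).trans hm
    have hQs : Q ^ s.card ≤ Q ^ m := pow_le_pow_right₀ hQ hs
    refine (IsObservable.prod hQ hK s f fun a _ => hf a).mono hQs ?_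
    have hs' : (s.card : ℝ) ≤ m := by exact_mod_cast hs
    gcongr
  · intro p
    have h1 : ∏ a, f a (p (u a)) = ∏ y ∈ U, ∏ a ∈ Finset.univ.filter (fun a => u a = y), f a (p y) := by
      rw [← Finset.prod_fiberwise_of_maps_to (s := Finset.univ) (t := U) (g := u)
        (fun a _ => Finset.mem_image_of_mem u (Finset.mem_univ a))]
      refine Finset.prod_congr rfl fun y _ => Finset.prod_congr rfl fun a ha => ?_
      rw [(Finset.mem_filter.1 ha).2]
    rw [h1]
    conv_rhs => rw [← Finset.map_orderEmbOfFin_univ U hc]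
    rw [Finset.prod_map]
    rfl

end Averaging

namespace Averaging

theorem eval_nonneg_of_coeff_nonneg {P : Polynomial ℝ} (hP : ∀ i, 0 ≤ P.coeff i) {x : ℝ}
    (hx : 0 ≤ x) : 0 ≤ P.eval x := by
  rw [Polynomial.eval_eq_sum_range]
  exact Finset.sum_nonneg fun i _ => mul_nonneg (hP i) (pow_nonneg hx i)

theorem eval_mono_of_coeff_nonneg {P : Polynomial ℝ} (hP : ∀ i, 0 ≤ P.coeff i) {x y : ℝ}
    (hx : 0 ≤ x) (hxy : x ≤ y) : P.eval x ≤ P.eval y := by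
  rw [Polynomial.eval_eq_sum_range, Polynomial.eval_eq_sum_range]
  exact Finset.sum_le_sum fun i _ =>
    mul_le_mul_of_nonneg_left (pow_le_pow_left₀ hx hxy i) (hP i)

/-- The decorrelation property for products of real observables over finite families of times,
not necessarily distinct. -/
theorem MultipleDecorrelation.exists_cov_prod_le {Ω : Type*} [MetricSpace Ω] [MeasurableSpace Ω]
    [Nonempty Ω] {ν : Measure Ω} {T : Ω → Ω} {η r : ℝ}
    (hdec : MultipleDecorrelation ν T η r) (hr : 1 ≤ r) {M : ℝ} (hM : 1 ≤ M) (m : ℕ) :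
    ∃ (A : ℝ) (P : Polynomial ℝ) (δ : ℝ), 0 ≤ A ∧ (∀ i, 0 ≤ P.coeff i) ∧ 0 < δ ∧ δ < 1 ∧
      ∀ H : ℝ, 1 ≤ H → ∀ (α β : Type) [Fintype α] [Fintype β] [Nonempty α] [Nonempty β],
        Fintype.card α ≤ m → Fintype.card β ≤ m →
        ∀ (f : α → Ω → ℝ) (g : β → Ω → ℝ), (∀ a, IsObservable η M (M * H) (f a)) →
        (∀ a, IsObservable η M (M * H) (g a)) →
        ∀ (u : α → ℕ) (v : β → ℕ) (b : ℝ) (n L : ℕ), (∀ a, (u a : ℝ) ≤ b) →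
        (∀ a, n ≤ v a) → (∀ a, v a ≤ L) →
        |(∫ ω, (∏ a, f a (T^[u a] ω)) * ∏ a, g a (T^[v a] ω) ∂ν)
          - (∫ ω, ∏ a, f a (T^[u a] ω) ∂ν) * ∫ ω, ∏ a, g a (T^[v a] ω) ∂ν|
          ≤ A * H * P.eval (L : ℝ) * δ ^ ((n : ℝ) - r * b) := by
  obtain ⟨P, δ, hP, hδ0, hδ1, hmain⟩ := hdec
  set Q : ℝ := max 1 (m * M ^ m * M) with hQ
  have hQ1 : 1 ≤ Q := le_max_left _ _
  refine ⟨(1 + 2 * m) * Q ^ (2 * m), P, δ, by positivity, hP, hδ0, hδ1, ?_⟩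
  intro H hH α β _ _ _ _ hα hβ f g hf hg u v b n L hu hv hL
  have hMH : 0 ≤ M * H := by positivity
  have hm1 : 1 ≤ m := (Fintype.card_pos (α := α)).trans_le hα
  obtain ⟨c, k, f', hc, hk, hku, hf', hfp⟩ := exists_strictMono_group hM hMH u f hf hα
  obtain ⟨c', l, g', hc', hl, hlv, hg', hgp⟩ :=
    exists_strictMono_group hM hMH (fun a => v a - n) g hg hβ
  have hMQ : M ^ m ≤ Q := by
    refine le_trans ?_ (le_max_right _ _)
    have h1 : (1 : ℝ) ≤ m := by exact_mod_cast hm1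
    have h2 : (1 : ℝ) ≤ m * M := by nlinarith
    have h3 : 0 < M ^ m := by positivity
    nlinarith
  have hKQ : m * M ^ m * (M * H) ≤ Q * H := by
    rw [← mul_assoc]
    exact mul_le_mul_of_nonneg_right (le_max_right _ _) (by linarith)
  have hQH : 0 ≤ Q * H := by positivity
  have hfo : ∀ i, IsObservable η Q (Q * H) (f' i) := fun i => (hf' i).mono hMQ hKQ
  have hgo : ∀ i, IsObservable η Q (Q * H) (g' i) := fun i => (hg' i).mono hMQ hKQ
  have key := hmain c c' (fun i x => (f' i x : ℂ)) (fun i x => (g' i x : ℂ))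
    (fun i => ⟨(hfo i).isBdd, (hfo i).isHolder⟩) (fun i => ⟨(hgo i).isBdd, (hgo i).isHolder⟩)
    k l hk hl n
  have hF : ∀ ω, ∏ i, ((f' i (T^[k i] ω) : ℝ) : ℂ) = ((∏ a, f a (T^[u a] ω) : ℝ) : ℂ) := by
    intro ω
    rw [← hfp fun j => T^[j] ω]
    push_cast
    rfl
  have hG : ∀ ω, ∏ i, ((g' i (T^[n + l i] ω) : ℝ) : ℂ) = ((∏ a, g a (T^[v a] ω) : ℝ) : ℂ) := by
    intro ω
    have h1 := hgp fun j => T^[n + j] ω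
    have h2 : ∀ a, n + (v a - n) = v a := fun a => by have := hv a; omega
    simp only [h2] at h1
    rw [← h1]
    push_cast
    rfl
  have hcov : cov ν (fun ω => ∏ i, ((f' i (T^[k i] ω) : ℝ) : ℂ))
      (fun ω => ∏ i, ((g' i (T^[n + l i] ω) : ℝ) : ℂ)) =
      (((∫ ω, (∏ a, f a (T^[u a] ω)) * ∏ a, g a (T^[v a] ω) ∂ν)
          - (∫ ω, ∏ a, f a (T^[u a] ω) ∂ν) * ∫ ω, ∏ a, g a (T^[v a] ω) ∂ν : ℝ) : ℂ) := by
    simp only [cov, hF, hG, ← Complex.ofReal_mul, integral_complex_ofReal, Complex.ofReal_sub]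
  rw [hcov, Complex.norm_real, Real.norm_eq_abs] at key
  refine key.trans ?_
  have hs0 : ∀ f : Ω → ℂ, 0 ≤ supNorm f := fun f => Real.iSup_nonneg fun _ => norm_nonneg _
  have hh0 : ∀ f : Ω → ℂ, 0 ≤ holderCoeff η f := fun f => Real.iSup_nonneg fun _ =>
    div_nonneg (norm_nonneg _) (Real.rpow_nonneg dist_nonneg _)
  have hprod : ∀ {c : ℕ} (q : Fin (c + 1) → Ω → ℝ), (∀ i, IsObservable η Q (Q * H) (q i)) →
      c + 1 ≤ m → ∀ s : Finset (Fin (c + 1)),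
      ∏ i ∈ s, supNorm (fun x => (q i x : ℂ)) ≤ Q ^ s.card := by
    intro c q hq _ s
    exact (Finset.prod_le_prod (fun i _ => hs0 _) fun i _ => (hq i).supNorm_le).trans (by simp)
  have hprod' : ∀ {c : ℕ} (q : Fin (c + 1) → Ω → ℝ), (∀ i, IsObservable η Q (Q * H) (q i)) →
      c + 1 ≤ m → ∏ i, supNorm (fun x => (q i x : ℂ)) ≤ Q ^ m := by
    intro c q hq hcm
    refine (hprod q hq hcm Finset.univ).trans (pow_le_pow_right₀ hQ1 (by simpa using hcm))
  have hsum : ∀ {c : ℕ} (q : Fin (c + 1) → Ω → ℝ), (∀ i, IsObservable η Q (Q * H) (q i)) →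
      c + 1 ≤ m → ∑ i, holderCoeff η (fun x => (q i x : ℂ)) *
        ∏ i' ∈ Finset.univ.erase i, supNorm (fun x => (q i' x : ℂ)) ≤ m * (H * Q ^ m) := by
    intro c q hq hcm
    have h1 : ∀ i ∈ (Finset.univ : Finset (Fin (c + 1))), holderCoeff η (fun x => (q i x : ℂ)) *
        ∏ i' ∈ Finset.univ.erase i, supNorm (fun x => (q i' x : ℂ)) ≤ H * Q ^ m := by
      intro i _
      have h2 := hprod q hq hcm (Finset.univ.erase i)
      rw [Finset.card_erase_of_mem (Finset.mem_univ i), Finset.card_univ, Fintype.card_fin,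
        Nat.add_sub_cancel] at h2
      have h3 : Q * H * Q ^ c ≤ H * Q ^ m := by
        have h4 : Q ^ (c + 1) ≤ Q ^ m := pow_le_pow_right₀ hQ1 hcm
        rw [pow_succ] at h4
        nlinarith
      refine le_trans ?_ h3
      exact mul_le_mul ((hq i).holderCoeff_le hQH) h2
        (Finset.prod_nonneg fun _ _ => hs0 _) hQH
    refine (Finset.sum_le_sum h1).trans ?_
    rw [Finset.sum_const, Finset.card_univ, Fintype.card_fin, nsmul_eq_mul]
    have : ((c + 1 : ℕ) : ℝ) ≤ m := by exact_mod_cast hcm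
    exact mul_le_mul_of_nonneg_right this (by positivity)
  have hpre : (∏ i, supNorm (fun x => (f' i x : ℂ))) * (∏ j, supNorm (fun x => (g' j x : ℂ)))
      + (∑ i, holderCoeff η (fun x => (f' i x : ℂ)) *
          ∏ i' ∈ Finset.univ.erase i, supNorm (fun x => (f' i' x : ℂ)))
        * (∏ j, supNorm (fun x => (g' j x : ℂ)))
      + (∏ i, supNorm (fun x => (f' i x : ℂ)))
        * ∑ j, holderCoeff η (fun x => (g' j x : ℂ)) *
          ∏ j' ∈ Finset.univ.erase j, supNorm (fun x => (g' j' x : ℂ))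
      ≤ (1 + 2 * m) * Q ^ (2 * m) * H := by
    have hf1 := hprod' f' hfo hc
    have hg1 := hprod' g' hgo hc'
    have hf2 := hsum f' hfo hc
    have hg2 := hsum g' hgo hc'
    have hp0 : 0 ≤ ∏ j, supNorm (fun x => (g' j x : ℂ)) := Finset.prod_nonneg fun _ _ => hs0 _
    have hsum0 : 0 ≤ ∑ j, holderCoeff η (fun x => (g' j x : ℂ)) *
          ∏ j' ∈ Finset.univ.erase j, supNorm (fun x => (g' j' x : ℂ)) :=
      Finset.sum_nonneg fun _ _ => mul_nonneg (hh0 _) (Finset.prod_nonneg fun _ _ => hs0 _)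
    have hQm : 0 ≤ Q ^ m := by positivity
    have e1 := mul_le_mul hf1 hg1 hp0 hQm
    have e2 := mul_le_mul hf2 hg1 hp0 (by positivity)
    have e3 := mul_le_mul hf1 hg2 hsum0 hQm
    have e4 : Q ^ m * Q ^ m ≤ Q ^ m * Q ^ m * H := le_mul_of_one_le_right (by positivity) hH
    have e5 : (1 + 2 * (m : ℝ)) * Q ^ (2 * m) * H
        = Q ^ m * Q ^ m * H + m * (H * Q ^ m) * Q ^ m + Q ^ m * (m * (H * Q ^ m)) := by
      ring
    rw [e5]
    linarith
  have hlL : P.eval (l (Fin.last c') : ℝ) ≤ P.eval (L : ℝ) := by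
    refine eval_mono_of_coeff_nonneg hP (by positivity) ?_
    obtain ⟨a, ha⟩ := hlv (Fin.last c')
    have := hL a
    rw [ha]
    exact_mod_cast (Nat.sub_le _ _).trans this
  have hδ : δ ^ ((n : ℝ) - r * (k (Fin.last c) : ℝ)) ≤ δ ^ ((n : ℝ) - r * b) := by
    refine Real.rpow_le_rpow_of_exponent_ge hδ0 hδ1.le ?_
    obtain ⟨a, ha⟩ := hku (Fin.last c)
    have := hu a
    rw [ha]
    nlinarith
  have hPl : 0 ≤ P.eval (l (Fin.last c') : ℝ) := eval_nonneg_of_coeff_nonneg hP (by positivity)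
  have hPL : 0 ≤ P.eval (L : ℝ) := hPl.trans hlL
  exact mul_le_mul (mul_le_mul hpre hlL hPl (by positivity)) hδ
    (Real.rpow_nonneg hδ0.le _) (by positivity)

/-- The expectation of a product of observables along an orbit factorizes along some partition
into two blocks, up to an error which is exponentially small in the diameter of the set of times. -/
theorem MultipleDecorrelation.exists_factorization {Ω : Type*} [MetricSpace Ω] [MeasurableSpace Ω]
    [BorelSpace Ω] {ν : Measure Ω} [IsProbabilityMeasure ν] {T : Ω → Ω}
    (hT : MeasurePreserving T ν ν) {η r : ℝ} (hη : 0 < η)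
    (hdec : MultipleDecorrelation ν T η r) (hr : 1 ≤ r) {M : ℝ} (hM : 1 ≤ M) (m : ℕ) :
    ∃ C θ : ℝ, 0 ≤ C ∧ 0 < θ ∧ θ < 1 ∧
      ∀ H : ℝ, 1 ≤ H → ∀ (ι : Type) [Fintype ι] [DecidableEq ι], Fintype.card ι = m → 2 ≤ m →
        ∀ (f : ι → Ω → ℝ), (∀ a, IsObservable η M (M * H) (f a)) → ∀ k : ι → ℕ,
        ∃ (D : ℕ) (S : Finset ι), (∀ i j, k i ≤ k j + D) ∧ S.Nonempty ∧ (∃ i, i ∉ S) ∧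
          |∫ ω, ∏ i, f i (T^[k i] ω) ∂ν| ≤
            |∫ ω, ∏ i : {i // i ∈ S}, f i (T^[k i] ω) ∂ν| *
              |∫ ω, ∏ i : {i // i ∉ S}, f i (T^[k i] ω) ∂ν| + C * H * θ ^ D := by
  classical
  have hne : Nonempty Ω := nonempty_of_isProbabilityMeasure ν
  obtain ⟨A, P, δ, hA, hP, hδ0, hδ1, hcov⟩ := hdec.exists_cov_prod_le hr hM m
  set Z : ℝ := ∑ l ∈ Finset.range m, r ^ l with hZ
  have hZ0 : 0 ≤ Z := Finset.sum_nonneg fun l _ => by positivity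
  -- a strictly positive rate, also for `m = 0`
  set c : ℝ := (max Z 1)⁻¹ with hc
  have hcpos : 0 < c := by positivity
  set θ : ℝ := δ ^ (c / 2) with hθ
  have hθ0 : 0 < θ := Real.rpow_pos_of_pos hδ0 _
  have hθ1 : θ < 1 := Real.rpow_lt_one hδ0.le hδ1 (by positivity)
  obtain ⟨B, hB0, hB⟩ := exists_polynomial_mul_pow_le P hθ0 hθ1
  refine ⟨max (A * B) (M ^ m), θ, le_trans (by positivity) (le_max_left _ _), hθ0, hθ1, ?_⟩
  intro H hH ι _ _ hcard hm2 f hf k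
  have hι : Nonempty ι := Fintype.card_pos_iff.1 (by omega)
  obtain ⟨i₀, hi₀⟩ := Finite.exists_min k
  obtain ⟨i₁, hi₁⟩ := Finite.exists_max k
  set u : ι → ℕ := fun i => k i - k i₀ with hu
  have hku : ∀ i, k i = u i + k i₀ := fun i => by have := hi₀ i; simp only [hu]; omega
  have hfm : ∀ i, Measurable (f i) := fun i => (hf i).measurable hη
  have hTm : ∀ j, Measurable T^[j] := fun j => hT.measurable.iterate j
  -- stationarity
  have hst : ∀ (α : Type) [Fintype α] (q : α → ι), ∫ ω, ∏ a, f (q a) (T^[k (q a)] ω) ∂ν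
      = ∫ ω, ∏ a, f (q a) (T^[u (q a)] ω) ∂ν := by
    intro α _ q
    have hmeas : Measurable fun ω => ∏ a, f (q a) (T^[u (q a)] ω) :=
      Finset.measurable_prod _ fun a _ => (hfm _).comp (hTm _)
    conv_rhs => rw [← (hT.iterate (k i₀)).map_eq]
    rw [integral_map (hTm _).aemeasurable hmeas.aestronglyMeasurable]
    simp_rw [← Function.iterate_add_apply, ← hku]
  refine ⟨u i₁, ?_⟩
  have hD : ∀ i j, k i ≤ k j + u i₁ := by
    intro i j
    have h1 := hi₁ i
    have h2 := hi₀ j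
    have h3 := hku i₁
    omega
  rcases Nat.eq_zero_or_pos (u i₁) with h0 | h0
  · refine ⟨{i₀}, hD, ⟨i₀, by simp⟩, ?_, ?_⟩
    · by_contra hcon
      push Not at hcon
      have : Fintype.card ι ≤ 1 := Fintype.card_le_one_iff.2 fun a b => by
        rw [Finset.mem_singleton.1 (hcon a), Finset.mem_singleton.1 (hcon b)]
      omega
    · rw [h0, pow_zero, mul_one]
      have h1 : |∫ ω, ∏ i, f i (T^[k i] ω) ∂ν| ≤ M ^ m := by
        rw [← Real.norm_eq_abs]
        refine (norm_integral_le_of_norm_le_const (C := M ^ m) (ae_of_all _ fun ω => ?_)).trans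
          (by simp)
        rw [Real.norm_eq_abs, Finset.abs_prod, ← hcard, ← Finset.card_univ, ← Finset.prod_const]
        exact Finset.prod_le_prod (fun _ _ => abs_nonneg _) fun i _ => (hf i).bound _
      have h2 : M ^ m ≤ max (A * B) (M ^ m) * H :=
        (le_max_right _ _).trans (le_mul_of_one_le_right (le_trans (by positivity)
          (le_max_right _ _)) hH)
      exact h1.trans (h2.trans (le_add_of_nonneg_left (by positivity)))
  · obtain ⟨b, hb0, hb1, hb2⟩ := exists_gap hr u i₀ i₁ (by simp [hu]) h0
    set S : Finset ι := Finset.univ.filter fun i => (u i : ℝ) ≤ b with hS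
    have hi₀S : i₀ ∈ S := by simp [hS, hu, hb0]
    have hi₁S : i₁ ∉ S := by simpa [hS] using hb1
    refine ⟨S, hD, ⟨i₀, hi₀S⟩, ⟨i₁, hi₁S⟩, ?_⟩
    have : Nonempty {i // i ∈ S} := ⟨⟨i₀, hi₀S⟩⟩
    have : Nonempty {i // i ∉ S} := ⟨⟨i₁, hi₁S⟩⟩
    obtain ⟨j, hj⟩ := Finite.exists_min fun i : {i // i ∉ S} => u i
    have hjb : b < u j := by simpa [hS] using j.2
    have key := hcov H hH {i // i ∈ S} {i // i ∉ S}
      ((Fintype.card_subtype_le _).trans hcard.le) ((Fintype.card_subtype_le _).trans hcard.le)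
      (fun i => f i) (fun i => f i) (fun i => hf i) (fun i => hf i)
      (fun i => u i) (fun i => u i) b (u j) (u i₁)
      (fun i => (Finset.mem_filter.1 i.2).2) (fun i => hj i)
      (fun i => by have := hi₁ i; simp only [hu]; omega)
    have hsplit : ∀ ω, (∏ i : {i // i ∈ S}, f i (T^[u i] ω)) * ∏ i : {i // i ∉ S}, f i (T^[u i] ω)
        = ∏ i, f i (T^[u i] ω) := by
      intro ω
      convert Fintype.prod_subtype_mul_prod_subtype (fun i => i ∈ S) fun i => f i (T^[u i] ω)
    simp only [hsplit] at key
    have hst₀ := hst ι id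
    simp only [id] at hst₀
    rw [hst₀, hst {i // i ∈ S} (fun i => i), hst {i // i ∉ S} (fun i => i), ← abs_mul]
    have h1 : A * H * P.eval ((u i₁ : ℕ) : ℝ) * δ ^ (((u j : ℕ) : ℝ) - r * b)
        ≤ max (A * B) (M ^ m) * H * θ ^ u i₁ := by
      have h2 : δ ^ (((u j : ℕ) : ℝ) - r * b) ≤ θ ^ u i₁ * θ ^ u i₁ := by
        have h3 : θ ^ u i₁ * θ ^ u i₁ = δ ^ (c * u i₁) := by
          rw [← Real.rpow_natCast, hθ, ← Real.rpow_mul hδ0.le, ← Real.rpow_add hδ0]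
          congr 1
          ring
        rw [h3]
        refine Real.rpow_le_rpow_of_exponent_ge hδ0 hδ1.le ?_
        have h4 := hb2 j hjb
        rw [hcard, ← hZ] at h4
        have h5 : c = Z⁻¹ := by
          rw [hc, max_eq_left]
          have : r ^ 0 ≤ Z := Finset.single_le_sum (f := fun l => r ^ l)
            (fun l _ => by positivity) (Finset.mem_range.2 (by omega))
          simpa using this
        rw [h5]
        linarith
      have hPn : 0 ≤ P.eval ((u i₁ : ℕ) : ℝ) := eval_nonneg_of_coeff_nonneg hP (by positivity)
      have h4 := hB (u i₁)
      calc A * H * P.eval ((u i₁ : ℕ) : ℝ) * δ ^ (((u j : ℕ) : ℝ) - r * b)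
          ≤ A * H * P.eval ((u i₁ : ℕ) : ℝ) * (θ ^ u i₁ * θ ^ u i₁) := by gcongr
        _ = A * H * (P.eval ((u i₁ : ℕ) : ℝ) * θ ^ u i₁) * θ ^ u i₁ := by ring
        _ ≤ A * H * B * θ ^ u i₁ := by gcongr
        _ = A * B * H * θ ^ u i₁ := by ring
        _ ≤ _ := by gcongr; exact le_max_left _ _
    have h6 := key.trans h1
    have h7 := abs_sub_abs_le_abs_sub (∫ ω, ∏ i, f i (T^[u i] ω) ∂ν)
      ((∫ ω, ∏ i : {i // i ∈ S}, f i (T^[u i] ω) ∂ν) * ∫ ω, ∏ i : {i // i ∉ S}, f i (T^[u i] ω) ∂ν)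
    linarith

end Averaging

namespace Averaging

theorem exists_sum_pow_natAbs_le {ρ : ℝ} (h₀ : 0 < ρ) (h₁ : ρ < 1) :
    ∃ G : ℝ, 0 ≤ G ∧ ∀ (N : ℕ) (a : ℤ), ∑ b : Fin N, ρ ^ ((b : ℤ) - a).natAbs ≤ G := by
  have hs : Summable fun j : ℤ => ρ ^ j.natAbs :=
    Summable.of_nat_of_neg (by simpa using summable_geometric_of_lt_one h₀.le h₁)
      (by simpa using summable_geometric_of_lt_one h₀.le h₁)
  refine ⟨∑' j : ℤ, ρ ^ j.natAbs, tsum_nonneg fun _ => by positivity, fun N a => ?_⟩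
  let e : Fin N ↪ ℤ := ⟨fun b => (b : ℤ) - a, fun b b' h => by
    have h' : (b : ℤ) - a = (b' : ℤ) - a := h
    exact Fin.ext (by omega)⟩
  have h := hs.sum_le_tsum (Finset.univ.map e) fun _ _ => by positivity
  rw [Finset.sum_map] at h
  exact h

theorem exists_sum_pow_diam_le (m : ℕ) {θ : ℝ} (h₀ : 0 < θ) (h₁ : θ < 1) :
    ∃ W : ℝ, 0 ≤ W ∧ ∀ (ι : Type) [Fintype ι] [DecidableEq ι] [Nonempty ι],
      Fintype.card ι = m → ∀ (N : ℕ)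
      (D : (ι → Fin N) → ℕ), (∀ k i j, (k i : ℕ) ≤ k j + D k) →
      ∑ k : ι → Fin N, θ ^ D k ≤ W * N := by
  classical
  rcases Nat.eq_zero_or_pos m with hm | hm
  · refine ⟨0, le_rfl, fun ι _ _ _ hc => ?_⟩
    exact absurd (hc.trans hm) Fintype.card_ne_zero
  set ρ : ℝ := θ ^ ((m : ℝ)⁻¹) with hρ
  have hρ0 : 0 < ρ := Real.rpow_pos_of_pos h₀ _
  have hρ1 : ρ < 1 := Real.rpow_lt_one h₀.le h₁ (by positivity)
  have hρm : ρ ^ m = θ := by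
    rw [hρ, ← Real.rpow_natCast, ← Real.rpow_mul h₀.le, inv_mul_cancel₀ (by positivity),
      Real.rpow_one]
  obtain ⟨G, hG0, hG⟩ := exists_sum_pow_natAbs_le hρ0 hρ1
  refine ⟨G ^ m, by positivity, ?_⟩
  intro ι _ _ _ hcard N D hD
  obtain ⟨i₀⟩ := ‹Nonempty ι›
  have h1 : ∀ k : ι → Fin N, θ ^ D k ≤ ∑ a : Fin N, ∏ i, ρ ^ ((k i : ℤ) - (a : ℤ)).natAbs := by
    intro k
    have h2 : θ ^ D k ≤ ∏ i, ρ ^ ((k i : ℤ) - (k i₀ : ℤ)).natAbs := by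
      have h3 : ∏ _i : ι, ρ ^ D k = θ ^ D k := by
        rw [Finset.prod_const, Finset.card_univ, hcard, ← pow_mul, mul_comm, pow_mul, hρm]
      rw [← h3]
      refine Finset.prod_le_prod (fun _ _ => by positivity) fun i _ => ?_
      refine pow_le_pow_of_le_one hρ0.le hρ1.le ?_
      have h4 := hD k i i₀
      have h5 := hD k i₀ i
      omega
    exact h2.trans (Finset.single_le_sum
      (f := fun a : Fin N => ∏ i, ρ ^ ((k i : ℤ) - (a : ℤ)).natAbs)
      (fun a _ => Finset.prod_nonneg fun _ _ => by positivity) (Finset.mem_univ (k i₀)))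
  calc ∑ k : ι → Fin N, θ ^ D k
      ≤ ∑ k : ι → Fin N, ∑ a : Fin N, ∏ i, ρ ^ ((k i : ℤ) - (a : ℤ)).natAbs :=
        Finset.sum_le_sum fun k _ => h1 k
    _ = ∑ a : Fin N, ∏ _i : ι, ∑ b : Fin N, ρ ^ ((b : ℤ) - (a : ℤ)).natAbs := by
        rw [Finset.sum_comm]
        refine Finset.sum_congr rfl fun a _ => ?_
        rw [Finset.prod_univ_sum, Fintype.piFinset_univ]
    _ ≤ ∑ _a : Fin N, ∏ _i : ι, G := by
        refine Finset.sum_le_sum fun a _ => Finset.prod_le_prod (fun _ _ => ?_) fun _ _ => hG N a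
        exact Finset.sum_nonneg fun _ _ => by positivity
    _ = G ^ m * N := by
        simp [hcard, mul_comm]

/-- Summability of the multiple correlations of centered observables. -/
theorem MultipleDecorrelation.exists_sum_abs_integral_prod_le {Ω : Type*} [MetricSpace Ω]
    [MeasurableSpace Ω] [BorelSpace Ω] {ν : Measure Ω} [IsProbabilityMeasure ν] {T : Ω → Ω}
    (hT : MeasurePreserving T ν ν) {η r : ℝ} (hη : 0 < η)
    (hdec : MultipleDecorrelation ν T η r) (hr : 1 ≤ r) {M : ℝ} (hM : 1 ≤ M) (m : ℕ) :
    ∃ C : ℝ, 0 ≤ C ∧ ∀ H : ℝ, 1 ≤ H → ∀ N : ℕ, 1 ≤ N → ∀ (ι : Type) [Fintype ι] [DecidableEq ι],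
      Fintype.card ι = m → ∀ f : ι → ℕ → Ω → ℝ, (∀ i j, IsObservable η M (M * H) (f i j)) →
      (∀ i j, ∫ ω, f i j ω ∂ν = 0) →
      ∑ k : ι → Fin N, |∫ ω, ∏ i, f i (k i) (T^[k i] ω) ∂ν| ≤ C * (N * H) ^ (m / 2) := by
  classical
  induction m using Nat.strong_induction_on with
  | _ m ih =>
    rcases Nat.lt_or_ge m 2 with hm | hm
    · interval_cases m
      · refine ⟨1, zero_le_one, fun H _ N _ ι _ _ hcard f _ _ => ?_⟩
        have := Fintype.card_eq_zero_iff.1 hcard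
        simp
      · refine ⟨0, le_rfl, fun H _ N _ ι _ _ hcard f hf hf0 => ?_⟩
        obtain ⟨i₀, hi₀⟩ := Fintype.card_eq_one_iff.1 hcard
        have : Unique ι := ⟨⟨i₀⟩, hi₀⟩
        have h1 : ∀ k : ι → Fin N, ∫ ω, ∏ i, f i (k i) (T^[k i] ω) ∂ν = 0 := by
          intro k
          simp only [Fintype.prod_unique]
          rw [← hf0 default (k default)]
          conv_rhs => rw [← (hT.iterate (k default)).map_eq]
          rw [integral_map (hT.iterate _).measurable.aemeasurable
            ((hf _ _).measurable hη).aestronglyMeasurable]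
        rw [Finset.sum_congr rfl fun k _ => by rw [h1 k, abs_zero]]
        simp
    · choose! Cs hCs0 hCs using ih
      obtain ⟨C, θ, hC0, hθ0, hθ1, hfac⟩ := hdec.exists_factorization hT hη hr hM m
      obtain ⟨W, hW0, hW⟩ := exists_sum_pow_diam_le m hθ0 hθ1
      set K : ℝ := ∑ j ∈ Finset.range m, Cs j with hK
      have hCs_le : ∀ j, j < m → Cs j ≤ K := fun j hj =>
        Finset.single_le_sum (f := Cs) (fun i hi => hCs0 i (Finset.mem_range.1 hi))
          (Finset.mem_range.2 hj)
      have hK0 : 0 ≤ K := Finset.sum_nonneg fun i hi => hCs0 i (Finset.mem_range.1 hi)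
      refine ⟨2 ^ m * (K * K) + C * W, by positivity, ?_⟩
      intro H hH N hN ι _ _ hcard f hf hf0
      have hNH : 1 ≤ (N : ℝ) * H := by
        have : (1 : ℝ) ≤ N := by exact_mod_cast hN
        nlinarith
      have hι : Nonempty ι := Fintype.card_pos_iff.1 (by omega)
      have hsel : ∀ k : ι → Fin N, _ := fun k =>
        hfac H hH ι hcard hm (fun i => f i (k i)) (fun i => hf i (k i)) (fun i => k i)
      choose D S hD hSne hSc hbd using hsel
      set E : Finset ι → (ι → Fin N) → ℝ := fun S k =>
        |∫ ω, ∏ i : {i // i ∈ S}, f i (k i) (T^[k i] ω) ∂ν| *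
          |∫ ω, ∏ i : {i // i ∉ S}, f i (k i) (T^[k i] ω) ∂ν| with hE
      set good : Finset (Finset ι) :=
        Finset.univ.filter fun S => S.Nonempty ∧ ∃ i, i ∉ S with hgood
      have h1 : ∀ k : ι → Fin N, |∫ ω, ∏ i, f i (k i) (T^[k i] ω) ∂ν| ≤
          ∑ S ∈ good, E S k + C * H * θ ^ D k := by
        intro k
        refine (hbd k).trans (add_le_add_left ?_ _)
        refine Finset.single_le_sum (f := fun S => E S k)
          (fun S _ => mul_nonneg (abs_nonneg _) (abs_nonneg _)) ?_
        simp [hgood, hSne k, hSc k]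
      have h2 : ∀ S ∈ good, ∑ k : ι → Fin N, E S k ≤ K * K * (N * H) ^ (m / 2) := by
        intro S hS
        obtain ⟨hS1, i, hS2⟩ : S.Nonempty ∧ ∃ i, i ∉ S := by simpa [hgood] using hS
        have hc1 : Fintype.card {i // i ∈ S} = S.card := Fintype.card_coe S
        have hlt : S.card < m := hcard ▸ Finset.card_lt_univ_of_notMem hS2
        have hc2 : Fintype.card {i // i ∉ S} = m - S.card := by
          rw [Fintype.card_subtype_compl, hcard, hc1]
        have hpos := hS1.card_pos
        have e1 := hCs S.card hlt H hH N hN {i // i ∈ S} hc1 (fun i => f i)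
          (fun i => hf i) fun i => hf0 i
        have e2 := hCs (m - S.card) (by omega) H hH N hN {i // i ∉ S} hc2 (fun i => f i)
          (fun i => hf i) fun i => hf0 i
        have e3 : ∑ k : ι → Fin N, E S k =
            (∑ k : {i // i ∈ S} → Fin N, |∫ ω, ∏ i : {i // i ∈ S}, f i (k i) (T^[k i] ω) ∂ν|) *
              ∑ k : {i // i ∉ S} → Fin N, |∫ ω, ∏ i : {i // i ∉ S}, f i (k i) (T^[k i] ω) ∂ν| := by
          rw [Finset.sum_mul_sum, ← Fintype.sum_prod_type']
          exact Fintype.sum_equiv (Equiv.piEquivPiSubtypeProd (fun i => i ∈ S) fun _ => Fin N)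
            _ _ fun k => rfl
        rw [e3]
        have hp1 : (S.card / 2) + ((m - S.card) / 2) ≤ m / 2 := by omega
        calc _ ≤ (Cs S.card * (N * H) ^ (S.card / 2)) *
              (Cs (m - S.card) * (N * H) ^ ((m - S.card) / 2)) :=
              mul_le_mul e1 e2 (Finset.sum_nonneg fun _ _ => abs_nonneg _)
                (mul_nonneg (hCs0 _ hlt) (by positivity))
          _ = Cs S.card * Cs (m - S.card) * (N * H) ^ (S.card / 2 + (m - S.card) / 2) := by
              rw [pow_add]; ring
          _ ≤ K * K * (N * H) ^ (m / 2) := by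
              have := hCs0 _ hlt
              have := hCs0 (m - S.card) (by omega)
              have := hCs_le _ hlt
              have := hCs_le (m - S.card) (by omega)
              have := pow_le_pow_right₀ hNH hp1
              gcongr
      have hgc : (good.card : ℝ) ≤ 2 ^ m := by
        have : good.card ≤ 2 ^ m := by
          rw [← hcard, ← Fintype.card_finset]
          exact Finset.card_le_univ _
        exact_mod_cast this
      calc ∑ k : ι → Fin N, |∫ ω, ∏ i, f i (k i) (T^[k i] ω) ∂ν|
          ≤ ∑ k : ι → Fin N, (∑ S ∈ good, E S k + C * H * θ ^ D k) :=
            Finset.sum_le_sum fun k _ => h1 k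
        _ = ∑ S ∈ good, ∑ k : ι → Fin N, E S k + C * H * ∑ k : ι → Fin N, θ ^ D k := by
            rw [Finset.sum_add_distrib, Finset.sum_comm, Finset.mul_sum]
        _ ≤ ∑ S ∈ good, K * K * (N * H) ^ (m / 2) + C * H * (W * N) := by
            have := hW ι hcard N D hD
            have := Finset.sum_le_sum h2
            gcongr
        _ = good.card * (K * K * (N * H) ^ (m / 2)) + C * W * (N * H) ^ 1 := by
            rw [Finset.sum_const, nsmul_eq_mul]; ring
        _ ≤ 2 ^ m * (K * K * (N * H) ^ (m / 2)) + C * W * (N * H) ^ (m / 2) := by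
            have : ((N : ℝ) * H) ^ 1 ≤ (N * H) ^ (m / 2) := pow_le_pow_right₀ hNH (by omega)
            gcongr
        _ = _ := by ring

/-- Bounded measurable functions along an orbit have integrable products. -/
theorem integrable_prod_observable {Ω : Type*} [MetricSpace Ω] [MeasurableSpace Ω] [BorelSpace Ω]
    {ν : Measure Ω} [IsProbabilityMeasure ν] {T : Ω → Ω} (hT : Measurable T) {η Q K : ℝ}
    (hη : 0 < η) {ι : Type*} [Fintype ι] (f : ι → Ω → ℝ) (hf : ∀ i, IsObservable η Q K (f i))
    (k : ι → ℕ) : Integrable (fun ω => ∏ i, f i (T^[k i] ω)) ν := by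
  refine Integrable.of_bound (C := Q ^ Fintype.card ι)
    (Finset.measurable_prod _ fun i _ =>
      ((hf i).measurable hη).comp (hT.iterate _)).aestronglyMeasurable (ae_of_all _ fun ω => ?_)
  rw [Real.norm_eq_abs, Finset.abs_prod, ← Finset.card_univ, ← Finset.prod_const]
  exact Finset.prod_le_prod (fun _ _ => abs_nonneg _) fun i _ => (hf i).bound _

section Moments

variable {Ω : Type*} [MetricSpace Ω] [MeasurableSpace Ω] [BorelSpace Ω] {ν : Measure Ω}
  [IsProbabilityMeasure ν] {T : Ω → Ω} {η r M : ℝ}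

/-- Moments of Birkhoff-type sums of centered observables. -/
theorem MultipleDecorrelation.exists_moment_sum_le
    (hT : MeasurePreserving T ν ν) (hη : 0 < η)
    (hdec : MultipleDecorrelation ν T η r) (hr : 1 ≤ r) (hM : 1 ≤ M) (q : ℕ) :
    ∃ C : ℝ, 0 ≤ C ∧ ∀ H : ℝ, 1 ≤ H → ∀ N : ℕ, 1 ≤ N → ∀ f : ℕ → Ω → ℝ,
      (∀ j, IsObservable η M (M * H) (f j)) → (∀ j, ∫ ω, f j ω ∂ν = 0) →
      ∫ ω, (∑ k ∈ Finset.range N, f k (T^[k] ω)) ^ (2 * q) ∂ν ≤ C * (N * H) ^ q := by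
  obtain ⟨C, hC0, hC⟩ := hdec.exists_sum_abs_integral_prod_le hT hη hr hM (2 * q)
  refine ⟨C, hC0, fun H hH N hN f hf hf0 => ?_⟩
  have h1 := hC H hH N hN (Fin (2 * q)) (by simp) (fun _ => f) (fun _ => hf) fun _ => hf0
  rw [Nat.mul_div_cancel_left q (by norm_num)] at h1
  refine le_trans ?_ h1
  simp_rw [Finset.sum_range, Fintype.sum_pow]
  rw [integral_finsetSum _ fun k _ => integrable_prod_observable hT.measurable hη
    (fun i => f (k i)) (fun i => hf _) fun i => k i]
  exact Finset.sum_le_sum fun k _ => le_abs_self _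

/-- Moments of iterated sums of centered observables. -/
theorem MultipleDecorrelation.exists_moment_iterated_sum_le
    (hT : MeasurePreserving T ν ν) (hη : 0 < η)
    (hdec : MultipleDecorrelation ν T η r) (hr : 1 ≤ r) (hM : 1 ≤ M) (q : ℕ) :
    ∃ C : ℝ, 0 ≤ C ∧ ∀ H : ℝ, 1 ≤ H → ∀ N : ℕ, 1 ≤ N → ∀ f g : ℕ → Ω → ℝ,
      (∀ j, IsObservable η M (M * H) (f j)) → (∀ j, ∫ ω, f j ω ∂ν = 0) →
      (∀ j, IsObservable η M (M * H) (g j)) → (∀ j, ∫ ω, g j ω ∂ν = 0) →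
      ∫ ω, (∑ k ∈ Finset.range N, g k (T^[k] ω) * ∑ l ∈ Finset.range k, f l (T^[l] ω)) ^ (2 * q) ∂ν
        ≤ C * (N * H) ^ (2 * q) := by
  classical
  obtain ⟨C, hC0, hC⟩ := hdec.exists_sum_abs_integral_prod_le hT hη hr hM (2 * (2 * q))
  refine ⟨C, hC0, fun H hH N hN f g hf hf0 hg hg0 => ?_⟩
  set n := 2 * q with hn
  set F : Fin n ⊕ Fin n → ℕ → Ω → ℝ := Sum.elim (fun _ => g) fun _ => f with hF
  have hFo : ∀ i j, IsObservable η M (M * H) (F i j) := by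
    rintro (i | i) j
    · exact hg j
    · exact hf j
  have hF0 : ∀ i j, ∫ ω, F i j ω ∂ν = 0 := by
    rintro (i | i) j
    · exact hg0 j
    · exact hf0 j
  have h1 := hC H hH N hN (Fin n ⊕ Fin n) (by simp; omega) F hFo hF0
  rw [Nat.mul_div_cancel_left n (by norm_num)] at h1
  refine le_trans ?_ h1
  set c : Fin N × Fin N → ℝ := fun p => if p.2 < p.1 then 1 else 0 with hc
  have hsum : ∀ ω, ∑ k ∈ Finset.range N, g k (T^[k] ω) * ∑ l ∈ Finset.range k, f l (T^[l] ω)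
      = ∑ p : Fin N × Fin N, c p * (g p.1 (T^[p.1] ω) * f p.2 (T^[p.2] ω)) := by
    intro ω
    rw [Finset.sum_range, Fintype.sum_prod_type]
    refine Finset.sum_congr rfl fun k _ => ?_
    have h2 : ∑ l ∈ Finset.range (k : ℕ), f l (T^[l] ω)
        = ∑ l : Fin N, if l < k then f l (T^[l] ω) else 0 := by
      have h3 : Finset.range (k : ℕ) = (Finset.range N).filter fun l => l < (k : ℕ) := by
        ext l
        simp only [Finset.mem_range, Finset.mem_filter]
        have := k.2
        omega
      rw [h3, Finset.sum_filter, Finset.sum_range]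
      rfl
    rw [h2, Finset.mul_sum]
    refine Finset.sum_congr rfl fun l _ => ?_
    simp only [hc]
    split_ifs <;> simp
  simp_rw [hsum, Fintype.sum_pow]
  set e : (Fin n → Fin N × Fin N) ≃ (Fin n ⊕ Fin n → Fin N) :=
    (Equiv.arrowProdEquivProdArrow (Fin n) (fun _ => Fin N) (fun _ => Fin N)).trans
      (Equiv.sumArrowEquivProdArrow (Fin n) (Fin n) (Fin N)).symm with he
  have hprod : ∀ (p : Fin n → Fin N × Fin N) ω,
      ∏ i, c (p i) * (g (p i).1 (T^[(p i).1] ω) * f (p i).2 (T^[(p i).2] ω))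
        = (∏ i, c (p i)) * ∏ i, F i (e p i) (T^[e p i] ω) := by
    intro p ω
    rw [Finset.prod_mul_distrib, Finset.prod_mul_distrib, Fintype.prod_sum_type]
    rfl
  simp_rw [hprod]
  have hint : ∀ p, Integrable (fun ω => ∏ i, F i (e p i) (T^[e p i] ω)) ν := fun p =>
    integrable_prod_observable hT.measurable hη (fun i => F i (e p i)) (fun i => hFo _ _)
      fun i => e p i
  rw [integral_finsetSum _ fun p _ => (hint p).const_mul _,
    ← e.sum_comp fun k => |∫ ω, ∏ i, F i (k i) (T^[k i] ω) ∂ν|]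
  refine Finset.sum_le_sum fun p _ => ?_
  rw [integral_const_mul]
  refine (le_abs_self _).trans ?_
  rw [abs_mul]
  refine mul_le_of_le_one_left (abs_nonneg _) ?_
  rw [Finset.abs_prod]
  refine Finset.prod_le_one (fun _ _ => abs_nonneg _) fun i _ => ?_
  simp only [hc]
  split_ifs <;> simp

end Moments

end Averaging

namespace Averaging

section

variable {Ω : Type*} [MeasurableSpace Ω] {T : Ω → Ω} {ε t : ℝ}

/-- The integral of a time-dependent observable along the slowed-down orbit. -/
noncomputable def orbitIntegral (T : Ω → Ω) (ε : ℝ) (φ : ℝ → Ω → ℝ) (t : ℝ) (ω : Ω) : ℝ :=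
  ∫ s in (0 : ℝ)..t, φ s (T^[⌊s / ε⌋₊] ω)

/-- The iterated integral of two time-dependent observables along the slowed-down orbit. -/
noncomputable def orbitIteratedIntegral (T : Ω → Ω) (ε : ℝ) (φ ψ : ℝ → Ω → ℝ) (t : ℝ) (ω : Ω) : ℝ :=
  ∫ s in (0 : ℝ)..t, ψ s (T^[⌊s / ε⌋₊] ω) * orbitIntegral T ε φ s ω

/-- The `k`-th point of the subdivision of `[0, t]` of step `ε`. -/
noncomputable def cellEnd (ε t : ℝ) (k : ℕ) : ℝ := min (k * ε) t

/-- The normalized integral over the `k`-th cell of the subdivision of `[0, t]` of step `ε`. -/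
noncomputable def cellAvg (ε t : ℝ) (φ : ℝ → Ω → ℝ) (k : ℕ) (ω : Ω) : ℝ :=
  ε⁻¹ * ∫ s in cellEnd ε t k..cellEnd ε t (k + 1), φ s ω

theorem cellEnd_zero (ht : 0 ≤ t) : cellEnd ε t 0 = 0 := by simp [cellEnd, ht]

theorem cellEnd_eq_of_le {k : ℕ} (h : t ≤ k * ε) : cellEnd ε t k = t := min_eq_right h

theorem cellEnd_mono (hε : 0 ≤ ε) (k : ℕ) : cellEnd ε t k ≤ cellEnd ε t (k + 1) := by
  unfold cellEnd
  refine min_le_min_right _ ?_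
  push_cast
  nlinarith

theorem cellEnd_sub_le (hε : 0 ≤ ε) (k : ℕ) : cellEnd ε t (k + 1) - cellEnd ε t k ≤ ε := by
  unfold cellEnd
  push_cast
  rcases le_total (k * ε) t with h | h
  · rw [min_eq_left h]
    have := min_le_left (((k : ℝ) + 1) * ε) t
    linarith
  · rw [min_eq_right h]
    have := min_le_right (((k : ℝ) + 1) * ε) t
    linarith

theorem floor_eq_of_mem_cell (hε : 0 < ε) {k : ℕ} {s : ℝ}
    (hs : s ∈ Ioo (cellEnd ε t k) (cellEnd ε t (k + 1))) : ⌊s / ε⌋₊ = k := by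
  obtain ⟨h1, h2⟩ := hs
  unfold cellEnd at h1 h2
  push_cast at h2
  have h3 := h2.trans_le (min_le_left _ _)
  have h4 := h2.trans_le (min_le_right _ _)
  have h5 : k * ε < s := by
    rcases le_total (k * ε) t with h | h
    · rwa [min_eq_left h] at h1
    · rw [min_eq_right h] at h1; linarith
  have h0 : 0 ≤ s / ε := div_nonneg (le_trans (by positivity) h5.le) hε.le
  rw [Nat.floor_eq_iff h0]
  exact ⟨(le_div_iff₀ hε).2 h5.le, (div_lt_iff₀ hε).2 h3⟩

theorem measurable_orbit (hT : Measurable T) (ε : ℝ) :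
    Measurable fun p : ℝ × Ω => T^[⌊p.1 / ε⌋₊] p.2 := by
  have h1 : Measurable fun p : ℕ × Ω => T^[p.1] p.2 :=
    measurable_from_prod_countable_right fun n => hT.iterate n
  exact h1.comp (((Nat.measurable_floor.comp (measurable_fst.div_const ε))).prodMk measurable_snd)

theorem measurable_along_orbit {G : Type*} [MeasurableSpace G] {φ : ℝ → Ω → G}
    (hT : Measurable T) (hφ : Measurable (Function.uncurry φ)) (ε : ℝ) :
    Measurable fun p : ℝ × Ω => φ p.1 (T^[⌊p.1 / ε⌋₊] p.2) :=
  hφ.comp (measurable_fst.prodMk (measurable_orbit hT ε))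

theorem intervalIntegrable_of_bounded {G : Type*} [NormedAddCommGroup G] {f : ℝ → G}
    {C a b : ℝ} (hf : AEStronglyMeasurable f (volume.restrict (uIoc a b)))
    (h : ∀ s ∈ uIoc a b, ‖f s‖ ≤ C) : IntervalIntegrable f volume a b := by
  rw [intervalIntegrable_iff]
  have : IsFiniteMeasure (volume.restrict (uIoc a b)) := ⟨by simp [uIoc]⟩
  exact Integrable.of_bound hf C ((ae_restrict_iff' measurableSet_uIoc).2 (ae_of_all _ h))

theorem measurable_intervalIntegral {f : ℝ → Ω → ℝ} (hf : Measurable (Function.uncurry f))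
    (a b : ℝ) : Measurable fun ω => ∫ s in a..b, f s ω := by
  simp only [intervalIntegral]
  exact ((hf.stronglyMeasurable.integral_prod_left (μ := volume.restrict (Ioc a b))).sub
    (hf.stronglyMeasurable.integral_prod_left (μ := volume.restrict (Ioc b a)))).measurable

theorem measurable_uncurry_intervalIntegral {f : ℝ → Ω → ℝ} (hf : Measurable (Function.uncurry f))
    (hint : ∀ ω a b, IntervalIntegrable (fun s => f s ω) volume a b) :
    Measurable (Function.uncurry fun t ω => ∫ s in (0 : ℝ)..t, f s ω) :=
  measurable_uncurry_of_continuous_of_measurable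
    (fun ω => intervalIntegral.continuous_primitive (hint ω) 0)
    fun t => measurable_intervalIntegral hf 0 t

/-- A measurable time-dependent family of centered observables. -/
structure IsCenteredField {Ω : Type*} [MetricSpace Ω] [MeasurableSpace Ω] (ν : Measure Ω) (η M H : ℝ) (φ : ℝ → Ω → ℝ) : Prop where
  measurable : Measurable (Function.uncurry φ)
  observable : ∀ s, IsObservable η M (M * H) (φ s)
  centered : ∀ s, ∫ ω, φ s ω ∂ν = 0

namespace IsCenteredField

variable {Ω : Type*} [MetricSpace Ω] [MeasurableSpace Ω] {ν : Measure Ω} {T : Ω → Ω}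
  {η M H ε t : ℝ} {φ ψ : ℝ → Ω → ℝ}

theorem intervalIntegrable_orbit (hφ : IsCenteredField ν η M H φ)
    (hT : Measurable T) (ε : ℝ) (ω : Ω) (a b : ℝ) :
    IntervalIntegrable (fun s => φ s (T^[⌊s / ε⌋₊] ω)) volume a b :=
  intervalIntegrable_of_bounded (C := M)
    ((measurable_along_orbit hT hφ.measurable ε).comp measurable_prodMk_right).aestronglyMeasurable
    fun s _ => (hφ.observable s).bound _

theorem intervalIntegrable (hφ : IsCenteredField ν η M H φ)
    (ω : Ω) (a b : ℝ) :
    IntervalIntegrable (fun s => φ s ω) volume a b :=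
  intervalIntegrable_of_bounded (C := M)
    (hφ.measurable.comp measurable_prodMk_right).aestronglyMeasurable
    fun s _ => (hφ.observable s).bound _

theorem measurable_orbitIntegral (hφ : IsCenteredField ν η M H φ)
    (hT : Measurable T) (ε : ℝ) :
    Measurable (Function.uncurry (orbitIntegral T ε φ)) :=
  measurable_uncurry_intervalIntegral
    (f := fun s ω => φ s (T^[⌊s / ε⌋₊] ω)) (measurable_along_orbit hT hφ.measurable ε)
    fun ω => hφ.intervalIntegrable_orbit hT ε ω

theorem abs_orbitIntegral_sub_le (hφ : IsCenteredField ν η M H φ)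
    (hT : Measurable T) (ε : ℝ) (ω : Ω) (a b : ℝ) :
    |orbitIntegral T ε φ b ω - orbitIntegral T ε φ a ω| ≤ M * |b - a| := by
  unfold orbitIntegral
  rw [intervalIntegral.integral_interval_sub_left (hφ.intervalIntegrable_orbit hT ε ω _ _)
    (hφ.intervalIntegrable_orbit hT ε ω _ _), ← Real.norm_eq_abs]
  exact intervalIntegral.norm_integral_le_of_norm_le_const fun s _ => (hφ.observable s).bound _

theorem abs_orbitIntegral_le (hφ : IsCenteredField ν η M H φ)
    (hT : Measurable T) (ε : ℝ) (ω : Ω) (t : ℝ) :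
    |orbitIntegral T ε φ t ω| ≤ M * |t| := by
  have := hφ.abs_orbitIntegral_sub_le hT ε ω 0 t
  simpa [orbitIntegral] using this

theorem intervalIntegrable_iterated (hφ : IsCenteredField ν η M H φ) (hψ : IsCenteredField ν η M H ψ)
    (hT : Measurable T) (ε : ℝ) (ω : Ω) (a b : ℝ) :
    IntervalIntegrable (fun s => ψ s (T^[⌊s / ε⌋₊] ω) * orbitIntegral T ε φ s ω) volume a b :=
  (hψ.intervalIntegrable_orbit hT ε ω a b).mul_continuousOn
    (intervalIntegral.continuous_primitive (hφ.intervalIntegrable_orbit hT ε ω) 0).continuousOn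

theorem measurable_orbitIteratedIntegral (hφ : IsCenteredField ν η M H φ) (hψ : IsCenteredField ν η M H ψ)
    (hT : Measurable T) (ε : ℝ) :
    Measurable (Function.uncurry (orbitIteratedIntegral T ε φ ψ)) :=
  measurable_uncurry_intervalIntegral
    (f := fun s ω => ψ s (T^[⌊s / ε⌋₊] ω) * orbitIntegral T ε φ s ω)
    ((measurable_along_orbit hT hψ.measurable ε).mul (hφ.measurable_orbitIntegral hT ε))
    fun ω => hφ.intervalIntegrable_iterated hψ hT ε ω

theorem observable_cellAvg (hφ : IsCenteredField ν η M H φ)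
    (hε : 0 < ε) (hMH : 0 ≤ M * H) (k : ℕ) :
    IsObservable η M (M * H) (cellAvg ε t φ k) := by
  have hlen : |cellEnd ε t (k + 1) - cellEnd ε t k| ≤ ε := by
    rw [abs_of_nonneg (sub_nonneg.2 (cellEnd_mono hε.le k))]
    exact cellEnd_sub_le hε.le k
  have aux : ∀ {C : ℝ} (f : ℝ → ℝ), 0 ≤ C → (∀ s, |f s| ≤ C) →
      |ε⁻¹ * ∫ s in cellEnd ε t k..cellEnd ε t (k + 1), f s| ≤ C := by
    intro C f hC hf
    have h1 := intervalIntegral.norm_integral_le_of_norm_le_const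
      (a := cellEnd ε t k) (b := cellEnd ε t (k + 1)) (f := f) (C := C) fun s _ => hf s
    rw [abs_mul, abs_of_pos (inv_pos.2 hε)]
    calc _ ≤ ε⁻¹ * (C * ε) := by
          refine mul_le_mul_of_nonneg_left (h1.trans ?_) (inv_pos.2 hε).le
          exact mul_le_mul_of_nonneg_left hlen hC
      _ = C := by field_simp
  refine ⟨fun ω => aux _ ((abs_nonneg _).trans ((hφ.observable 0).bound ω))
    fun s => (hφ.observable s).bound ω, fun x y => ?_⟩
  unfold cellAvg
  rw [← mul_sub, ← intervalIntegral.integral_sub (hφ.intervalIntegrable x _ _)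
    (hφ.intervalIntegrable y _ _)]
  exact aux _ (mul_nonneg hMH (Real.rpow_nonneg dist_nonneg _))
    fun s => (hφ.observable s).holder x y

theorem integral_cellAvg (hφ : IsCenteredField ν η M H φ)
    [IsProbabilityMeasure ν] (k : ℕ) : ∫ ω, cellAvg ε t φ k ω ∂ν = 0 := by
  unfold cellAvg
  rw [integral_const_mul]
  have h : ∀ a b : ℝ, ∫ ω, (∫ s in Ioc a b, φ s ω) ∂ν = 0 := by
    intro a b
    rw [integral_integral_swap]
    · simp [hφ.centered]
    · refine Integrable.of_bound (C := M) ?_ (ae_of_all _ fun p => (hφ.observable p.2).bound p.1)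
      exact (hφ.measurable.comp measurable_swap).aestronglyMeasurable
  have hm : ∀ a b : ℝ, Integrable (fun ω => ∫ s in Ioc a b, φ s ω) ν := by
    intro a b
    refine Integrable.of_bound (C := M * volume.real (Ioc a b))
      (hφ.measurable.stronglyMeasurable.integral_prod_left
        (μ := volume.restrict (Ioc a b))).aestronglyMeasurable (ae_of_all _ fun ω => ?_)
    exact norm_setIntegral_le_of_norm_le_const (by simp) fun s _ => (hφ.observable s).bound ω
  simp only [intervalIntegral]
  rw [integral_sub (hm _ _) (hm _ _), h, h, sub_zero, mul_zero]

theorem orbitIntegral_cellEnd (hφ : IsCenteredField ν η M H φ)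
    (hT : Measurable T) (hε : 0 < ε) (ht : 0 ≤ t) (ω : Ω) (k : ℕ) :
    orbitIntegral T ε φ (cellEnd ε t k) ω
      = ε * ∑ l ∈ Finset.range k, cellAvg ε t φ l (T^[l] ω) := by
  unfold orbitIntegral
  have h := intervalIntegral.sum_integral_adjacent_intervals (a := cellEnd ε t) (n := k)
    (f := fun s => φ s (T^[⌊s / ε⌋₊] ω)) (μ := volume)
    fun l _ => hφ.intervalIntegrable_orbit hT ε ω _ _
  rw [cellEnd_zero ht] at h
  rw [← h, Finset.mul_sum]
  refine Finset.sum_congr rfl fun l _ => ?_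
  unfold cellAvg
  rw [mul_inv_cancel_left₀ hε.ne']
  refine intervalIntegral.integral_congr_Ioo_of_le (cellEnd_mono hε.le l) fun s hs => ?_
  simp only [floor_eq_of_mem_cell hε hs]

theorem abs_orbitIteratedIntegral_sub_le (hφ : IsCenteredField ν η M H φ) (hψ : IsCenteredField ν η M H ψ)
    (hT : Measurable T) (hε : 0 < ε) (ht : 0 ≤ t)
    (hM : 0 ≤ M) (ω : Ω) {N : ℕ} (hN : t ≤ N * ε) :
    |orbitIteratedIntegral T ε φ ψ t ω - ε ^ 2 * ∑ k ∈ Finset.range N,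
      cellAvg ε t ψ k (T^[k] ω) * ∑ l ∈ Finset.range k, cellAvg ε t φ l (T^[l] ω)|
      ≤ M ^ 2 * (N * ε) * ε := by
  unfold orbitIteratedIntegral
  have h := intervalIntegral.sum_integral_adjacent_intervals (a := cellEnd ε t) (n := N)
    (f := fun s => ψ s (T^[⌊s / ε⌋₊] ω) * orbitIntegral T ε φ s ω) (μ := volume)
    fun l _ => hφ.intervalIntegrable_iterated hψ hT ε ω _ _
  rw [cellEnd_zero ht, cellEnd_eq_of_le hN] at h
  rw [← h, Finset.mul_sum, ← Finset.sum_sub_distrib]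
  have hterm : ∀ k ∈ Finset.range N,
      |(∫ s in cellEnd ε t k..cellEnd ε t (k + 1),
        ψ s (T^[⌊s / ε⌋₊] ω) * orbitIntegral T ε φ s ω) -
      ε ^ 2 * (cellAvg ε t ψ k (T^[k] ω) * ∑ l ∈ Finset.range k, cellAvg ε t φ l (T^[l] ω))|
      ≤ M ^ 2 * ε * ε := by
    intro k _
    have e1 : ε ^ 2 * (cellAvg ε t ψ k (T^[k] ω) *
        ∑ l ∈ Finset.range k, cellAvg ε t φ l (T^[l] ω))
        = ∫ s in cellEnd ε t k..cellEnd ε t (k + 1),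
          ψ s (T^[⌊s / ε⌋₊] ω) * orbitIntegral T ε φ (cellEnd ε t k) ω := by
      rw [intervalIntegral.integral_mul_const, hφ.orbitIntegral_cellEnd hT hε ht ω k]
      have e2 : ∫ s in cellEnd ε t k..cellEnd ε t (k + 1), ψ s (T^[⌊s / ε⌋₊] ω)
          = ε * cellAvg ε t ψ k (T^[k] ω) := by
        unfold cellAvg
        rw [mul_inv_cancel_left₀ hε.ne']
        refine intervalIntegral.integral_congr_Ioo_of_le (cellEnd_mono hε.le k) fun s hs => ?_
        simp only [floor_eq_of_mem_cell hε hs]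
      rw [e2]
      ring
    rw [e1, ← intervalIntegral.integral_sub (hφ.intervalIntegrable_iterated hψ hT ε ω _ _)
      ((hψ.intervalIntegrable_orbit hT ε ω _ _).mul_const _), ← Real.norm_eq_abs]
    have hmono := cellEnd_mono (t := t) hε.le k
    have hlen := cellEnd_sub_le (t := t) hε.le k
    refine (intervalIntegral.norm_integral_le_of_norm_le_const (C := M * (M * ε))
      fun s hs => ?_).trans ?_
    · rw [uIoc_of_le hmono] at hs
      rw [← mul_sub, Real.norm_eq_abs, abs_mul]
      refine mul_le_mul ((hψ.observable s).bound _) ?_ (abs_nonneg _) hM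
      refine (hφ.abs_orbitIntegral_sub_le hT ε ω _ _).trans (mul_le_mul_of_nonneg_left ?_ hM)
      rw [abs_of_pos (by linarith [hs.1])]
      linarith [hs.2]
    · rw [abs_of_nonneg (by linarith)]
      calc M * (M * ε) * (cellEnd ε t (k + 1) - cellEnd ε t k) ≤ M * (M * ε) * ε := by gcongr
        _ = _ := by ring
  refine (Finset.abs_sum_le_sum_abs _ _).trans ((Finset.sum_le_sum hterm).trans (le_of_eq ?_))
  rw [Finset.sum_const, Finset.card_range, nsmul_eq_mul]
  ring

end IsCenteredField

theorem eLpNorm_le_of_integral_pow_le {ν : Measure Ω} [IsProbabilityMeasure ν] {X : Ω → ℝ} (hX : Measurable X)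
    {B a : ℝ} (hB : ∀ ω, |X ω| ≤ B) (ha : 0 ≤ a) {q : ℕ} (hq : 1 ≤ q)
    (h : ∫ ω, X ω ^ (2 * q) ∂ν ≤ a ^ (2 * q)) :
    eLpNorm X ((2 * q : ℕ) : ENNReal) ν ≤ ENNReal.ofReal a := by
  have hq0 : 2 * q ≠ 0 := by omega
  rw [eLpNorm_eq_lintegral_rpow_enorm_toReal (by exact_mod_cast hq0) (ENNReal.natCast_ne_top _),
    ENNReal.toReal_natCast]
  have h1 : ∀ ω, ‖X ω‖ₑ ^ ((2 * q : ℕ) : ℝ) = ENNReal.ofReal (X ω ^ (2 * q)) := by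
    intro ω
    rw [ENNReal.rpow_natCast, Real.enorm_eq_ofReal_abs, ← ENNReal.ofReal_pow (abs_nonneg _),
      (even_two_mul q).pow_abs]
  simp_rw [h1]
  have hint : Integrable (fun ω => X ω ^ (2 * q)) ν := by
    refine Integrable.of_bound (C := B ^ (2 * q)) (hX.pow_const _).aestronglyMeasurable
      (ae_of_all _ fun ω => ?_)
    rw [norm_pow]
    exact pow_le_pow_left₀ (norm_nonneg _) (hB ω) _
  rw [← ofReal_integral_eq_lintegral_ofReal hint
    (ae_of_all _ fun ω => (even_two_mul q).pow_nonneg _)]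
  have h2 : ENNReal.ofReal a = (ENNReal.ofReal (a ^ (2 * q))) ^ (1 / ((2 * q : ℕ) : ℝ)) := by
    rw [ENNReal.ofReal_pow ha, ← ENNReal.rpow_natCast, ← ENNReal.rpow_mul,
      mul_one_div_cancel (by exact_mod_cast hq0), ENNReal.rpow_one]
  rw [h2]
  exact ENNReal.rpow_le_rpow (ENNReal.ofReal_le_ofReal h) (by positivity)

theorem exists_number_of_cells {T₀ ε : ℝ} (hT₀ : 0 ≤ T₀) (hε : 0 < ε) (hε1 : ε ≤ 1) :
    ∃ N : ℕ, 1 ≤ N ∧ T₀ ≤ N * ε ∧ N * ε ≤ T₀ + 2 := by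
  refine ⟨⌈T₀ / ε⌉₊ + 1, by omega, ?_, ?_⟩
  · push_cast
    have h := Nat.le_ceil (T₀ / ε)
    rw [div_le_iff₀ hε] at h
    nlinarith
  · push_cast
    have h := (Nat.ceil_lt_add_one (div_nonneg hT₀ hε.le)).le
    have h2 : ((⌈T₀ / ε⌉₊ : ℝ) + 1) * ε ≤ (T₀ / ε + 1 + 1) * ε := by gcongr
    refine h2.trans ?_
    have h3 : (T₀ / ε + 1 + 1) * ε = T₀ + 2 * ε := by field_simp; ring
    rw [h3]
    linarith

end

section

variable {Ω : Type*} [MetricSpace Ω] [MeasurableSpace Ω] [BorelSpace Ω] {ν : Measure Ω}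
  [IsProbabilityMeasure ν] {T : Ω → Ω} {η r M : ℝ}

theorem MultipleDecorrelation.exists_moment_orbitIntegral_le
    (hT : MeasurePreserving T ν ν) (hη : 0 < η)
    (hdec : MultipleDecorrelation ν T η r) (hr : 1 ≤ r) (hM : 1 ≤ M) {T₀ : ℝ} (hT₀ : 0 ≤ T₀)
    (q : ℕ) :
    ∃ C : ℝ, 0 ≤ C ∧ ∀ H : ℝ, 1 ≤ H → ∀ ε : ℝ, 0 < ε → ε ≤ 1 → ∀ t ∈ Icc 0 T₀,
      ∀ φ : ℝ → Ω → ℝ, IsCenteredField ν η M H φ →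
      ∫ ω, orbitIntegral T ε φ t ω ^ (2 * q) ∂ν ≤ C * (ε * H) ^ q := by
  obtain ⟨C, hC0, hC⟩ := hdec.exists_moment_sum_le hT hη hr hM q
  refine ⟨C * (T₀ + 2) ^ q, by positivity, ?_⟩
  intro H hH ε hε hε1 t ht φ hφ
  obtain ⟨N, hN1, hN2, hN3⟩ := exists_number_of_cells hT₀ hε hε1
  have h1 := hC H hH N hN1 (cellAvg ε t φ)
    (fun k => hφ.observable_cellAvg hε (by positivity) k) fun k => hφ.integral_cellAvg k
  have h2 : ∀ ω, orbitIntegral T ε φ t ω ^ (2 * q)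
      = ε ^ (2 * q) * (∑ k ∈ Finset.range N, cellAvg ε t φ k (T^[k] ω)) ^ (2 * q) := by
    intro ω
    rw [← mul_pow, ← hφ.orbitIntegral_cellEnd hT.measurable hε ht.1 ω N,
      cellEnd_eq_of_le (ht.2.trans hN2)]
  simp_rw [h2]
  rw [integral_const_mul]
  calc _ ≤ ε ^ (2 * q) * (C * (N * H) ^ q) := by gcongr
    _ = C * (N * ε) ^ q * (ε * H) ^ q := by
        rw [pow_mul, pow_two, mul_pow ε ε, mul_pow, mul_pow, mul_pow]; ring
    _ ≤ _ := by gcongr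

theorem MultipleDecorrelation.exists_moment_orbitIteratedIntegral_le
    (hT : MeasurePreserving T ν ν) (hη : 0 < η)
    (hdec : MultipleDecorrelation ν T η r) (hr : 1 ≤ r) (hM : 1 ≤ M) {T₀ : ℝ} (hT₀ : 0 ≤ T₀)
    (q : ℕ) :
    ∃ C : ℝ, 0 ≤ C ∧ ∀ H : ℝ, 1 ≤ H → ∀ ε : ℝ, 0 < ε → ε ≤ 1 → ∀ t ∈ Icc 0 T₀,
      ∀ φ ψ : ℝ → Ω → ℝ, IsCenteredField ν η M H φ → IsCenteredField ν η M H ψ →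
      ∫ ω, orbitIteratedIntegral T ε φ ψ t ω ^ (2 * q) ∂ν ≤ C * (ε * H) ^ (2 * q) := by
  obtain ⟨C, hC0, hC⟩ := hdec.exists_moment_iterated_sum_le hT hη hr hM q
  set A : ℝ := M ^ 2 * (T₀ + 2) with hA
  refine ⟨2 ^ (2 * q - 1) * (C * (T₀ + 2) ^ (2 * q) + A ^ (2 * q)), by positivity, ?_⟩
  intro H hH ε hε hε1 t ht φ ψ hφ hψ
  obtain ⟨N, hN1, hN2, hN3⟩ := exists_number_of_cells hT₀ hε hε1
  have hMH : 0 ≤ M * H := by positivity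
  have hφo := fun k => hφ.observable_cellAvg (t := t) hε hMH k
  have hψo := fun k => hψ.observable_cellAvg (t := t) hε hMH k
  have h1 := hC H hH N hN1 (cellAvg ε t φ) (cellAvg ε t ψ) hφo (fun k => hφ.integral_cellAvg k)
    hψo fun k => hψ.integral_cellAvg k
  set S : Ω → ℝ := fun ω => ∑ k ∈ Finset.range N,
      cellAvg ε t ψ k (T^[k] ω) * ∑ l ∈ Finset.range k, cellAvg ε t φ l (T^[l] ω) with hS
  have hSm : Measurable S := Finset.measurable_fun_sum _ fun k _ =>
    (((hψo k).measurable hη).comp (hT.measurable.iterate k)).mul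
      (Finset.measurable_fun_sum _ fun l _ =>
        ((hφo l).measurable hη).comp (hT.measurable.iterate l))
  have hSb : ∀ ω, |S ω| ≤ ∑ k ∈ Finset.range N, M * ∑ l ∈ Finset.range k, M := by
    intro ω
    refine (Finset.abs_sum_le_sum_abs _ _).trans (Finset.sum_le_sum fun k _ => ?_)
    rw [abs_mul]
    refine mul_le_mul ((hψo k).bound _) ?_ (abs_nonneg _) (by positivity)
    exact (Finset.abs_sum_le_sum_abs _ _).trans (Finset.sum_le_sum fun l _ => (hφo l).bound _)
  have hSi : Integrable (fun ω => S ω ^ (2 * q)) ν := by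
    refine Integrable.of_bound (C := (∑ k ∈ Finset.range N, M * ∑ l ∈ Finset.range k, M) ^ (2 * q))
      (hSm.pow_const _).aestronglyMeasurable (ae_of_all _ fun ω => ?_)
    rw [norm_pow]
    exact pow_le_pow_left₀ (norm_nonneg _) (hSb ω) _
  have h2 : ∀ ω, orbitIteratedIntegral T ε φ ψ t ω ^ (2 * q) ≤
      2 ^ (2 * q - 1) * (ε ^ (4 * q) * S ω ^ (2 * q) + (A * ε) ^ (2 * q)) := by
    intro ω
    have e1 := hφ.abs_orbitIteratedIntegral_sub_le hψ hT.measurable hε ht.1 (by linarith) ω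
      (ht.2.trans hN2)
    have e2 : |orbitIteratedIntegral T ε φ ψ t ω - ε ^ 2 * S ω| ≤ A * ε := by
      refine e1.trans ?_
      rw [hA]
      gcongr
    have e3 : |orbitIteratedIntegral T ε φ ψ t ω| ≤ ε ^ 2 * |S ω| + A * ε := by
      have e4 := abs_sub_abs_le_abs_sub (orbitIteratedIntegral T ε φ ψ t ω) (ε ^ 2 * S ω)
      rw [abs_mul, abs_of_nonneg (sq_nonneg ε)] at e4
      linarith
    rw [← (even_two_mul q).pow_abs]
    refine (pow_le_pow_left₀ (abs_nonneg _) e3 _).trans ?_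
    refine (add_pow_le (by positivity) (by positivity) _).trans (le_of_eq ?_)
    rw [mul_pow _ |S ω|, (even_two_mul q).pow_abs, ← pow_mul, show 2 * (2 * q) = 4 * q by ring]
  have h3 : ∫ ω, orbitIteratedIntegral T ε φ ψ t ω ^ (2 * q) ∂ν ≤
      ∫ ω, 2 ^ (2 * q - 1) * (ε ^ (4 * q) * S ω ^ (2 * q) + (A * ε) ^ (2 * q)) ∂ν :=
    integral_mono_of_nonneg (ae_of_all _ fun ω => (even_two_mul q).pow_nonneg _)
      (((hSi.const_mul _).add (integrable_const _)).const_mul _) (ae_of_all _ h2)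
  refine h3.trans ?_
  rw [integral_const_mul, integral_add (hSi.const_mul _) (integrable_const _), integral_const_mul,
    integral_const, probReal_univ, one_smul]
  have h4 : ε ^ (4 * q) * ∫ ω, S ω ^ (2 * q) ∂ν ≤ C * (T₀ + 2) ^ (2 * q) * (ε * H) ^ (2 * q) := by
    calc _ ≤ ε ^ (4 * q) * (C * (N * H) ^ (2 * q)) := by gcongr
      _ = C * (N * ε) ^ (2 * q) * (ε * H) ^ (2 * q) := by
          rw [show 4 * q = 2 * q + 2 * q by ring, pow_add, mul_pow, mul_pow, mul_pow]; ring
      _ ≤ _ := by gcongr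
  have h5 : (A * ε) ^ (2 * q) ≤ A ^ (2 * q) * (ε * H) ^ (2 * q) := by
    rw [← mul_pow]
    refine pow_le_pow_left₀ (by positivity) ?_ _
    have : ε ≤ ε * H := le_mul_of_one_le_right hε.le hH
    have hA0 : 0 ≤ A := by positivity
    exact mul_le_mul_of_nonneg_left this hA0
  have h6 : 0 ≤ (2 : ℝ) ^ (2 * q - 1) := by positivity
  refine (mul_le_mul_of_nonneg_left ?_ h6).trans (le_of_eq (mul_assoc _ _ _).symm)
  rw [add_mul]
  exact add_le_add h4 h5

/-- `L^p` bounds for integrals along the slowed-down orbit, for even `p`. -/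
theorem MultipleDecorrelation.exists_eLpNorm_orbitIntegral_le
    (hT : MeasurePreserving T ν ν) (hη : 0 < η)
    (hdec : MultipleDecorrelation ν T η r) (hr : 1 ≤ r) (hM : 1 ≤ M) {T₀ : ℝ} (hT₀ : 0 ≤ T₀)
    {q : ℕ} (hq : 1 ≤ q) :
    ∃ C : ℝ, 0 ≤ C ∧ ∀ H : ℝ, 1 ≤ H → ∀ ε : ℝ, 0 < ε → ε ≤ 1 → ∀ t ∈ Icc 0 T₀,
      ∀ φ ψ : ℝ → Ω → ℝ, IsCenteredField ν η M H φ → IsCenteredField ν η M H ψ →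
      eLpNorm (orbitIntegral T ε φ t) ((2 * q : ℕ) : ENNReal) ν
        ≤ ENNReal.ofReal (C * √(ε * H)) ∧
      eLpNorm (fun ω => orbitIntegral T ε φ t ω ^ 2) ((2 * q : ℕ) : ENNReal) ν
        ≤ ENNReal.ofReal (C * (ε * H)) ∧
      eLpNorm (orbitIteratedIntegral T ε φ ψ t) ((2 * q : ℕ) : ENNReal) ν
        ≤ ENNReal.ofReal (C * (ε * H)) := by
  obtain ⟨C₁, hC₁0, hC₁⟩ := hdec.exists_moment_orbitIntegral_le hT hη hr hM hT₀ q
  obtain ⟨C₂, hC₂0, hC₂⟩ := hdec.exists_moment_orbitIntegral_le hT hη hr hM hT₀ (2 * q)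
  obtain ⟨C₃, hC₃0, hC₃⟩ := hdec.exists_moment_orbitIteratedIntegral_le hT hη hr hM hT₀ q
  set C : ℝ := max 1 (max C₁ (max C₂ C₃)) with hC
  have hC1 : 1 ≤ C := le_max_left _ _
  have hCpow : ∀ c, c ≤ C → c ≤ C ^ (2 * q) := fun c hc =>
    hc.trans (le_self_pow₀ hC1 (by omega))
  have hc₁ : C₁ ≤ C ^ (2 * q) := hCpow _ (by simp [hC])
  have hc₂ : C₂ ≤ C ^ (2 * q) := hCpow _ (by simp [hC])
  have hc₃ : C₃ ≤ C ^ (2 * q) := hCpow _ (by simp [hC])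
  refine ⟨C, by positivity, ?_⟩
  intro H hH ε hε hε1 t ht φ ψ hφ hψ
  have hεH : 0 ≤ ε * H := by positivity
  have hm := (hφ.measurable_orbitIntegral hT.measurable ε).comp (measurable_prodMk_left (x := t))
  have hm' := (hφ.measurable_orbitIteratedIntegral hψ hT.measurable ε).comp
    (measurable_prodMk_left (x := t))
  have hb := fun ω => hφ.abs_orbitIntegral_le hT.measurable ε ω t
  refine ⟨eLpNorm_le_of_integral_pow_le hm hb (by positivity) hq ?_,
    eLpNorm_le_of_integral_pow_le (hm.pow_const 2) (B := (M * |t|) ^ 2) (fun ω => ?_)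
      (by positivity) hq ?_,
    eLpNorm_le_of_integral_pow_le hm' (B := M * (M * |t|) * |t|) (fun ω => ?_)
      (by positivity) hq ?_⟩
  · refine (hC₁ H hH ε hε hε1 t ht φ hφ).trans ?_
    rw [mul_pow C, pow_mul √(ε * H), Real.sq_sqrt hεH]
    gcongr
  · rw [abs_pow]
    exact pow_le_pow_left₀ (abs_nonneg _) (hb ω) _
  · simp_rw [Function.comp_def, ← pow_mul]
    refine (hC₂ H hH ε hε hε1 t ht φ hφ).trans ?_
    rw [mul_pow C]
    gcongr
  · have := intervalIntegral.norm_integral_le_of_norm_le_const (a := 0) (b := t)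
      (f := fun s => ψ s (T^[⌊s / ε⌋₊] ω) * orbitIntegral T ε φ s ω) (C := M * (M * |t|))
      fun s hs => by
        rw [Real.norm_eq_abs, abs_mul]
        refine mul_le_mul ((hψ.observable s).bound _) ?_ (abs_nonneg _) (by positivity)
        refine (hφ.abs_orbitIntegral_le hT.measurable ε ω s).trans ?_
        rw [uIoc_of_le ht.1] at hs
        rw [abs_of_pos hs.1, abs_of_nonneg ht.1]
        have := hs.2
        gcongr
    simpa [orbitIteratedIntegral] using this
  · refine (hC₃ H hH ε hε hε1 t ht φ ψ hφ hψ).trans ?_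
    rw [mul_pow C]
    gcongr

end

end Averaging

namespace Averaging

/-- Minkowski's inequality for an integral over a time interval. -/
theorem eLpNorm_intervalIntegral_le {Ω : Type*} [MeasurableSpace Ω] {ν : Measure Ω} [SFinite ν]
    {g : ℝ → Ω → ℝ} (hg : Measurable (Function.uncurry g)) {t : ℝ} (ht : 0 ≤ t) {p : ℕ}
    (hp : 1 ≤ p) {c : ENNReal} (h : ∀ s ∈ Icc 0 t, eLpNorm (g s) (p : ENNReal) ν ≤ c) :
    eLpNorm (fun ω => ∫ s in (0 : ℝ)..t, g s ω) (p : ENNReal) ν ≤ ENNReal.ofReal t * c := by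
  have hp0 : (p : ENNReal) ≠ 0 := by exact_mod_cast (by omega : p ≠ 0)
  have hpr : 1 ≤ (p : ℝ) := by exact_mod_cast hp
  have hpr0 : (0 : ℝ) < p := by linarith
  have hpow : ∀ f : Ω → ℝ, eLpNorm f (p : ENNReal) ν = (∫⁻ ω, ‖f ω‖ₑ ^ (p : ℝ) ∂ν) ^ (1 / (p : ℝ)) :=
    fun f => by
      rw [eLpNorm_eq_lintegral_rpow_enorm_toReal hp0 (ENNReal.natCast_ne_top _),
        ENNReal.toReal_natCast]
  set μ : Measure ℝ := volume.restrict (Ioc 0 t) with hμ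
  have hμu : μ univ = ENNReal.ofReal t := by simp [hμ]
  have h1 : ∀ ω, ‖∫ s in (0 : ℝ)..t, g s ω‖ₑ ^ (p : ℝ)
      ≤ ENNReal.ofReal t ^ ((p : ℝ) - 1) * ∫⁻ s, ‖g s ω‖ₑ ^ (p : ℝ) ∂μ := by
    intro ω
    rw [intervalIntegral.integral_of_le ht]
    have e1 : ‖∫ s, g s ω ∂μ‖ₑ ≤ ∫⁻ s, ‖g s ω‖ₑ ∂μ := enorm_integral_le_lintegral_enorm _
    have hm : AEStronglyMeasurable (fun s => g s ω) μ :=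
      (hg.comp measurable_prodMk_right).aestronglyMeasurable
    have e2 := eLpNorm_le_eLpNorm_mul_rpow_measure_univ (p := 1) (q := (p : ENNReal))
      (by exact_mod_cast hp) hm
    rw [eLpNorm_one_eq_lintegral_enorm, eLpNorm_eq_lintegral_rpow_enorm_toReal hp0
      (ENNReal.natCast_ne_top _), ENNReal.toReal_natCast, hμu, ENNReal.toReal_one] at e2
    refine (ENNReal.rpow_le_rpow (e1.trans e2) hpr0.le).trans (le_of_eq ?_)
    rw [ENNReal.mul_rpow_of_nonneg _ _ hpr0.le, ← ENNReal.rpow_mul, ← ENNReal.rpow_mul,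
      one_div_mul_cancel hpr0.ne', ENNReal.rpow_one, mul_comm]
    congr 2
    field_simp
  rw [hpow]
  have h2 : ∫⁻ ω, ‖∫ s in (0 : ℝ)..t, g s ω‖ₑ ^ (p : ℝ) ∂ν ≤ (ENNReal.ofReal t * c) ^ (p : ℝ) := by
    calc _ ≤ ∫⁻ ω, ENNReal.ofReal t ^ ((p : ℝ) - 1) * ∫⁻ s, ‖g s ω‖ₑ ^ (p : ℝ) ∂μ ∂ν :=
          lintegral_mono h1
      _ = ENNReal.ofReal t ^ ((p : ℝ) - 1) * ∫⁻ s, ∫⁻ ω, ‖g s ω‖ₑ ^ (p : ℝ) ∂ν ∂μ := by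
          have hm : Measurable fun q : Ω × ℝ => ‖g q.2 q.1‖ₑ ^ (p : ℝ) :=
            ((hg.comp measurable_swap).enorm).pow_const _
          rw [lintegral_const_mul _ hm.lintegral_prod_right', lintegral_lintegral_swap hm.aemeasurable]
      _ ≤ ENNReal.ofReal t ^ ((p : ℝ) - 1) * ∫⁻ _s, c ^ (p : ℝ) ∂μ := by
          refine mul_le_mul' le_rfl (lintegral_mono_ae ?_)
          rw [hμ, ae_restrict_iff' measurableSet_Ioc]
          refine ae_of_all _ fun s hs => ?_
          have := h s ⟨hs.1.le, hs.2⟩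
          rw [hpow] at this
          have h3 := ENNReal.rpow_le_rpow this hpr0.le
          rwa [← ENNReal.rpow_mul, one_div_mul_cancel hpr0.ne', ENNReal.rpow_one] at h3
      _ = (ENNReal.ofReal t * c) ^ (p : ℝ) := by
          rw [lintegral_const, hμu, ENNReal.mul_rpow_of_nonneg _ _ hpr0.le]
          rcases ht.eq_or_lt with h0 | h0
          · rw [← h0]
            have : p ≠ 0 := by omega
            simp [this]
          · have e : ENNReal.ofReal t ^ (p : ℝ) = ENNReal.ofReal t ^ ((p : ℝ) - 1) * ENNReal.ofReal t := by
              conv_rhs => rw [← ENNReal.rpow_one (ENNReal.ofReal t), ← ENNReal.rpow_mul, one_mul]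
              rw [← ENNReal.rpow_add _ _ (by simpa using h0) ENNReal.ofReal_ne_top]
              ring_nf
            rw [e]
            ring
  refine (ENNReal.rpow_le_rpow h2 (by positivity)).trans (le_of_eq ?_)
  rw [← ENNReal.rpow_mul, mul_one_div_cancel hpr0.ne', ENNReal.rpow_one]

/-- Gronwall's inequality in integral form. -/
theorem le_add_integral_of_le_add_integral {φ J : ℝ → ℝ} (hφ : Continuous φ) (hJ : Continuous J)
    {L T₀ : ℝ} (hL : 0 ≤ L) (hJ0 : ∀ t ∈ Icc 0 T₀, 0 ≤ J t)
    (h : ∀ t ∈ Icc 0 T₀, φ t ≤ J t + L * ∫ s in (0 : ℝ)..t, φ s) :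
    ∀ t ∈ Icc 0 T₀, φ t ≤ J t + L * Real.exp (L * T₀) * ∫ s in (0 : ℝ)..t, J s := by
  intro t ht
  have hT₀ : 0 ≤ T₀ := ht.1.trans ht.2
  have hdφ : ∀ s, HasDerivAt (fun u => ∫ x in (0 : ℝ)..u, φ x) (φ s) s := fun s =>
    hφ.integral_hasStrictDerivAt 0 s |>.hasDerivAt
  have hdJ : ∀ s, HasDerivAt (fun u => ∫ x in (0 : ℝ)..u, J x) (J s) s := fun s =>
    hJ.integral_hasStrictDerivAt 0 s |>.hasDerivAt
  set g : ℝ → ℝ := fun s => (∫ x in (0 : ℝ)..s, J x) - Real.exp (-L * s) * ∫ x in (0 : ℝ)..s, φ x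
    with hg
  have hgd : ∀ s, HasDerivAt g
      (J s - (Real.exp (-L * s) * (-L) * (∫ x in (0 : ℝ)..s, φ x) + Real.exp (-L * s) * φ s)) s := by
    intro s
    have he : HasDerivAt (fun s => Real.exp (-L * s)) (Real.exp (-L * s) * (-L)) s := by
      simpa using ((hasDerivAt_id s).const_mul (-L)).exp
    exact (hdJ s).sub (he.mul (hdφ s))
  have hmono : MonotoneOn g (Icc 0 T₀) := by
    refine monotoneOn_of_deriv_nonneg (convex_Icc _ _)
      (fun s _ => (hgd s).continuousAt.continuousWithinAt)
      (fun s _ => (hgd s).differentiableAt.differentiableWithinAt) fun s hs => ?_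
    rw [interior_Icc] at hs
    have hs' : s ∈ Icc 0 T₀ := ⟨hs.1.le, hs.2.le⟩
    rw [(hgd s).deriv]
    have h1 := h s hs'
    have h2 := hJ0 s hs'
    have h3 : Real.exp (-L * s) ≤ 1 := Real.exp_le_one_iff.2 (by nlinarith [hs.1])
    have h4 : 0 < Real.exp (-L * s) := Real.exp_pos _
    nlinarith
  have h1 := hmono ⟨le_rfl, hT₀⟩ ht ht.1
  simp only [hg, intervalIntegral.integral_same, mul_zero, sub_zero] at h1
  have hJint : 0 ≤ ∫ x in (0 : ℝ)..t, J x :=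
    intervalIntegral.integral_nonneg ht.1 fun s hs => hJ0 s ⟨hs.1, hs.2.trans ht.2⟩
  have h2 : ∫ x in (0 : ℝ)..t, φ x ≤ Real.exp (L * T₀) * ∫ x in (0 : ℝ)..t, J x := by
    have e1 : Real.exp (L * t) * (Real.exp (-L * t) * ∫ x in (0 : ℝ)..t, φ x)
        = ∫ x in (0 : ℝ)..t, φ x := by
      rw [← mul_assoc, ← Real.exp_add]
      simp
    rw [← e1]
    calc _ ≤ Real.exp (L * t) * ∫ x in (0 : ℝ)..t, J x :=
          mul_le_mul_of_nonneg_left (by linarith) (Real.exp_pos _).le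
      _ ≤ _ := by
          refine mul_le_mul_of_nonneg_right (Real.exp_le_exp.2 ?_) hJint
          exact mul_le_mul_of_nonneg_left ht.2 hL
  have h3 := h t ht
  nlinarith

theorem sq_integral_le {f : ℝ → ℝ} (hf : Continuous f) {t : ℝ} (ht : 0 ≤ t) :
    (∫ s in (0 : ℝ)..t, f s) ^ 2 ≤ t * ∫ s in (0 : ℝ)..t, f s ^ 2 := by
  rcases ht.eq_or_lt with rfl | h0
  · simp
  set m : ℝ := (∫ s in (0 : ℝ)..t, f s) / t with hm
  have hI : ∫ s in (0 : ℝ)..t, f s = m * t := by rw [hm]; field_simp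
  have h1 : 0 ≤ ∫ s in (0 : ℝ)..t, (f s - m) ^ 2 :=
    intervalIntegral.integral_nonneg ht fun s _ => sq_nonneg _
  have h2 : ∫ s in (0 : ℝ)..t, (f s - m) ^ 2
      = (∫ s in (0 : ℝ)..t, f s ^ 2) - 2 * m * (m * t) + m ^ 2 * t := by
    have e : ∀ s, (f s - m) ^ 2 = f s ^ 2 - 2 * m * f s + m ^ 2 := fun s => by ring
    simp_rw [e]
    rw [intervalIntegral.integral_add, intervalIntegral.integral_sub,
      intervalIntegral.integral_const_mul, hI, intervalIntegral.integral_const]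
    · simp; ring
    all_goals exact Continuous.intervalIntegrable (by fun_prop) _ _
  rw [hI]
  rw [h2] at h1
  nlinarith

/-- Consequences of Gronwall's inequality for first and second moments in time. -/
theorem integral_le_of_le_add_integral {y ι : ℝ → ℝ} (hy : Continuous y) (hι : Continuous ι)
    {L T₀ : ℝ} (hL : 0 ≤ L) (hy0 : ∀ t, 0 ≤ y t) (hι0 : ∀ t, 0 ≤ ι t)
    (h : ∀ t ∈ Icc 0 T₀, y t ≤ ι t + L * ∫ s in (0 : ℝ)..t, y s) {k : ℝ}
    (hk : k = L * Real.exp (L * T₀) * T₀) :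
    ∀ t ∈ Icc 0 T₀, ∫ s in (0 : ℝ)..t, y s ≤ (1 + k) * ∫ s in (0 : ℝ)..t, ι s ∧
      ∫ s in (0 : ℝ)..t, y s ^ 2 ≤ (2 + 2 * k ^ 2) * ∫ s in (0 : ℝ)..t, ι s ^ 2 := by
  intro t ht
  have hT₀ : 0 ≤ T₀ := ht.1.trans ht.2
  have hg := le_add_integral_of_le_add_integral hy hι hL (fun t _ => hι0 t) h
  set c : ℝ := L * Real.exp (L * T₀) with hc
  have hc0 : 0 ≤ c := by positivity
  set A : ℝ := ∫ s in (0 : ℝ)..t, ι s with hA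
  have hA0 : 0 ≤ A := intervalIntegral.integral_nonneg ht.1 fun s _ => hι0 s
  have h1 : ∀ s ∈ Icc 0 t, y s ≤ ι s + c * A := by
    intro s hs
    refine (hg s ⟨hs.1, hs.2.trans ht.2⟩).trans ?_
    have : ∫ x in (0 : ℝ)..s, ι x ≤ A :=
      intervalIntegral.integral_mono_interval le_rfl hs.1 hs.2 (ae_of_all _ fun x => hι0 x)
        (hι.intervalIntegrable _ _)
    gcongr
  constructor
  · have h2 : ∫ s in (0 : ℝ)..t, y s ≤ ∫ s in (0 : ℝ)..t, (ι s + c * A) :=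
      intervalIntegral.integral_mono_on ht.1 (hy.intervalIntegrable _ _)
        ((hι.add continuous_const).intervalIntegrable _ _) h1
    rw [intervalIntegral.integral_add (hι.intervalIntegrable _ _)
      (continuous_const.intervalIntegrable _ _), intervalIntegral.integral_const, ← hA] at h2
    simp only [sub_zero, smul_eq_mul] at h2
    have h3 : t * (c * A) ≤ T₀ * (c * A) := mul_le_mul_of_nonneg_right ht.2 (by positivity)
    rw [hk]
    nlinarith
  · have hsq := sq_integral_le hι ht.1
    set B : ℝ := ∫ s in (0 : ℝ)..t, ι s ^ 2 with hB
    have hB0 : 0 ≤ B := intervalIntegral.integral_nonneg ht.1 fun s _ => sq_nonneg _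
    have h2 : ∀ s ∈ Icc 0 t, y s ^ 2 ≤ 2 * ι s ^ 2 + 2 * c ^ 2 * A ^ 2 := by
      intro s hs
      have h3 := pow_le_pow_left₀ (hy0 s) (h1 s hs) 2
      nlinarith [sq_nonneg (ι s - c * A)]
    have h3 : ∫ s in (0 : ℝ)..t, y s ^ 2 ≤ ∫ s in (0 : ℝ)..t, (2 * ι s ^ 2 + 2 * c ^ 2 * A ^ 2) :=
      intervalIntegral.integral_mono_on ht.1 ((hy.pow 2).intervalIntegrable _ _)
        (Continuous.intervalIntegrable (by fun_prop) _ _) h2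
    rw [intervalIntegral.integral_add (Continuous.intervalIntegrable (by fun_prop) _ _)
      (continuous_const.intervalIntegrable _ _), intervalIntegral.integral_const,
      intervalIntegral.integral_const_mul, ← hB] at h3
    simp only [sub_zero, smul_eq_mul] at h3
    have h4 : t * (2 * c ^ 2 * A ^ 2) ≤ 2 * (c * T₀) ^ 2 * B := by
      calc t * (2 * c ^ 2 * A ^ 2) ≤ T₀ * (2 * c ^ 2 * (T₀ * B)) := by
            have h5 : A ^ 2 ≤ T₀ * B := hsq.trans (mul_le_mul_of_nonneg_right ht.2 hB0)
            have := ht.2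
            gcongr
        _ = _ := by ring
    rw [hk]
    nlinarith

/-- Exchange of the order of integration over a triangle. -/
theorem integral_integral_triangle {E : Type*} [NormedAddCommGroup E] [NormedSpace ℝ E]
    {g : ℝ → ℝ → E} {t C : ℝ} (ht : 0 ≤ t)
    (hg : AEStronglyMeasurable (Function.uncurry g)
      (volume.restrict {p : ℝ × ℝ | 0 < p.2 ∧ p.2 ≤ p.1 ∧ p.1 ≤ t}))
    (hb : ∀ s r, 0 < r → r ≤ s → s ≤ t → ‖g s r‖ ≤ C) :
    IntervalIntegrable (fun s => ∫ r in (0 : ℝ)..s, g s r) volume 0 t ∧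
    ∫ s in (0 : ℝ)..t, ∫ r in (0 : ℝ)..s, g s r = ∫ r in (0 : ℝ)..t, ∫ s in r..t, g s r := by
  set Δ : Set (ℝ × ℝ) := {p : ℝ × ℝ | 0 < p.2 ∧ p.2 ≤ p.1 ∧ p.1 ≤ t} with hΔ
  have hΔm : MeasurableSet Δ :=
    (measurableSet_lt measurable_const measurable_snd).inter
      ((measurableSet_le measurable_snd measurable_fst).inter
        (measurableSet_le measurable_fst measurable_const))
  have hΔfin : volume Δ < ⊤ := by
    have : Δ ⊆ Icc 0 t ×ˢ Icc 0 t := fun p hp =>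
      ⟨⟨hp.1.le.trans hp.2.1, hp.2.2⟩, ⟨hp.1.le, hp.2.1.trans hp.2.2⟩⟩
    refine (measure_mono this).trans_lt ?_
    rw [Measure.volume_eq_prod, Measure.prod_prod]
    exact ENNReal.mul_lt_top (by simp) (by simp)
  have hint : Integrable (Δ.indicator (Function.uncurry g)) (volume.prod volume) := by
    rw [← Measure.volume_eq_prod, integrable_indicator_iff hΔm]
    have : IsFiniteMeasure (volume.restrict Δ) := ⟨by simpa using hΔfin⟩
    exact Integrable.of_bound hg C ((ae_restrict_iff' hΔm).2
      (ae_of_all _ fun p hp => hb p.1 p.2 hp.1 hp.2.1 hp.2.2))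
  have e1 : (fun s => ∫ r, Δ.indicator (Function.uncurry g) (s, r))
      = (Ioc 0 t).indicator fun s => ∫ r in (0 : ℝ)..s, g s r := by
    funext s
    by_cases hs : s ∈ Ioc 0 t
    · rw [indicator_of_mem hs, intervalIntegral.integral_of_le hs.1.le,
        ← integral_indicator measurableSet_Ioc]
      refine integral_congr_ae (ae_of_all _ fun r => ?_)
      by_cases hr : r ∈ Ioc 0 s
      · have : (s, r) ∈ Δ := ⟨hr.1, hr.2, hs.2⟩
        simp only [indicator_of_mem this, indicator_of_mem hr, Function.uncurry]
      · have : (s, r) ∉ Δ := fun h => hr ⟨h.1, h.2.1⟩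
        simp only [indicator_of_notMem this, indicator_of_notMem hr]
    · rw [indicator_of_notMem hs]
      have : ∀ r, Δ.indicator (Function.uncurry g) (s, r) = 0 := fun r =>
        indicator_of_notMem (fun h => hs ⟨h.1.trans_le h.2.1, h.2.2⟩) _
      simp [this]
  have e2 : (fun r => ∫ s, Δ.indicator (Function.uncurry g) (s, r))
      = (Ioc 0 t).indicator fun r => ∫ s in r..t, g s r := by
    funext r
    by_cases hr : r ∈ Ioc 0 t
    · rw [indicator_of_mem hr, intervalIntegral.integral_of_le hr.2,
        ← integral_Icc_eq_integral_Ioc, ← integral_indicator measurableSet_Icc]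
      refine integral_congr_ae (ae_of_all _ fun s => ?_)
      by_cases hs : s ∈ Icc r t
      · have : (s, r) ∈ Δ := ⟨hr.1, hs.1, hs.2⟩
        simp only [indicator_of_mem this, indicator_of_mem hs, Function.uncurry]
      · have : (s, r) ∉ Δ := fun h => hs ⟨h.2.1, h.2.2⟩
        simp only [indicator_of_notMem this, indicator_of_notMem hs]
    · rw [indicator_of_notMem hr]
      have : ∀ s, Δ.indicator (Function.uncurry g) (s, r) = 0 := fun s =>
        indicator_of_notMem (fun h => hr ⟨h.1, h.2.1.trans h.2.2⟩) _
      simp [this]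
  constructor
  · have h := hint.integral_prod_left
    rw [e1, integrable_indicator_iff measurableSet_Ioc] at h
    rwa [intervalIntegrable_iff_integrableOn_Ioc_of_le ht]
  · have h := integral_integral_swap (f := fun s r => Δ.indicator (Function.uncurry g) (s, r)) hint
    rw [e1, e2, integral_indicator measurableSet_Ioc, integral_indicator measurableSet_Ioc] at h
    rwa [intervalIntegral.integral_of_le ht, intervalIntegral.integral_of_le ht]

end Averaging

namespace Averaging

variable {E : Type*} [NormedAddCommGroup E] [NormedSpace ℝ E] [CompleteSpace E]

/-- Integration by parts for an operator-valued integrand. -/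
theorem integral_apply_integral {G : ℝ → E →L[ℝ] E} {v : ℝ → E} {t M : ℝ} (ht : 0 ≤ t)
    (hG : AEStronglyMeasurable G) (hGb : ∀ s, ‖G s‖ ≤ M) (hv : Continuous v) :
    ∫ s in (0 : ℝ)..t, G s (∫ r in (0 : ℝ)..s, v r) =
      ∫ r in (0 : ℝ)..t, ((∫ s in (0 : ℝ)..t, G s) - ∫ s in (0 : ℝ)..r, G s) (v r) := by
  have hGi : ∀ a b, IntervalIntegrable G volume a b := fun a b =>
    intervalIntegrable_of_bounded hG.restrict fun s _ => hGb s
  obtain ⟨B, hB⟩ := isCompact_Icc.exists_bound_of_continuousOn (hv.continuousOn (s := Icc 0 t))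
  have hM : 0 ≤ M := (norm_nonneg _).trans (hGb 0)
  have h := (integral_integral_triangle (g := fun s r => G s (v r)) (t := t) (C := M * B) ht ?_
    ?_).2
  · have e1 : ∀ s, G s (∫ r in (0 : ℝ)..s, v r) = ∫ r in (0 : ℝ)..s, G s (v r) := fun s =>
      ((G s).intervalIntegral_comp_comm (hv.intervalIntegrable _ _)).symm
    simp_rw [e1, h]
    refine intervalIntegral.integral_congr fun r _ => ?_
    rw [intervalIntegral.integral_interval_sub_left (hGi _ _) (hGi _ _),
      ContinuousLinearMap.intervalIntegral_apply (hGi _ _)]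
  · refine AEStronglyMeasurable.restrict ?_
    have h1 : AEStronglyMeasurable (fun p : ℝ × ℝ => G p.1) volume := hG.comp_fst
    have h2 : AEStronglyMeasurable (fun p : ℝ × ℝ => v p.2) volume :=
      (hv.comp continuous_snd).aestronglyMeasurable
    exact (ContinuousLinearMap.id ℝ (E →L[ℝ] E)).aestronglyMeasurable_comp₂ h1 h2
  · intro s r hr hrs hst
    exact ((G s).le_opNorm _).trans (mul_le_mul (hGb s) (hB r ⟨hr.le, hrs.trans hst⟩)
      (norm_nonneg _) hM)

/-- The constant in `norm_sub_le_of_linearization`. -/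
noncomputable def linearizationConst (L M T₀ : ℝ) : ℝ :=
  let k := L * Real.exp (L * T₀) * T₀
  let c := (L + M + L) * (2 + 2 * k + 2 * k ^ 2) + L
  (1 + L * T₀ + c) + L * Real.exp (L * T₀) * (1 + L * T₀ + c * T₀)

/-- Deterministic comparison of a trajectory with the solution of the linearized equation. Here
`e` is the deviation from the averaged trajectory, `z` the solution of the linearized equation,
`I` the integrated forcing, and `G` a substitute for the fluctuating part `B` of the
differential. -/
theorem norm_sub_le_of_linearization {L M h T₀ : ℝ} (hL : 0 ≤ L) (hh : 0 ≤ h)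
    {e z I a : ℝ → E} {A B G : ℝ → E →L[ℝ] E}
    (he : Continuous e) (hz : Continuous z) (hI : Continuous I)
    (hA : Continuous A) (hB : AEStronglyMeasurable B) (hG : AEStronglyMeasurable G)
    (ha : ∀ t, IntervalIntegrable a volume 0 t)
    (hAb : ∀ t, ‖A t‖ ≤ L) (hGb : ∀ t, ‖G t‖ ≤ M) (hABb : ∀ t, ‖A t + B t‖ ≤ L)
    (hBG : ∀ t, ‖B t - G t‖ ≤ M * h)
    (hea : ∀ t ∈ Icc 0 T₀, e t = I t + ∫ s in (0 : ℝ)..t, a s)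
    (hae : ∀ t, ‖a t‖ ≤ L * ‖e t‖) (hlin : ∀ t, ‖a t - (A t + B t) (e t)‖ ≤ L * ‖e t‖ ^ 2)
    (hzA : ∀ t ∈ Icc 0 T₀, z t = I t + ∫ s in (0 : ℝ)..t, A s (z s)) :
    ∀ t ∈ Icc 0 T₀, ‖e t - z t‖ ≤ linearizationConst L M T₀ *
      (‖∫ s in (0 : ℝ)..t, G s (I s)‖ + ‖∫ s in (0 : ℝ)..t, G s‖ ^ 2
        + ∫ r in (0 : ℝ)..t, (‖∫ s in (0 : ℝ)..r, G s (I s)‖ + ‖∫ s in (0 : ℝ)..r, G s‖ ^ 2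
          + ‖I r‖ ^ 2 + h * ‖I r‖)) := by
  have hM : 0 ≤ M := (norm_nonneg _).trans (hGb 0)
  have hGi : ∀ a b, IntervalIntegrable G volume a b := fun a b =>
    intervalIntegrable_of_bounded hG.restrict fun s _ => hGb s
  have happ : ∀ {V : ℝ → E →L[ℝ] E} {y : ℝ → E} {K : ℝ}, AEStronglyMeasurable V →
      (∀ t, ‖V t‖ ≤ K) → Continuous y → ∀ a b,
      IntervalIntegrable (fun s => V s (y s)) volume a b := by
    intro V y K hV hVb hy a b
    obtain ⟨C, hC⟩ := isCompact_uIcc.exists_bound_of_continuousOn (hy.continuousOn (s := uIcc a b))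
    refine intervalIntegrable_of_bounded (C := K * C) ?_ fun s hs => ?_
    · exact AEStronglyMeasurable.restrict
        ((ContinuousLinearMap.id ℝ (E →L[ℝ] E)).aestronglyMeasurable_comp₂ hV
          hy.aestronglyMeasurable)
    · exact ((V s).le_opNorm _).trans (mul_le_mul (hVb s) (hC s (uIoc_subset_uIcc hs))
        (norm_nonneg _) ((norm_nonneg _).trans (hVb s)))
  set Γ : ℝ → E →L[ℝ] E := fun t => ∫ s in (0 : ℝ)..t, G s with hΓ
  set K : ℝ → E := fun t => ∫ s in (0 : ℝ)..t, G s (I s) with hK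
  have hΓc : Continuous Γ := intervalIntegral.continuous_primitive hGi 0
  have hKc : Continuous K := intervalIntegral.continuous_primitive (happ hG hGb hI) 0
  have hAzc : Continuous fun s => A s (z s) := hA.clm_apply hz
  intro τ hτ
  have hT₀ : 0 ≤ T₀ := hτ.1.trans hτ.2
  set k : ℝ := L * Real.exp (L * T₀) * T₀ with hk
  have hk0 : 0 ≤ k := by positivity
  -- moments of the deviations
  have hez : ∀ (y b : ℝ → E), Continuous y → (∀ t, IntervalIntegrable b volume 0 t) →
      (∀ t ∈ Icc 0 T₀, y t = I t + ∫ s in (0 : ℝ)..t, b s) → (∀ t, ‖b t‖ ≤ L * ‖y t‖) →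
      ∀ t ∈ Icc 0 T₀, ∫ s in (0 : ℝ)..t, ‖y s‖ ≤ (1 + k) * ∫ s in (0 : ℝ)..t, ‖I s‖ ∧
      ∫ s in (0 : ℝ)..t, ‖y s‖ ^ 2 ≤ (2 + 2 * k ^ 2) * ∫ s in (0 : ℝ)..t, ‖I s‖ ^ 2 := by
    intro y b hy hb hyb hby
    refine integral_le_of_le_add_integral hy.norm hI.norm hL (fun _ => norm_nonneg _)
      (fun _ => norm_nonneg _) (fun t ht => ?_) hk
    rw [hyb t ht]
    refine (norm_add_le _ _).trans (add_le_add_right ?_ _)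
    rw [← intervalIntegral.integral_const_mul]
    refine (intervalIntegral.norm_integral_le_integral_norm ht.1).trans ?_
    exact intervalIntegral.integral_mono_on ht.1 (hb t).norm
      ((continuous_const.mul hy.norm).intervalIntegrable _ _) fun s _ => hby s
  have hem := hez e a he ha hea hae
  have hzm := hez z (fun s => A s (z s)) hz (fun t => hAzc.intervalIntegrable _ _) hzA
    fun t => ((A t).le_opNorm _).trans (mul_le_mul_of_nonneg_right (hAb t) (norm_nonneg _))
  -- the source term
  set c₁ : ℝ := 2 + 2 * k + 2 * k ^ 2 with hc₁
  set c : ℝ := (L + M + L) * c₁ + L with hc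
  have hc₁0 : 0 ≤ c₁ := by positivity
  have hc0 : 0 ≤ c := by positivity
  set S : ℝ := ∫ r in (0 : ℝ)..τ, (‖K r‖ + ‖Γ r‖ ^ 2 + ‖I r‖ ^ 2 + h * ‖I r‖) with hS
  have hSc : Continuous fun r => ‖K r‖ + ‖Γ r‖ ^ 2 + ‖I r‖ ^ 2 + h * ‖I r‖ := by fun_prop
  have hS_ge : ∀ f : ℝ → ℝ, Continuous f → (∀ r, 0 ≤ f r) →
      (∀ r, f r ≤ ‖K r‖ + ‖Γ r‖ ^ 2 + ‖I r‖ ^ 2 + h * ‖I r‖) → ∀ t ∈ Icc 0 τ,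
      ∫ r in (0 : ℝ)..t, f r ≤ S := by
    intro f hf hf0 hfle t ht
    refine (intervalIntegral.integral_mono_interval le_rfl ht.1 ht.2 (ae_of_all _ fun r => hf0 r)
      (hf.intervalIntegrable _ _)).trans ?_
    exact intervalIntegral.integral_mono_on hτ.1 (hf.intervalIntegrable _ _)
      (hSc.intervalIntegrable _ _) fun r _ => hfle r
  have hS0 : 0 ≤ S := intervalIntegral.integral_nonneg hτ.1 fun r _ => by positivity
  have hp1 : ∀ r, 0 ≤ ‖K r‖ := fun r => norm_nonneg _
  have hp2 : ∀ r, 0 ≤ ‖Γ r‖ ^ 2 := fun r => by positivity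
  have hp3 : ∀ r, 0 ≤ ‖I r‖ ^ 2 := fun r => by positivity
  have hp4 : ∀ r, 0 ≤ h * ‖I r‖ := fun r => by positivity
  have hSΓ : ∀ t ∈ Icc 0 τ, ∫ r in (0 : ℝ)..t, ‖Γ r‖ ^ 2 ≤ S :=
    hS_ge _ (by fun_prop) hp2 fun r => by linarith [hp1 r, hp3 r, hp4 r]
  have hSI : ∀ t ∈ Icc 0 τ, ∫ r in (0 : ℝ)..t, ‖I r‖ ^ 2 ≤ S :=
    hS_ge _ (by fun_prop) hp3 fun r => by linarith [hp1 r, hp2 r, hp4 r]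
  have hShI : ∀ t ∈ Icc 0 τ, h * ∫ r in (0 : ℝ)..t, ‖I r‖ ≤ S := fun t ht => by
    rw [← intervalIntegral.integral_const_mul]
    exact hS_ge _ (by fun_prop) hp4 (fun r => by linarith [hp1 r, hp2 r, hp3 r]) t ht
  set J : ℝ → ℝ := fun t => ‖K t‖ + L * T₀ * ‖Γ t‖ ^ 2 + c * S with hJ
  have hJc : Continuous J := by fun_prop
  have hd : ∀ t ∈ Icc 0 τ, ‖e t - z t‖ ≤ J t + L * ∫ s in (0 : ℝ)..t, ‖e s - z s‖ := by
    intro t ht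
    have htT : t ∈ Icc 0 T₀ := ⟨ht.1, ht.2.trans hτ.2⟩
    set ρ : ℝ → E := fun s => a s - (A s + B s) (e s) with hρ
    have hAB : AEStronglyMeasurable (fun s => A s + B s) := hA.aestronglyMeasurable.add hB
    have hρi : IntervalIntegrable ρ volume 0 t := (ha t).sub (happ hAB hABb he 0 t)
    have hBGi : IntervalIntegrable (fun s => (B s - G s) (z s)) volume 0 t :=
      happ (hB.sub hG) hBG hz 0 t
    have hABi : IntervalIntegrable (fun s => (A s + B s) (e s - z s)) volume 0 t :=
      happ hAB hABb (he.sub hz) 0 t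
    have e1 : e t - z t = (((∫ s in (0 : ℝ)..t, (A s + B s) (e s - z s)) +
        ∫ s in (0 : ℝ)..t, ρ s) + ∫ s in (0 : ℝ)..t, (B s - G s) (z s)) +
        ∫ s in (0 : ℝ)..t, G s (z s) := by
      rw [← intervalIntegral.integral_add hABi hρi,
        ← intervalIntegral.integral_add (hABi.add hρi) hBGi,
        ← intervalIntegral.integral_add ((hABi.add hρi).add hBGi) (happ hG hGb hz 0 t),
        hea t htT, hzA t htT, add_sub_add_left_eq_sub,
        ← intervalIntegral.integral_sub (ha t) (hAzc.intervalIntegrable _ _)]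
      refine intervalIntegral.integral_congr fun s _ => ?_
      simp only [hρ, add_apply, sub_apply, map_sub]
      abel
    have e2 : ∫ s in (0 : ℝ)..t, G s (z s)
        = K t + ∫ r in (0 : ℝ)..t, (Γ t - Γ r) (A r (z r)) := by
      rw [hK, hΓ]
      simp only
      rw [← integral_apply_integral ht.1 hG hGb hAzc, ← intervalIntegral.integral_add
        (happ hG hGb hI 0 t) (happ hG hGb (intervalIntegral.continuous_primitive
          (fun a b => hAzc.intervalIntegrable a b) 0) 0 t)]
      refine intervalIntegral.integral_congr fun s hs => ?_
      rw [uIcc_of_le ht.1] at hs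
      rw [← map_add, ← hzA s ⟨hs.1, hs.2.trans htT.2⟩]
    have b1 : ‖∫ s in (0 : ℝ)..t, (A s + B s) (e s - z s)‖
        ≤ L * ∫ s in (0 : ℝ)..t, ‖e s - z s‖ := by
      rw [← intervalIntegral.integral_const_mul]
      refine (intervalIntegral.norm_integral_le_integral_norm ht.1).trans ?_
      exact intervalIntegral.integral_mono_on ht.1 hABi.norm
        (Continuous.intervalIntegrable (by fun_prop) _ _) fun s _ =>
          ((A s + B s).le_opNorm _).trans (mul_le_mul_of_nonneg_right (hABb s) (norm_nonneg _))
    have b2 : ‖∫ s in (0 : ℝ)..t, ρ s‖ ≤ L * (c₁ * S) := by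
      refine (intervalIntegral.norm_integral_le_integral_norm ht.1).trans ?_
      have h1 : ∫ s in (0 : ℝ)..t, ‖ρ s‖ ≤ ∫ s in (0 : ℝ)..t, L * ‖e s‖ ^ 2 :=
        intervalIntegral.integral_mono_on ht.1 hρi.norm
          (Continuous.intervalIntegrable (by fun_prop) _ _) fun s _ => hlin s
      rw [intervalIntegral.integral_const_mul] at h1
      refine h1.trans (mul_le_mul_of_nonneg_left ?_ hL)
      refine (hem t htT).2.trans ?_
      exact mul_le_mul (by linarith) (hSI t ht)
        (intervalIntegral.integral_nonneg ht.1 fun _ _ => by positivity) hc₁0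
    have b3 : ‖∫ s in (0 : ℝ)..t, (B s - G s) (z s)‖ ≤ M * (c₁ * S) := by
      refine (intervalIntegral.norm_integral_le_integral_norm ht.1).trans ?_
      have h1 : ∫ s in (0 : ℝ)..t, ‖(B s - G s) (z s)‖ ≤ ∫ s in (0 : ℝ)..t, M * h * ‖z s‖ :=
        intervalIntegral.integral_mono_on ht.1 hBGi.norm
          (Continuous.intervalIntegrable (by fun_prop) _ _) fun s _ =>
          ((B s - G s).le_opNorm _).trans (mul_le_mul_of_nonneg_right (hBG s) (norm_nonneg _))
      rw [intervalIntegral.integral_const_mul, mul_assoc] at h1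
      refine h1.trans (mul_le_mul_of_nonneg_left ?_ hM)
      calc h * ∫ s in (0 : ℝ)..t, ‖z s‖ ≤ h * ((1 + k) * ∫ s in (0 : ℝ)..t, ‖I s‖) :=
            mul_le_mul_of_nonneg_left (hzm t htT).1 hh
        _ = (1 + k) * (h * ∫ s in (0 : ℝ)..t, ‖I s‖) := by ring
        _ ≤ c₁ * S := by
            refine mul_le_mul (by nlinarith [sq_nonneg k]) (hShI t ht) ?_ hc₁0
            exact mul_nonneg hh (intervalIntegral.integral_nonneg ht.1 fun _ _ => norm_nonneg _)
    have b4 : ‖∫ r in (0 : ℝ)..t, (Γ t - Γ r) (A r (z r))‖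
        ≤ L * T₀ * ‖Γ t‖ ^ 2 + (L * S + L * (c₁ * S)) := by
      refine (intervalIntegral.norm_integral_le_integral_norm ht.1).trans ?_
      have h1 : ∫ r in (0 : ℝ)..t, ‖(Γ t - Γ r) (A r (z r))‖
          ≤ ∫ r in (0 : ℝ)..t, (L * ‖Γ t‖ ^ 2 + L * (‖Γ r‖ ^ 2 + ‖z r‖ ^ 2)) := by
        refine intervalIntegral.integral_mono_on ht.1
          (Continuous.intervalIntegrable (by fun_prop) _ _)
          (Continuous.intervalIntegrable (by fun_prop) _ _) fun r _ => ?_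
        have f1 : ‖(Γ t - Γ r) (A r (z r))‖ ≤ (‖Γ t‖ + ‖Γ r‖) * (L * ‖z r‖) := by
          refine ((Γ t - Γ r).le_opNorm _).trans (mul_le_mul (norm_sub_le _ _) ?_
            (norm_nonneg _) (by positivity))
          exact ((A r).le_opNorm _).trans (mul_le_mul_of_nonneg_right (hAb r) (norm_nonneg _))
        have f2 : (‖Γ t‖ + ‖Γ r‖) * ‖z r‖ ≤ ‖Γ t‖ ^ 2 + (‖Γ r‖ ^ 2 + ‖z r‖ ^ 2) := by
          nlinarith [sq_nonneg (‖Γ t‖ - ‖z r‖), sq_nonneg (‖Γ r‖ - ‖z r‖), sq_nonneg ‖Γ t‖,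
            sq_nonneg ‖Γ r‖]
        calc _ ≤ L * ((‖Γ t‖ + ‖Γ r‖) * ‖z r‖) := f1.trans (le_of_eq (by ring))
          _ ≤ L * (‖Γ t‖ ^ 2 + (‖Γ r‖ ^ 2 + ‖z r‖ ^ 2)) := mul_le_mul_of_nonneg_left f2 hL
          _ = _ := by ring
      refine h1.trans ?_
      rw [intervalIntegral.integral_add (continuous_const.intervalIntegrable _ _)
        (Continuous.intervalIntegrable (by fun_prop) _ _), intervalIntegral.integral_const,
        intervalIntegral.integral_const_mul, intervalIntegral.integral_add
        (Continuous.intervalIntegrable (by fun_prop) _ _)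
        (Continuous.intervalIntegrable (by fun_prop) _ _), sub_zero, smul_eq_mul, ← mul_add]
      have h2 : ∫ s in (0 : ℝ)..t, ‖z s‖ ^ 2 ≤ c₁ * S := by
        refine (hzm t htT).2.trans ?_
        exact mul_le_mul (by linarith) (hSI t ht)
          (intervalIntegral.integral_nonneg ht.1 fun _ _ => by positivity) hc₁0
      have h3 : t * (L * ‖Γ t‖ ^ 2) ≤ L * T₀ * ‖Γ t‖ ^ 2 := by
        calc t * (L * ‖Γ t‖ ^ 2) ≤ T₀ * (L * ‖Γ t‖ ^ 2) :=
              mul_le_mul_of_nonneg_right htT.2 (by positivity)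
          _ = _ := by ring
      exact add_le_add h3 (mul_le_mul_of_nonneg_left (add_le_add (hSΓ t ht) h2) hL)
    rw [e1, e2]
    have n1 := norm_add_le (((∫ s in (0 : ℝ)..t, (A s + B s) (e s - z s)) +
        ∫ s in (0 : ℝ)..t, ρ s) + ∫ s in (0 : ℝ)..t, (B s - G s) (z s))
        (K t + ∫ r in (0 : ℝ)..t, (Γ t - Γ r) (A r (z r)))
    have n2 := norm_add_le ((∫ s in (0 : ℝ)..t, (A s + B s) (e s - z s)) +
        ∫ s in (0 : ℝ)..t, ρ s) (∫ s in (0 : ℝ)..t, (B s - G s) (z s))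
    have n3 := norm_add_le (∫ s in (0 : ℝ)..t, (A s + B s) (e s - z s)) (∫ s in (0 : ℝ)..t, ρ s)
    have n4 := norm_add_le (K t) (∫ r in (0 : ℝ)..t, (Γ t - Γ r) (A r (z r)))
    have e3 : c * S = L * (c₁ * S) + M * (c₁ * S) + (L * S + L * (c₁ * S)) := by
      rw [hc]; ring
    simp only [hJ, e3]
    linarith
  have hg := le_add_integral_of_le_add_integral (he.sub hz).norm hJc hL
    (fun t _ => by positivity) hd τ ⟨hτ.1, le_rfl⟩
  have hJint : ∫ s in (0 : ℝ)..τ, J s ≤ (1 + L * T₀ + c * T₀) * S := by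
    have h1 : ∫ s in (0 : ℝ)..τ, J s
        = (∫ s in (0 : ℝ)..τ, ‖K s‖) + L * T₀ * (∫ s in (0 : ℝ)..τ, ‖Γ s‖ ^ 2) + τ * (c * S) := by
      simp only [hJ]
      rw [intervalIntegral.integral_add (Continuous.intervalIntegrable (by fun_prop) _ _)
        (continuous_const.intervalIntegrable _ _), intervalIntegral.integral_add
        (Continuous.intervalIntegrable (by fun_prop) _ _)
        (Continuous.intervalIntegrable (by fun_prop) _ _), intervalIntegral.integral_const,
        intervalIntegral.integral_const_mul, sub_zero, smul_eq_mul]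
    rw [h1]
    have h2 := hS_ge (fun r => ‖K r‖) (by fun_prop) hp1
      (fun r => by linarith [hp2 r, hp3 r, hp4 r]) τ ⟨hτ.1, le_rfl⟩
    have h3 := mul_le_mul_of_nonneg_left (hSΓ τ ⟨hτ.1, le_rfl⟩) (by positivity : 0 ≤ L * T₀)
    have h4 := mul_le_mul_of_nonneg_right hτ.2 (by positivity : 0 ≤ c * S)
    linarith
  have hexp : Real.exp (L * τ) ≤ Real.exp (L * T₀) :=
    Real.exp_le_exp.2 (mul_le_mul_of_nonneg_left hτ.2 hL)
  set X : ℝ := L * Real.exp (L * T₀) * (1 + L * T₀ + c * T₀) with hX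
  have hX0 : 0 ≤ X := by positivity
  have hfin : L * Real.exp (L * τ) * ∫ s in (0 : ℝ)..τ, J s ≤ X * S := by
    have hJ0 : 0 ≤ ∫ s in (0 : ℝ)..τ, J s :=
      intervalIntegral.integral_nonneg hτ.1 fun s _ => by positivity
    calc _ ≤ L * Real.exp (L * T₀) * ((1 + L * T₀ + c * T₀) * S) := by gcongr
      _ = X * S := by rw [hX]; ring
  have hconst : linearizationConst L M T₀ = (1 + L * T₀ + c) + X := rfl
  have hLT : 0 ≤ L * T₀ := by positivity
  rw [hconst]
  refine hg.trans ((add_le_add_right hfin _).trans ?_)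
  simp only [hJ]
  have g1 : ‖K τ‖ ≤ ((1 + L * T₀ + c) + X) * ‖K τ‖ :=
    le_mul_of_one_le_left (norm_nonneg _) (by linarith)
  have g2 : L * T₀ * ‖Γ τ‖ ^ 2 ≤ ((1 + L * T₀ + c) + X) * ‖Γ τ‖ ^ 2 :=
    mul_le_mul_of_nonneg_right (by linarith) (hp2 τ)
  have g3 : c * S + X * S ≤ ((1 + L * T₀ + c) + X) * S := by
    rw [← add_mul]
    exact mul_le_mul_of_nonneg_right (by linarith) hS0
  rw [mul_add, mul_add]
  linarith

end Averaging

namespace Averaging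

namespace IsResolvent

variable {d : ℕ} {A : ℝ → (Fin d → ℝ) →L[ℝ] (Fin d → ℝ)}
  {R : ℝ → ℝ → (Fin d → ℝ) →L[ℝ] (Fin d → ℝ)} {L T₀ : ℝ}

theorem continuousOn (hR : IsResolvent A R) {s : ℝ} (hs : 0 ≤ s) :
    ContinuousOn (fun t => R t s) (Ici s) :=
  fun t ht => (hR.deriv s t hs ht).continuousWithinAt

theorem hasDerivWithinAt_Ici (hR : IsResolvent A R) {s t : ℝ} (hs : 0 ≤ s) (hst : s ≤ t) :
    HasDerivWithinAt (fun t' => R t' s) ((A t).comp (R t s)) (Ici t) t :=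
  (hR.deriv s t hs hst).mono (Ici_subset_Ici.2 hst)

theorem norm_le (hR : IsResolvent A R) (hA : ∀ t, 0 ≤ t → ‖A t‖ ≤ L) {s t : ℝ} (hs : 0 ≤ s)
    (hst : s ≤ t) : ‖R t s‖ ≤ Real.exp (L * (t - s)) := by
  have h := norm_le_gronwallBound_of_norm_deriv_right_le (f := fun t => R t s)
    (f' := fun t => (A t).comp (R t s)) (δ := 1) (K := L) (ε := 0) (a := s) (b := t)
    ((hR.continuousOn hs).mono Icc_subset_Ici_self)
    (fun x hx => hR.hasDerivWithinAt_Ici hs hx.1)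
    (by rw [hR.diag s hs]; exact ContinuousLinearMap.norm_id_le)
    (fun x hx => by
      rw [add_zero]
      exact (ContinuousLinearMap.opNorm_comp_le _ _).trans
        (mul_le_mul_of_nonneg_right (hA x (hs.trans hx.1)) (norm_nonneg _)))
    t ⟨hst, le_rfl⟩
  rwa [gronwallBound_ε0, one_mul] at h

theorem comp_eq (hR : IsResolvent A R) (hA : ∀ t, 0 ≤ t → ‖A t‖ ≤ L) {s s' t : ℝ} (hs : 0 ≤ s)
    (hss' : s ≤ s') (hst : s' ≤ t) : R t s = (R t s').comp (R s' s) := by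
  have hs' := hs.trans hss'
  have hd : ∀ x, s' ≤ x → HasDerivWithinAt (fun t => R t s - (R t s').comp (R s' s))
      ((A x).comp (R x s) - ((A x).comp (R x s')).comp (R s' s)) (Ici x) x := fun x hx =>
    (hR.hasDerivWithinAt_Ici hs (hss'.trans hx)).sub
      (by
        simpa using (hR.hasDerivWithinAt_Ici hs' hx).clm_comp
          (hasDerivWithinAt_const x (Ici x) (R s' s)))
  have h := norm_le_gronwallBound_of_norm_deriv_right_le
    (f := fun t => R t s - (R t s').comp (R s' s))
    (f' := fun x => (A x).comp (R x s) - ((A x).comp (R x s')).comp (R s' s))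
    (δ := 0) (K := L) (ε := 0) (a := s') (b := t)
    (((hR.continuousOn hs).mono fun x hx => hss'.trans hx.1).sub
      (((hR.continuousOn hs').mono Icc_subset_Ici_self).clm_comp continuousOn_const))
    (fun x hx => hd x hx.1)
    (by rw [hR.diag s' hs', ContinuousLinearMap.id_comp, sub_self, norm_zero])
    (fun x hx => by
      rw [add_zero, ContinuousLinearMap.comp_assoc, ← ContinuousLinearMap.comp_sub]
      exact (ContinuousLinearMap.opNorm_comp_le _ _).trans
        (mul_le_mul_of_nonneg_right (hA x (hs'.trans hx.1)) (norm_nonneg _)))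
    t ⟨hst, le_rfl⟩
  rw [gronwallBound_ε0, zero_mul] at h
  exact sub_eq_zero.1 (norm_le_zero_iff.1 h)

theorem norm_le_exp (hR : IsResolvent A R) (hL : 0 ≤ L) (hA : ∀ t, 0 ≤ t → ‖A t‖ ≤ L) {s t : ℝ}
    (hs : 0 ≤ s) (hst : s ≤ t) (ht : t ≤ T₀) : ‖R t s‖ ≤ Real.exp (L * T₀) := by
  refine (hR.norm_le hA hs hst).trans (Real.exp_le_exp.2 ?_)
  exact mul_le_mul_of_nonneg_left (by linarith) hL

theorem norm_sub_le_left (hR : IsResolvent A R) (hL : 0 ≤ L) (hA : ∀ t, 0 ≤ t → ‖A t‖ ≤ L)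
    {s t t' : ℝ} (hs : 0 ≤ s) (hst : s ≤ t) (htt' : t ≤ t') (ht' : t' ≤ T₀) :
    ‖R t' s - R t s‖ ≤ L * Real.exp (L * T₀) * (t' - t) :=
  norm_image_sub_le_of_norm_deriv_right_le_segment (f := fun t => R t s)
    (f' := fun t => (A t).comp (R t s)) (a := t) (b := t')
    ((hR.continuousOn hs).mono fun _ hx => hst.trans hx.1)
    (fun _ hx => hR.hasDerivWithinAt_Ici hs (hst.trans hx.1))
    (fun _ hx => (ContinuousLinearMap.opNorm_comp_le _ _).trans
      (mul_le_mul (hA _ (hs.trans (hst.trans hx.1)))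
        (hR.norm_le_exp hL hA hs (hst.trans hx.1) (hx.2.le.trans ht')) (norm_nonneg _) hL))
    t' ⟨htt', le_rfl⟩

theorem norm_sub_le_right (hR : IsResolvent A R) (hL : 0 ≤ L) (hA : ∀ t, 0 ≤ t → ‖A t‖ ≤ L)
    {s s' t : ℝ} (hs : 0 ≤ s) (hss' : s ≤ s') (hst : s' ≤ t) (ht : t ≤ T₀) :
    ‖R t s - R t s'‖ ≤ L * Real.exp (L * T₀) * Real.exp (L * T₀) * (s' - s) := by
  have h1 : R t s - R t s' = (R t s').comp (R s' s - R s s) := by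
    rw [ContinuousLinearMap.comp_sub, ← hR.comp_eq hA hs hss' hst, hR.diag s hs,
      ContinuousLinearMap.comp_id]
  rw [h1]
  refine (ContinuousLinearMap.opNorm_comp_le _ _).trans ?_
  have h2 := hR.norm_sub_le_left hL hA hs le_rfl hss' (hst.trans ht)
  have h3 := hR.norm_le_exp hL hA (hs.trans hss') hst ht
  calc _ ≤ Real.exp (L * T₀) * (L * Real.exp (L * T₀) * (s' - s)) :=
        mul_le_mul h3 h2 (norm_nonneg _) (Real.exp_pos _).le
    _ = _ := by ring

/-- The resolvent is jointly continuous. -/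
theorem continuousOn_uncurry (hR : IsResolvent A R) (hL : 0 ≤ L) (hT₀ : 0 ≤ T₀)
    (hA : ∀ t, 0 ≤ t → ‖A t‖ ≤ L) :
    ContinuousOn (Function.uncurry R) {p : ℝ × ℝ | 0 ≤ p.2 ∧ p.2 ≤ p.1 ∧ p.1 ≤ T₀} := by
  set C : ℝ := L * Real.exp (L * T₀) * Real.exp (L * T₀) with hC
  have hC0 : 0 ≤ C := by positivity
  have hexp : 1 ≤ Real.exp (L * T₀) := Real.one_le_exp (by positivity)
  have hleft : ∀ {s t t' : ℝ}, 0 ≤ s → s ≤ t → t ≤ t' → t' ≤ T₀ →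
      ‖R t' s - R t s‖ ≤ C * (t' - t) := fun hs hst htt' ht' =>
    (hR.norm_sub_le_left hL hA hs hst htt' ht').trans
      (mul_le_mul_of_nonneg_right (le_mul_of_one_le_right (by positivity) hexp) (by linarith))
  have hright : ∀ {s s' t : ℝ}, 0 ≤ s → 0 ≤ s' → s ≤ t → s' ≤ t → t ≤ T₀ →
      ‖R t s - R t s'‖ ≤ C * |s - s'| := by
    intro s s' t hs hs' hst hst' ht
    rcases le_total s s' with h | h
    · rw [abs_sub_comm, abs_of_nonneg (sub_nonneg.2 h)]
      exact hR.norm_sub_le_right hL hA hs h hst' ht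
    · rw [norm_sub_rev, abs_of_nonneg (sub_nonneg.2 h)]
      exact hR.norm_sub_le_right hL hA hs' h hst ht
  have hlip : LipschitzOnWith (Real.toNNReal (3 * C)) (Function.uncurry R)
      {p : ℝ × ℝ | 0 ≤ p.2 ∧ p.2 ≤ p.1 ∧ p.1 ≤ T₀} := by
    refine LipschitzOnWith.of_dist_le_mul ?_
    rintro ⟨t, s⟩ ⟨hs, hst, ht⟩ ⟨t', s'⟩ ⟨hs', hst', ht'⟩
    simp only at hs hst ht hs' hst' ht'
    rw [Real.coe_toNNReal _ (by positivity), dist_eq_norm, Prod.dist_eq, Real.dist_eq, Real.dist_eq]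
    simp only [Function.uncurry]
    set m := max t t' with hm
    have hmT : m ≤ T₀ := max_le ht ht'
    have h1 := hleft hs hst (le_max_left t t') hmT
    have h2 := hright hs hs' (hst.trans (le_max_left t t')) (hst'.trans (le_max_right t t')) hmT
    have h3 := hleft hs' hst' (le_max_right t t') hmT
    have e : R t s - R t' s' = -(R m s - R t s) + (R m s - R m s') + (R m s' - R t' s') := by abel
    have n1 := norm_add_le (-(R m s - R t s) + (R m s - R m s')) (R m s' - R t' s')
    have n2 := norm_add_le (-(R m s - R t s)) (R m s - R m s')
    rw [norm_neg] at n2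
    rw [← e] at n1
    have k1 : m - t ≤ max |t - t'| |s - s'| := by
      refine le_trans ?_ (le_max_left _ _)
      rcases le_total t t' with h | h
      · rw [hm, max_eq_right h, abs_sub_comm]; exact le_abs_self _
      · rw [hm, max_eq_left h, sub_self]; exact abs_nonneg _
    have k2 : m - t' ≤ max |t - t'| |s - s'| := by
      refine le_trans ?_ (le_max_left _ _)
      rcases le_total t t' with h | h
      · rw [hm, max_eq_right h, sub_self]; exact abs_nonneg _
      · rw [hm, max_eq_left h]; exact le_abs_self _
    have k3 : |s - s'| ≤ max |t - t'| |s - s'| := le_max_right _ _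
    have := mul_le_mul_of_nonneg_left k1 hC0
    have := mul_le_mul_of_nonneg_left k2 hC0
    have := mul_le_mul_of_nonneg_left k3 hC0
    linarith
  exact hlip.continuousOn

/-- Duhamel's formula: the integral of the forcing against the resolvent solves the forced linear
equation, in integral form. -/
theorem exists_continuous_duhamel (hR : IsResolvent A R) (hL : 0 ≤ L) (hT₀ : 0 ≤ T₀)
    (hA : ∀ t, 0 ≤ t → ‖A t‖ ≤ L) {A' : ℝ → (Fin d → ℝ) →L[ℝ] (Fin d → ℝ)} (hA' : Continuous A')
    (hAA' : ∀ t, 0 ≤ t → A' t = A t) {f : ℝ → Fin d → ℝ} {M : ℝ} (hf : AEStronglyMeasurable f)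
    (hM : ∀ s, ‖f s‖ ≤ M) :
    ∃ z : ℝ → Fin d → ℝ, Continuous z ∧
      (∀ t ∈ Icc 0 T₀, z t = ∫ s in (0 : ℝ)..t, R t s (f s)) ∧
      ∀ t ∈ Icc 0 T₀, z t = (∫ s in (0 : ℝ)..t, f s) + ∫ s in (0 : ℝ)..t, A' s (z s) := by
  have hM0 : 0 ≤ M := (norm_nonneg _).trans (hM 0)
  set Cst := Real.exp (L * T₀) with hCst
  set z : ℝ → Fin d → ℝ := fun t => ∫ s in (0 : ℝ)..t, R t s (f s) with hz
  have hcont := hR.continuousOn_uncurry hL hT₀ hA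
  have hfi : ∀ a b, IntervalIntegrable f volume a b := fun a b =>
    intervalIntegrable_of_bounded hf.restrict fun s _ => hM s
  -- integrability of the Duhamel integrand
  have hRi : ∀ t ∈ Icc 0 T₀, IntervalIntegrable (fun s => R t s (f s)) volume 0 t := by
    intro t ht
    refine intervalIntegrable_of_bounded (C := Cst * M) ?_ fun s hs => ?_
    · have h1 : AEStronglyMeasurable (fun s => R t s) (volume.restrict (uIoc 0 t)) := by
        refine ContinuousOn.aestronglyMeasurable ?_ measurableSet_uIoc
        refine hcont.comp (f := fun s => (t, s)) (by fun_prop) fun s hs => ?_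
        rw [uIoc_of_le ht.1] at hs
        exact ⟨hs.1.le, hs.2, ht.2⟩
      exact (ContinuousLinearMap.id ℝ _).aestronglyMeasurable_comp₂ h1 hf.restrict
    · rw [uIoc_of_le ht.1] at hs
      exact ((R t s).le_opNorm _).trans (mul_le_mul (hR.norm_le_exp hL hA hs.1.le hs.2 ht.2) (hM s)
        (norm_nonneg _) (Real.exp_pos _).le)
  have hkey : ∀ t ∈ Icc 0 T₀, IntervalIntegrable (fun s => A' s (z s)) volume 0 t ∧
      z t = (∫ s in (0 : ℝ)..t, f s) + ∫ s in (0 : ℝ)..t, A' s (z s) := by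
    intro t ht
    have h12 := integral_integral_triangle (g := fun s r => A' s (R s r (f r))) (t := t)
      (C := L * (Cst * M)) ht.1 ?_ ?_
    · obtain ⟨h1, h2⟩ := h12
      have e1 : ∀ s ∈ uIcc 0 t, ∫ r in (0 : ℝ)..s, A' s (R s r (f r)) = A' s (z s) := by
        intro s hs
        rw [uIcc_of_le ht.1] at hs
        exact (A' s).intervalIntegral_comp_comm (hRi s ⟨hs.1, hs.2.trans ht.2⟩)
      have e2 : ∀ r ∈ uIcc 0 t, ∫ s in r..t, A' s (R s r (f r)) = R t r (f r) - f r := by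
        intro r hr
        rw [uIcc_of_le ht.1] at hr
        have hc : ContinuousOn (fun s => R s r (f r)) (Icc r t) :=
          ((hR.continuousOn hr.1).mono Icc_subset_Ici_self).clm_apply continuousOn_const
        rw [intervalIntegral.integral_eq_sub_of_hasDerivAt_of_le hr.2
          (f := fun s => R s r (f r)) hc]
        · rw [hR.diag r hr.1]; rfl
        · intro s hs
          have h3 : HasDerivAt (fun t' => R t' r) ((A s).comp (R s r)) s :=
            (hR.deriv r s hr.1 hs.1.le).hasDerivAt (Ici_mem_nhds hs.1)
          have h4 := h3.clm_apply (hasDerivAt_const s (f r))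
          rw [hAA' s (hr.1.trans hs.1.le)]
          simpa using h4
        · refine ContinuousOn.intervalIntegrable ?_
          rw [uIcc_of_le hr.2]
          exact hA'.continuousOn.clm_apply hc
      rw [intervalIntegral.integral_congr e1, intervalIntegral.integral_congr e2,
        intervalIntegral.integral_sub (hRi t ht) (hfi _ _)] at h2
      refine ⟨h1.congr ?_, ?_⟩
      · intro s hs
        exact e1 s (uIoc_subset_uIcc hs)
      · rw [h2, hz]
        simp
    · set Δ : Set (ℝ × ℝ) := {p : ℝ × ℝ | 0 < p.2 ∧ p.2 ≤ p.1 ∧ p.1 ≤ t} with hΔ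
      have hΔm : MeasurableSet Δ :=
        (measurableSet_lt measurable_const measurable_snd).inter
          ((measurableSet_le measurable_snd measurable_fst).inter
            (measurableSet_le measurable_fst measurable_const))
      have m1 : AEStronglyMeasurable (Function.uncurry R) (volume.restrict Δ) :=
        (hcont.mono fun p hp => ⟨hp.1.le, hp.2.1, hp.2.2.trans ht.2⟩).aestronglyMeasurable hΔm
      have m2 : AEStronglyMeasurable (fun p : ℝ × ℝ => f p.2) (volume.restrict Δ) :=
        (hf.comp_snd (μ := (volume : Measure ℝ))).restrict
      have m3 : AEStronglyMeasurable (fun p : ℝ × ℝ => A' p.1) (volume.restrict Δ) :=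
        (hA'.comp continuous_fst).aestronglyMeasurable
      exact (ContinuousLinearMap.id ℝ _).aestronglyMeasurable_comp₂ m3
        ((ContinuousLinearMap.id ℝ _).aestronglyMeasurable_comp₂ m1 m2)
    · intro s r hr hrs hst
      have hs0 : 0 ≤ s := hr.le.trans hrs
      refine ((A' s).le_opNorm _).trans (mul_le_mul (hAA' s hs0 ▸ hA s hs0) ?_ (norm_nonneg _) hL)
      exact ((R s r).le_opNorm _).trans (mul_le_mul
        (hR.norm_le_exp hL hA hr.le hrs (hst.trans ht.2)) (hM r) (norm_nonneg _) (Real.exp_pos _).le)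
  have hzc : ContinuousOn z (Icc 0 T₀) := by
    have h1 : ContinuousOn (fun t => (∫ s in (0 : ℝ)..t, f s) + ∫ s in (0 : ℝ)..t, A' s (z s))
        (Icc 0 T₀) := by
      refine (intervalIntegral.continuous_primitive hfi 0).continuousOn.add ?_
      have h2 := (hkey T₀ ⟨hT₀, le_rfl⟩).1
      rw [intervalIntegrable_iff_integrableOn_Icc_of_le hT₀, ← uIcc_of_le hT₀] at h2
      rw [← uIcc_of_le hT₀]
      exact intervalIntegral.continuousOn_primitive_interval h2
    exact h1.congr fun t ht => (hkey t ht).2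
  refine ⟨IccExtend hT₀ ((Icc 0 T₀).domRestrict z), hzc.domRestrict.Icc_extend', ?_, ?_⟩
  · intro t ht
    rw [IccExtend_of_mem _ _ ht]; rfl
  · intro t ht
    rw [IccExtend_of_mem _ _ ht]
    refine (hkey t ht).2.trans ?_
    congr 1
    refine intervalIntegral.integral_congr fun s hs => ?_
    rw [uIcc_of_le ht.1] at hs
    rw [IccExtend_of_mem _ _ ⟨hs.1, hs.2.trans ht.2⟩]; rfl

end IsResolvent

end Averaging

namespace Averaging

variable {d : ℕ} {Ω : Type*} [MeasurableSpace Ω] {ν : Measure Ω}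
  {F : (Fin d → ℝ) → Ω → (Fin d → ℝ)} {L : ℝ}

/-- A common bound for a vector field and its first two differentials. -/
structure IsCbTwoBound (F : (Fin d → ℝ) → Ω → (Fin d → ℝ)) (L : ℝ) : Prop where
  norm_le : ∀ x ω, ‖F x ω‖ ≤ L
  norm_D₁_le : ∀ x ω, ‖D₁ F x ω‖ ≤ L
  norm_D₁D₁_le : ∀ x ω, ‖D₁ (D₁ F) x ω‖ ≤ L

theorem IsCbTwo.exists_bound (hF : IsCbTwo F) (a : ℝ) : ∃ L, a ≤ L ∧ 1 ≤ L ∧ IsCbTwoBound F L := by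
  obtain ⟨C₀, h₀⟩ := hF.bounded
  obtain ⟨C₁, h₁⟩ := hF.bounded_D₁
  obtain ⟨C₂, h₂⟩ := hF.bounded_D₁D₁
  refine ⟨max (max a 1) (max C₀ (max C₁ C₂)), by simp, by simp, fun x ω => (h₀ x ω).trans (by simp),
    fun x ω => (h₁ x ω).trans (by simp), fun x ω => (h₂ x ω).trans (by simp)⟩

theorem IsCbTwo.hasFDerivAt (hF : IsCbTwo F) (x : Fin d → ℝ) (ω : Ω) :
    HasFDerivAt (fun x => F x ω) (D₁ F x ω) x :=
  ((hF.contDiff ω).differentiable (by norm_num) x).hasFDerivAt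

theorem IsCbTwo.hasFDerivAt_D₁ (hF : IsCbTwo F) (x : Fin d → ℝ) (ω : Ω) :
    HasFDerivAt (fun x => D₁ F x ω) (D₁ (D₁ F) x ω) x := by
  have h : ContDiff ℝ 1 (fderiv ℝ fun x => F x ω) :=
    (hF.contDiff ω).fderiv_right (by norm_num)
  exact (h.differentiable (by norm_num) x).hasFDerivAt

theorem IsCbTwoBound.norm_sub_le (hL : IsCbTwoBound F L) (hF : IsCbTwo F) (x y : Fin d → ℝ)
    (ω : Ω) : ‖F y ω - F x ω‖ ≤ L * ‖y - x‖ :=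
  Convex.norm_image_sub_le_of_norm_hasFDerivWithin_le (f := fun x => F x ω) (s := univ)
    (fun x _ => (hF.hasFDerivAt x ω).hasFDerivWithinAt) (fun x _ => hL.norm_D₁_le x ω) convex_univ
    (mem_univ x) (mem_univ y)

theorem IsCbTwoBound.norm_D₁_sub_le (hL : IsCbTwoBound F L) (hF : IsCbTwo F) (x y : Fin d → ℝ)
    (ω : Ω) : ‖D₁ F y ω - D₁ F x ω‖ ≤ L * ‖y - x‖ :=
  Convex.norm_image_sub_le_of_norm_hasFDerivWithin_le (f := fun x => D₁ F x ω) (s := univ)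
    (fun x _ => (hF.hasFDerivAt_D₁ x ω).hasFDerivWithinAt) (fun x _ => hL.norm_D₁D₁_le x ω)
    convex_univ (mem_univ x) (mem_univ y)

theorem norm_sub_sub_le_of_lipschitz_fderiv {V W : Type*} [NormedAddCommGroup V] [NormedSpace ℝ V]
    [NormedAddCommGroup W] [NormedSpace ℝ W] {f : V → W} {f' : V → V →L[ℝ] W} {L : ℝ} (hL : 0 ≤ L)
    (hf : ∀ x, HasFDerivAt f (f' x) x) (hf' : ∀ x y, ‖f' y - f' x‖ ≤ L * ‖y - x‖) (x y : V) :
    ‖f y - f x - f' x (y - x)‖ ≤ L * ‖y - x‖ ^ 2 := by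
  have h := Convex.norm_image_sub_le_of_norm_hasFDerivWithin_le' (f := f) (f' := f')
    (C := L * ‖y - x‖) (s := segment ℝ x y) (x := x) (y := y) (φ := f' x)
    (fun z _ => (hf z).hasFDerivWithinAt)
    (fun z hz => (hf' x z).trans (mul_le_mul_of_nonneg_left ?_ hL)) (convex_segment x y)
    (left_mem_segment ℝ x y) (right_mem_segment ℝ x y)
  · rwa [mul_assoc, ← pow_two] at h
  · obtain ⟨θ, ⟨h0, h1⟩, rfl⟩ := (segment_eq_image' ℝ x y ▸ hz :)
    rw [add_sub_cancel_left, norm_smul, Real.norm_of_nonneg h0]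
    exact mul_le_of_le_one_left (norm_nonneg _) h1

theorem IsCbTwo.integrable_D₁ [IsProbabilityMeasure ν] (hF : IsCbTwo F) (x : Fin d → ℝ) :
    Integrable (D₁ F x) ν := by
  obtain ⟨L, _, _, hL⟩ := hF.exists_bound 0
  exact Integrable.of_bound
    (hF.measurable_D₁.comp measurable_prodMk_left).aestronglyMeasurable L
    (ae_of_all _ fun ω => hL.norm_D₁_le x ω)

theorem IsCbTwo.integrable [IsProbabilityMeasure ν] (hF : IsCbTwo F) (x : Fin d → ℝ) :
    Integrable (F x) ν := by
  obtain ⟨L, _, _, hL⟩ := hF.exists_bound 0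
  exact Integrable.of_bound
    (hF.measurable.comp measurable_prodMk_left).aestronglyMeasurable L
    (ae_of_all _ fun ω => hL.norm_le x ω)

section Fbar

variable [IsProbabilityMeasure ν]

theorem IsCbTwo.hasFDerivAt_Fbar (hF : IsCbTwo F) (x : Fin d → ℝ) :
    HasFDerivAt (Fbar ν F) (∫ ω, D₁ F x ω ∂ν) x := by
  obtain ⟨L, _, _, hL⟩ := hF.exists_bound 0
  exact hasFDerivAt_integral_of_dominated_of_fderiv_le (F := F) (F' := D₁ F) (s := univ)
    (bound := fun _ => L) univ_mem
    (Eventually.of_forall fun y => (hF.integrable y).aestronglyMeasurable) (hF.integrable x)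
    (hF.integrable_D₁ x).aestronglyMeasurable
    (ae_of_all _ fun ω y _ => hL.norm_D₁_le y ω) (integrable_const _)
    (ae_of_all _ fun ω y _ => hF.hasFDerivAt y ω)

theorem IsCbTwo.fderiv_Fbar (hF : IsCbTwo F) (x : Fin d → ℝ) :
    fderiv ℝ (Fbar ν F) x = ∫ ω, D₁ F x ω ∂ν :=
  (hF.hasFDerivAt_Fbar x).fderiv

theorem norm_integral_le_of_forall_norm_le {G : Type*} [NormedAddCommGroup G] [NormedSpace ℝ G]
    {f : Ω → G} {C : ℝ} (h : ∀ ω, ‖f ω‖ ≤ C) : ‖∫ ω, f ω ∂ν‖ ≤ C :=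
  (norm_integral_le_of_norm_le_const (ae_of_all _ h)).trans (by simp)

theorem IsCbTwoBound.norm_fderiv_Fbar_le (hL : IsCbTwoBound F L) (hF : IsCbTwo F)
    (x : Fin d → ℝ) : ‖fderiv ℝ (Fbar ν F) x‖ ≤ L := by
  rw [hF.fderiv_Fbar]
  exact norm_integral_le_of_forall_norm_le (hL.norm_D₁_le x)

theorem IsCbTwoBound.norm_fderiv_Fbar_sub_le (hL : IsCbTwoBound F L) (hF : IsCbTwo F)
    (x y : Fin d → ℝ) : ‖fderiv ℝ (Fbar ν F) y - fderiv ℝ (Fbar ν F) x‖ ≤ L * ‖y - x‖ := by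
  rw [hF.fderiv_Fbar, hF.fderiv_Fbar, ← integral_sub (hF.integrable_D₁ y) (hF.integrable_D₁ x)]
  exact norm_integral_le_of_forall_norm_le fun ω => hL.norm_D₁_sub_le hF x y ω

theorem IsCbTwo.continuous_fderiv_Fbar (hF : IsCbTwo F) : Continuous (fderiv ℝ (Fbar ν F)) := by
  obtain ⟨L, _, hL1, hL⟩ := hF.exists_bound 0
  refine (LipschitzWith.of_dist_le_mul (K := L.toNNReal) fun x y => ?_).continuous
  rw [Real.coe_toNNReal _ (by linarith), dist_eq_norm, dist_eq_norm]
  exact hL.norm_fderiv_Fbar_sub_le hF y x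

theorem IsCbTwo.continuous_Fbar (hF : IsCbTwo F) : Continuous (Fbar ν F) :=
  continuous_iff_continuousAt.2 fun x => (hF.hasFDerivAt_Fbar x).continuousAt

theorem IsCbTwoBound.norm_Ftilde_le (hL : IsCbTwoBound F L) (x : Fin d → ℝ) (ω : Ω) :
    ‖Ftilde ν F x ω‖ ≤ 2 * L := by
  have h1 := _root_.norm_sub_le (F x ω) (Fbar ν F x)
  have h2 : ‖Fbar ν F x‖ ≤ L := norm_integral_le_of_forall_norm_le (hL.norm_le x)
  have h3 := hL.norm_le x ω
  unfold Ftilde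
  linarith

theorem IsCbTwo.measurable_Ftilde (hF : IsCbTwo F) :
    Measurable fun q : (Fin d → ℝ) × Ω => Ftilde ν F q.1 q.2 :=
  hF.measurable.sub (hF.continuous_Fbar.measurable.comp measurable_fst)

end Fbar

/-- `G` is a centered substitute, regular in the second variable, for the differential of the
centered vector field. -/
structure IsFluctuationApprox [MetricSpace Ω] (ν : Measure Ω) (η M H h : ℝ)
    (F : (Fin d → ℝ) → Ω → (Fin d → ℝ))
    (G : (Fin d → ℝ) → Ω → (Fin d → ℝ) →L[ℝ] (Fin d → ℝ)) : Prop where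
  measurable : Measurable fun q : (Fin d → ℝ) × Ω => G q.1 q.2
  norm_le : ∀ x ω, ‖G x ω‖ ≤ M
  holder : ∀ x ω ω', ‖G x ω - G x ω'‖ ≤ M * H * dist ω ω' ^ η
  centered : ∀ x, ∫ ω, G x ω ∂ν = 0
  approx : ∀ x ω, ‖D₁ F x ω - fderiv ℝ (Fbar ν F) x - G x ω‖ ≤ M * h

theorem continuous_comp_max {V : Type*} [TopologicalSpace V] {u : ℝ → V}
    (hu : ContinuousOn u (Ici 0)) : Continuous fun s => u (max s 0) :=
  hu.comp_continuous (continuous_id.max continuous_const) fun s => le_max_right s 0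

/-- Pathwise comparison of the perturbed trajectory with its linearization. -/
theorem norm_sub_duhamel_le [MetricSpace Ω] [IsProbabilityMeasure ν] {T : Ω → Ω}
    {η M H h ε T₀ : ℝ} (hh : 0 ≤ h) (hL1 : 1 ≤ L) (hF : IsCbTwo F) (hL : IsCbTwoBound F L)
    {G : (Fin d → ℝ) → Ω → (Fin d → ℝ) →L[ℝ] (Fin d → ℝ)}
    (hG : IsFluctuationApprox ν η M H h F G)
    {x : Fin d → ℝ} {ω : Ω} {u w : ℝ → Fin d → ℝ} (hu : IsPerturbedSolution T F ε x ω u)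
    (hw : IsAveragedSolution ν F x w) {R : ℝ → ℝ → (Fin d → ℝ) →L[ℝ] (Fin d → ℝ)}
    (hR : IsResolvent (fun t => fderiv ℝ (Fbar ν F) (w t)) R) {I : ℝ → Fin d → ℝ}
    (hI : ∀ t, I t = ∫ s in (0 : ℝ)..t, Ftilde ν F (w (max s 0)) (T^[⌊s / ε⌋₊] ω)) :
    ∀ t ∈ Icc 0 T₀,
      ‖u t - w t - ∫ s in (0 : ℝ)..t, R t s (Ftilde ν F (w s) (T^[⌊s / ε⌋₊] ω))‖ ≤
        linearizationConst L M T₀ *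
        (‖∫ s in (0 : ℝ)..t, G (w (max s 0)) (T^[⌊s / ε⌋₊] ω) (I s)‖
          + ‖∫ s in (0 : ℝ)..t, G (w (max s 0)) (T^[⌊s / ε⌋₊] ω)‖ ^ 2
          + ∫ r in (0 : ℝ)..t, (‖∫ s in (0 : ℝ)..r, G (w (max s 0)) (T^[⌊s / ε⌋₊] ω) (I s)‖
            + ‖∫ s in (0 : ℝ)..r, G (w (max s 0)) (T^[⌊s / ε⌋₊] ω)‖ ^ 2
            + ‖I r‖ ^ 2 + h * ‖I r‖)) := by
  intro τ hτ
  have hT₀ : 0 ≤ T₀ := hτ.1.trans hτ.2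
  have hL0 : 0 ≤ L := by linarith
  set θ : ℝ → Ω := fun s => T^[⌊s / ε⌋₊] ω with hθ
  have hθm : Measurable θ :=
    (measurable_from_nat (f := fun n => T^[n] ω)).comp
      (Nat.measurable_floor.comp (measurable_id.div_const ε))
  have hwcon : ContinuousOn w (Ici 0) := fun t ht => (hw.deriv t ht).continuousWithinAt
  set w' : ℝ → Fin d → ℝ := fun s => w (max s 0) with hw'
  set u' : ℝ → Fin d → ℝ := fun s => u (max s 0) with hu'
  have hwc : Continuous w' := continuous_comp_max hwcon
  have huc : Continuous u' := continuous_comp_max hu.continuousOn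
  have hw'eq : ∀ s, 0 ≤ s → w' s = w s := fun s hs => by simp [hw', hs]
  have hu'eq : ∀ s, 0 ≤ s → u' s = u s := fun s hs => by simp [hu', hs]
  have hcomp : ∀ {V : Type} [MeasurableSpace V] {g : (Fin d → ℝ) → Ω → V} {v : ℝ → Fin d → ℝ},
      (Measurable fun q : (Fin d → ℝ) × Ω => g q.1 q.2) → Continuous v →
      Measurable fun s => g (v s) (θ s) := fun hg hv => hg.comp (hv.measurable.prodMk hθm)
  have hfm := hcomp (hF.measurable_Ftilde (ν := ν)) hwc
  have hFu := hcomp hF.measurable huc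
  have hFw := hcomp hF.measurable hwc
  have hfi : ∀ a b, IntervalIntegrable (fun s => Ftilde ν F (w' s) (θ s)) volume a b := fun a b =>
    intervalIntegrable_of_bounded hfm.aestronglyMeasurable fun s _ => hL.norm_Ftilde_le _ _
  have hFui : ∀ a b, IntervalIntegrable (fun s => F (u' s) (θ s)) volume a b := fun a b =>
    intervalIntegrable_of_bounded hFu.aestronglyMeasurable fun s _ => hL.norm_le _ _
  have hFwi : ∀ a b, IntervalIntegrable (fun s => F (w' s) (θ s)) volume a b := fun a b =>
    intervalIntegrable_of_bounded hFw.aestronglyMeasurable fun s _ => hL.norm_le _ _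
  have hAc : Continuous fun s => fderiv ℝ (Fbar ν F) (w' s) :=
    (hF.continuous_fderiv_Fbar (ν := ν)).comp hwc
  have hIeq : I = fun t => ∫ s in (0 : ℝ)..t, Ftilde ν F (w' s) (θ s) := funext hI
  obtain ⟨z, hzc, hzR, hz⟩ := hR.exists_continuous_duhamel hL0 hT₀
    (fun t _ => hL.norm_fderiv_Fbar_le hF _) (A' := fun s => fderiv ℝ (Fbar ν F) (w' s)) hAc
    (fun t ht => by simp only [hw'eq t ht]) (f := fun s => Ftilde ν F (w' s) (θ s))
    hfm.aestronglyMeasurable fun s => hL.norm_Ftilde_le _ _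
  have hzτ : z τ = ∫ s in (0 : ℝ)..τ, R τ s (Ftilde ν F (w s) (θ s)) := by
    rw [hzR τ hτ]
    refine intervalIntegral.integral_congr fun s hs => ?_
    rw [uIcc_of_le hτ.1] at hs
    simp only [hw'eq s hs.1]
  have hBm : Measurable fun s => D₁ F (w' s) (θ s) := hcomp hF.measurable_D₁ hwc
  have hGm : Measurable fun s => G (w' s) (θ s) := hcomp hG.measurable hwc
  have hut : ∀ t, 0 ≤ t → ∫ s in (0 : ℝ)..t, F (u' s) (θ s) = u t - u 0 := by
    intro t ht
    refine integral_eq_of_hasDerivAt_off_countable_of_le u _ ht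
      (s := range fun n : ℕ => ε * (n : ℝ)) (countable_range _)
      (hu.continuousOn.mono Icc_subset_Ici_self) (fun s hs => ?_) (hFui 0 t)
    have h1 := hu.deriv s hs.1.1.le fun n hn => hs.2 ⟨n, hn.symm⟩
    rwa [← hu'eq s hs.1.1.le] at h1
  have hwt : ∀ t, 0 ≤ t → ∫ s in (0 : ℝ)..t, Fbar ν F (w' s) = w t - w 0 := by
    intro t ht
    refine intervalIntegral.integral_eq_sub_of_hasDerivAt_of_le ht
      (hwcon.mono Icc_subset_Ici_self) (fun s hs => ?_)
      ((hF.continuous_Fbar.comp hwc).intervalIntegrable _ _)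
    rw [hw'eq s hs.1.le]
    exact (hw.deriv s hs.1.le).hasDerivAt (Ici_mem_nhds hs.1)
  have hea : ∀ t ∈ Icc 0 T₀, u' t - w' t
      = I t + ∫ s in (0 : ℝ)..t, (F (u' s) (θ s) - F (w' s) (θ s)) := by
    intro t ht
    rw [hIeq]
    simp only
    rw [← intervalIntegral.integral_add (hfi _ _) ((hFui _ _).sub (hFwi _ _))]
    have e1 : ∀ s, Ftilde ν F (w' s) (θ s) + (F (u' s) (θ s) - F (w' s) (θ s))
        = F (u' s) (θ s) - Fbar ν F (w' s) := fun s => by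
      unfold Ftilde
      abel
    simp_rw [e1]
    have hFbi : IntervalIntegrable (fun s => Fbar ν F (w' s)) volume 0 t :=
      (hF.continuous_Fbar.comp hwc).intervalIntegrable _ _
    rw [intervalIntegral.integral_sub (hFui _ _) hFbi, hut t ht.1, hwt t ht.1, hu.initial,
      hw.initial, hu'eq t ht.1, hw'eq t ht.1]
    abel
  have key := norm_sub_le_of_linearization (L := L) (M := M) (h := h) (T₀ := T₀) hL0 hh
    (e := fun s => u' s - w' s) (z := z) (I := I)
    (a := fun s => F (u' s) (θ s) - F (w' s) (θ s))
    (A := fun s => fderiv ℝ (Fbar ν F) (w' s))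
    (B := fun s => D₁ F (w' s) (θ s) - fderiv ℝ (Fbar ν F) (w' s))
    (G := fun s => G (w' s) (θ s))
    (huc.sub hwc) hzc (by rw [hIeq]; exact intervalIntegral.continuous_primitive hfi 0) hAc
    (hBm.aestronglyMeasurable.sub hAc.aestronglyMeasurable) hGm.aestronglyMeasurable
    (fun t => (hFui 0 t).sub (hFwi 0 t)) (fun t => hL.norm_fderiv_Fbar_le hF _)
    (fun t => hG.norm_le _ _) (fun t => by rw [add_sub_cancel]; exact hL.norm_D₁_le _ _)
    (fun t => hG.approx _ _) hea (fun t => hL.norm_sub_le hF _ _ _)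
    (fun t => by
      rw [add_sub_cancel]
      exact norm_sub_sub_le_of_lipschitz_fderiv hL0 (fun x => hF.hasFDerivAt x (θ t))
        (fun x y => hL.norm_D₁_sub_le hF x y (θ t)) (w' t) (u' t))
    (fun t ht => by rw [hz t ht, hIeq]) τ hτ
  simp only [hu'eq τ hτ.1, hw'eq τ hτ.1] at key
  rw [← hzτ]
  exact key

end Averaging

namespace Averaging

/-- A measurable function whose `L^p` norm is at most `a`. -/
structure HasLpBound {Ω : Type*} [MeasurableSpace Ω] (ν : Measure Ω) (p : ℕ) (X : Ω → ℝ) (a : ℝ) :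
    Prop where
  measurable : Measurable X
  nonneg : 0 ≤ a
  le : eLpNorm X (p : ENNReal) ν ≤ ENNReal.ofReal a

namespace HasLpBound

variable {Ω : Type*} [MeasurableSpace Ω] {ν : Measure Ω} {p : ℕ} {X Y : Ω → ℝ} {a b : ℝ}

theorem mono (hX : HasLpBound ν p X a) (h : a ≤ b) : HasLpBound ν p X b :=
  ⟨hX.measurable, hX.nonneg.trans h, hX.le.trans (ENNReal.ofReal_le_ofReal h)⟩

theorem add (hp : 1 ≤ p) (hX : HasLpBound ν p X a) (hY : HasLpBound ν p Y b) :
    HasLpBound ν p (fun ω => X ω + Y ω) (a + b) := by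
  refine ⟨hX.measurable.add hY.measurable, add_nonneg hX.nonneg hY.nonneg, ?_⟩
  rw [ENNReal.ofReal_add hX.nonneg hY.nonneg]
  exact (eLpNorm_add_le hX.measurable.aestronglyMeasurable hY.measurable.aestronglyMeasurable
    (by exact_mod_cast hp)).trans (add_le_add hX.le hY.le)

theorem const_mul (hX : HasLpBound ν p X a) {c : ℝ} (hc : 0 ≤ c) :
    HasLpBound ν p (fun ω => c * X ω) (c * a) := by
  refine ⟨hX.measurable.const_mul c, mul_nonneg hc hX.nonneg, ?_⟩
  have h := eLpNorm_const_smul (μ := ν) c X (p : ENNReal)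
  rw [ENNReal.ofReal_mul hc]
  refine (le_of_eq h).trans ?_
  rw [Real.enorm_eq_ofReal hc]
  exact mul_le_mul' le_rfl hX.le

theorem abs (hX : HasLpBound ν p X a) : HasLpBound ν p (fun ω => |X ω|) a :=
  ⟨hX.measurable.abs, hX.nonneg, (eLpNorm_norm X).le.trans hX.le⟩

theorem sum (hp : 1 ≤ p) {ι : Type*} [Fintype ι] {Z : ι → Ω → ℝ} (ha : 0 ≤ a)
    (h : ∀ i, HasLpBound ν p (Z i) a) :
    HasLpBound ν p (fun ω => ∑ i, Z i ω) (Fintype.card ι * a) := by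
  refine ⟨Finset.measurable_fun_sum _ fun i _ => (h i).measurable, by positivity, ?_⟩
  have h1 := eLpNorm_sum_le (μ := ν) (p := (p : ENNReal)) (f := Z) (s := Finset.univ)
    (fun i _ => (h i).measurable.aestronglyMeasurable) (by exact_mod_cast hp)
  rw [show (∑ i, Z i) = fun ω => ∑ i, Z i ω from funext fun ω => Finset.sum_apply _ _ _] at h1
  refine h1.trans ((Finset.sum_le_sum fun i _ => (h i).le).trans (le_of_eq ?_))
  rw [Finset.sum_const, Finset.card_univ, nsmul_eq_mul, ENNReal.ofReal_mul (by positivity),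
    ENNReal.ofReal_natCast]

theorem intervalIntegral [SFinite ν] (hp : 1 ≤ p) {g : ℝ → Ω → ℝ}
    (hg : Measurable (Function.uncurry g)) {t : ℝ} (ht : 0 ≤ t) (ha : 0 ≤ a)
    (h : ∀ s ∈ Icc 0 t, HasLpBound ν p (g s) a) :
    HasLpBound ν p (fun ω => ∫ s in (0 : ℝ)..t, g s ω) (t * a) := by
  refine ⟨measurable_intervalIntegral hg 0 t, by positivity, ?_⟩
  rw [ENNReal.ofReal_mul ht]
  exact eLpNorm_intervalIntegral_le hg ht hp fun s hs => (h s hs).le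

end HasLpBound

section Coordinates

variable {d : ℕ}

theorem norm_le_sum_abs (v : Fin d → ℝ) : ‖v‖ ≤ ∑ i, |v i| := by
  rw [pi_norm_le_iff_of_nonneg (Finset.sum_nonneg fun _ _ => abs_nonneg _)]
  intro i
  rw [Real.norm_eq_abs]
  exact Finset.single_le_sum (f := fun i => |v i|) (fun _ _ => abs_nonneg _) (Finset.mem_univ i)

theorem apply_eq_sum_single (A : (Fin d → ℝ) →L[ℝ] (Fin d → ℝ)) (v : Fin d → ℝ) :
    A v = ∑ j, v j • A (Pi.single j 1) := by
  conv_lhs => rw [← Finset.univ_sum_single v, map_sum]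
  refine Finset.sum_congr rfl fun j _ => ?_
  rw [← map_smul, ← Pi.single_smul, smul_eq_mul, mul_one]

theorem opNorm_le_sum_abs (A : (Fin d → ℝ) →L[ℝ] (Fin d → ℝ)) :
    ‖A‖ ≤ ∑ p : Fin d × Fin d, |A (Pi.single p.2 1) p.1| := by
  refine ContinuousLinearMap.opNorm_le_bound _ (Finset.sum_nonneg fun _ _ => abs_nonneg _)
    fun v => ?_
  refine (norm_le_sum_abs _).trans ?_
  rw [Fintype.sum_prod_type, Finset.sum_mul]
  refine Finset.sum_le_sum fun i _ => ?_
  rw [apply_eq_sum_single, Finset.sum_apply, Finset.sum_mul]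
  refine (Finset.abs_sum_le_sum_abs _ _).trans (Finset.sum_le_sum fun j _ => ?_)
  rw [Pi.smul_apply, smul_eq_mul, abs_mul, mul_comm]
  exact mul_le_mul_of_nonneg_left (norm_le_pi_norm v j) (abs_nonneg _)

theorem norm_single_one_le (j : Fin d) : ‖(Pi.single j 1 : Fin d → ℝ)‖ ≤ 1 := by
  rw [pi_norm_le_iff_of_nonneg zero_le_one]
  intro i
  by_cases h : i = j
  · subst h; simp
  · simp [h]

theorem abs_apply_single_le (A : (Fin d → ℝ) →L[ℝ] (Fin d → ℝ)) (i j : Fin d) :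
    |A (Pi.single j 1) i| ≤ ‖A‖ :=
  (norm_le_pi_norm (A (Pi.single j 1)) i).trans ((A.le_opNorm _).trans
    (mul_le_of_le_one_right (norm_nonneg _) (norm_single_one_le j)))

end Coordinates

theorem IsCenteredField.mono_right {Ω : Type*} [MetricSpace Ω] [MeasurableSpace Ω]
    {ν : Measure Ω} {η M H H' : ℝ} {φ : ℝ → Ω → ℝ} (hM : 0 ≤ M) (hH : H ≤ H')
    (h : IsCenteredField ν η M H φ) : IsCenteredField ν η M H' φ :=
  ⟨h.measurable, fun s => (h.observable s).mono le_rfl (mul_le_mul_of_nonneg_left hH hM),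
    h.centered⟩

section Fields

variable {d : ℕ} {Ω : Type*} [MetricSpace Ω] [MeasurableSpace Ω]
  {ν : Measure Ω} [IsProbabilityMeasure ν] {F : (Fin d → ℝ) → Ω → (Fin d → ℝ)} {η L M H h : ℝ}

theorem IsCbTwoBound.isCenteredField_Ftilde (hL : IsCbTwoBound F L) (hF : IsCbTwo F)
    (hLM : 2 * L ≤ M) (hol : ∀ x ω ω', ‖F x ω - F x ω'‖ ≤ M * dist ω ω' ^ η)
    {w : ℝ → Fin d → ℝ} (hw : Continuous w) (i : Fin d) :
    IsCenteredField ν η M 1 fun s ω => Ftilde ν F (w s) ω i := by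
  refine ⟨?_, fun s => ⟨fun ω => ?_, fun ω ω' => ?_⟩, fun s => ?_⟩
  · exact (measurable_pi_apply i).comp (hF.measurable_Ftilde.comp
      ((hw.measurable.comp measurable_fst).prodMk measurable_snd))
  · exact (norm_le_pi_norm (Ftilde ν F (w s) ω) i).trans ((hL.norm_Ftilde_le _ _).trans hLM)
  · rw [mul_one]
    refine le_trans ?_ (hol (w s) ω ω')
    have h1 := norm_le_pi_norm (F (w s) ω - F (w s) ω') i
    simpa [Ftilde] using h1
  · have h1 : ∫ ω, Ftilde ν F (w s) ω ∂ν = 0 := by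
      unfold Ftilde
      rw [integral_sub (hF.integrable _) (integrable_const _)]
      simp [Fbar]
    have h2 := (ContinuousLinearMap.proj (R := ℝ) (φ := fun _ : Fin d => ℝ) i).integral_comp_comm
      (μ := ν) (φ := Ftilde ν F (w s)) ((hF.integrable _).sub (integrable_const _))
    rw [h1] at h2
    simpa using h2

theorem IsFluctuationApprox.integrable
    {G : (Fin d → ℝ) → Ω → (Fin d → ℝ) →L[ℝ] (Fin d → ℝ)}
    (hG : IsFluctuationApprox ν η M H h F G) (x : Fin d → ℝ) : Integrable (G x) ν :=
  Integrable.of_bound (hG.measurable.comp measurable_prodMk_left).aestronglyMeasurable M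
    (ae_of_all _ fun ω => hG.norm_le x ω)

theorem IsFluctuationApprox.isCenteredField
    {G : (Fin d → ℝ) → Ω → (Fin d → ℝ) →L[ℝ] (Fin d → ℝ)}
    (hG : IsFluctuationApprox ν η M H h F G) {w : ℝ → Fin d → ℝ} (hw : Continuous w)
    (i j : Fin d) : IsCenteredField ν η M H fun s ω => G (w s) ω (Pi.single j 1) i := by
  refine ⟨?_, fun s => ⟨fun ω => ?_, fun ω ω' => ?_⟩, fun s => ?_⟩
  · have h1 : Measurable fun A : (Fin d → ℝ) →L[ℝ] (Fin d → ℝ) => A (Pi.single j 1) :=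
      (ContinuousLinearMap.apply ℝ _ (Pi.single j 1)).continuous.measurable
    exact (measurable_pi_apply i).comp (h1.comp (hG.measurable.comp
      ((hw.measurable.comp measurable_fst).prodMk measurable_snd)))
  · exact (abs_apply_single_le _ i j).trans (hG.norm_le _ _)
  · exact (abs_apply_single_le (G (w s) ω - G (w s) ω') i j).trans (hG.holder _ _ _)
  · have h1 := ((ContinuousLinearMap.proj (R := ℝ) (φ := fun _ : Fin d => ℝ) i).comp
      (ContinuousLinearMap.apply ℝ (Fin d → ℝ) (Pi.single j (1 : ℝ)))).integral_comp_comm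
      (μ := ν) (φ := G (w s)) (hG.integrable _)
    rw [hG.centered] at h1
    simpa using h1

end Fields

namespace IsCenteredField

variable {Ω : Type*} [MetricSpace Ω] [MeasurableSpace Ω] {ν : Measure Ω} {T : Ω → Ω}
  {η M H ε : ℝ} {φ ψ : ℝ → Ω → ℝ}

theorem continuous_orbitIntegral (hφ : IsCenteredField ν η M H φ) (hT : Measurable T) (ω : Ω) :
    Continuous fun t => orbitIntegral T ε φ t ω :=
  intervalIntegral.continuous_primitive (hφ.intervalIntegrable_orbit hT ε ω) 0

theorem continuous_orbitIteratedIntegral (hφ : IsCenteredField ν η M H φ)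
    (hψ : IsCenteredField ν η M H ψ) (hT : Measurable T) (ω : Ω) :
    Continuous fun t => orbitIteratedIntegral T ε φ ψ t ω :=
  intervalIntegral.continuous_primitive (hφ.intervalIntegrable_iterated hψ hT ε ω) 0

end IsCenteredField

section Assembly

variable {d : ℕ} {Ω : Type*} [MetricSpace Ω] [MeasurableSpace Ω]
  {ν : Measure Ω} [IsProbabilityMeasure ν] {F : (Fin d → ℝ) → Ω → (Fin d → ℝ)}
  {T : Ω → Ω} {η L M H h ε : ℝ} {G : (Fin d → ℝ) → Ω → (Fin d → ℝ) →L[ℝ] (Fin d → ℝ)}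
  {w : ℝ → Fin d → ℝ}

/-- The scalar quantity controlling the linearization error, in coordinates. -/
noncomputable def errorDensity (ν : Measure Ω) (T : Ω → Ω) (F : (Fin d → ℝ) → Ω → (Fin d → ℝ))
    (G : (Fin d → ℝ) → Ω → (Fin d → ℝ) →L[ℝ] (Fin d → ℝ)) (w : ℝ → Fin d → ℝ) (h ε t : ℝ)
    (ω : Ω) : ℝ :=
  (∑ p : Fin d × Fin d, |orbitIteratedIntegral T ε (fun s ω => Ftilde ν F (w s) ω p.2)
      (fun s ω => G (w s) ω (Pi.single p.2 1) p.1) t ω|)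
    + (d * d : ℝ) * (∑ p : Fin d × Fin d,
      orbitIntegral T ε (fun s ω => G (w s) ω (Pi.single p.2 1) p.1) t ω ^ 2)
    + d * (∑ i : Fin d, orbitIntegral T ε (fun s ω => Ftilde ν F (w s) ω i) t ω ^ 2)
    + h * ∑ i : Fin d, |orbitIntegral T ε (fun s ω => Ftilde ν F (w s) ω i) t ω|

theorem le_errorDensity (hT : Measurable T) (hh : 0 ≤ h)
    (hF : IsCbTwo F) (hL : IsCbTwoBound F L) (hG : IsFluctuationApprox ν η M H h F G)
    (hφ : ∀ i, IsCenteredField ν η M H fun s ω => Ftilde ν F (w s) ω i) (hw : Continuous w)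
    {I : ℝ → Fin d → ℝ} (ω : Ω)
    (hI : ∀ t, I t = ∫ s in (0 : ℝ)..t, Ftilde ν F (w s) (T^[⌊s / ε⌋₊] ω)) (t : ℝ) :
    ‖∫ s in (0 : ℝ)..t, G (w s) (T^[⌊s / ε⌋₊] ω) (I s)‖
      + ‖∫ s in (0 : ℝ)..t, G (w s) (T^[⌊s / ε⌋₊] ω)‖ ^ 2 + ‖I t‖ ^ 2 + h * ‖I t‖
      ≤ errorDensity ν T F G w h ε t ω := by
  have hγ := fun i j => hG.isCenteredField hw i j
  have hm : Measurable fun s : ℝ => (w s, T^[⌊s / ε⌋₊] ω) :=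
    hw.measurable.prodMk ((measurable_from_nat (f := fun n => T^[n] ω)).comp
      (Nat.measurable_floor.comp (measurable_id.div_const ε)))
  have hFi : ∀ a b, IntervalIntegrable (fun s => Ftilde ν F (w s) (T^[⌊s / ε⌋₊] ω)) volume a b :=
    fun a b => intervalIntegrable_of_bounded
      (hF.measurable_Ftilde.comp hm).aestronglyMeasurable fun s _ => hL.norm_Ftilde_le _ _
  have hGi : ∀ a b, IntervalIntegrable (fun s => G (w s) (T^[⌊s / ε⌋₊] ω)) volume a b :=
    fun a b => intervalIntegrable_of_bounded
      (hG.measurable.comp hm).aestronglyMeasurable fun s _ => hG.norm_le _ _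
  have hIc : Continuous I := by
    rw [show I = _ from funext hI]
    exact intervalIntegral.continuous_primitive hFi 0
  have hproj : ∀ {f : ℝ → Fin d → ℝ} {a b : ℝ} (i : Fin d), IntervalIntegrable f volume a b →
      (∫ s in a..b, f s) i = ∫ s in a..b, f s i := fun i hf =>
    ((ContinuousLinearMap.proj (R := ℝ) (φ := fun _ : Fin d => ℝ) i).intervalIntegral_comp_comm
      hf).symm
  have hIcoord : ∀ t i, I t i = orbitIntegral T ε (fun s ω => Ftilde ν F (w s) ω i) t ω := by
    intro t i
    rw [hI, hproj i (hFi _ _)]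
    rfl
  have hI1 : ‖I t‖ ≤ ∑ i : Fin d, |orbitIntegral T ε (fun s ω => Ftilde ν F (w s) ω i) t ω| := by
    refine (norm_le_sum_abs _).trans (le_of_eq ?_)
    simp only [hIcoord]
  have hI2 : ‖I t‖ ^ 2 ≤
      d * ∑ i : Fin d, orbitIntegral T ε (fun s ω => Ftilde ν F (w s) ω i) t ω ^ 2 := by
    refine (pow_le_pow_left₀ (norm_nonneg _) hI1 2).trans ?_
    refine sq_sum_le_card_mul_sum_sq.trans (le_of_eq ?_)
    simp only [Finset.card_univ, Fintype.card_fin, sq_abs]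
  have hΓ : ‖∫ s in (0 : ℝ)..t, G (w s) (T^[⌊s / ε⌋₊] ω)‖ ^ 2 ≤ (d * d : ℝ) *
      ∑ p : Fin d × Fin d,
        orbitIntegral T ε (fun s ω => G (w s) ω (Pi.single p.2 1) p.1) t ω ^ 2 := by
    refine (pow_le_pow_left₀ (norm_nonneg _) (opNorm_le_sum_abs _) 2).trans ?_
    refine sq_sum_le_card_mul_sum_sq.trans (le_of_eq ?_)
    simp only [Finset.card_univ, Fintype.card_prod, Fintype.card_fin, sq_abs, Nat.cast_mul]
    congr 1
    refine Finset.sum_congr rfl fun p _ => ?_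
    congr 1
    rw [ContinuousLinearMap.intervalIntegral_apply (hGi _ _), hproj]
    · rfl
    · exact ⟨(hGi 0 t).1.apply_continuousLinearMap _, (hGi 0 t).2.apply_continuousLinearMap _⟩
  have hK : ‖∫ s in (0 : ℝ)..t, G (w s) (T^[⌊s / ε⌋₊] ω) (I s)‖ ≤ ∑ p : Fin d × Fin d,
      |orbitIteratedIntegral T ε (fun s ω => Ftilde ν F (w s) ω p.2)
        (fun s ω => G (w s) ω (Pi.single p.2 1) p.1) t ω| := by
    refine (norm_le_sum_abs _).trans ?_
    rw [Fintype.sum_prod_type]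
    refine Finset.sum_le_sum fun i _ => ?_
    have hint : IntervalIntegrable (fun s => G (w s) (T^[⌊s / ε⌋₊] ω) (I s)) volume 0 t := by
      obtain ⟨C, hC⟩ := isCompact_uIcc.exists_bound_of_continuousOn
        (hIc.continuousOn (s := uIcc 0 t))
      refine intervalIntegrable_of_bounded (C := M * C) ?_ fun s hs => ?_
      · exact AEStronglyMeasurable.restrict
          ((ContinuousLinearMap.id ℝ _).aestronglyMeasurable_comp₂
            (hG.measurable.comp hm).aestronglyMeasurable hIc.aestronglyMeasurable)
      · exact (ContinuousLinearMap.le_opNorm _ _).trans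
          (mul_le_mul (hG.norm_le _ _) (hC s (uIoc_subset_uIcc hs)) (norm_nonneg _)
            ((norm_nonneg _).trans (hG.norm_le 0 ω)))
    rw [hproj i hint]
    have e1 : ∀ s, G (w s) (T^[⌊s / ε⌋₊] ω) (I s) i = ∑ j,
        G (w s) (T^[⌊s / ε⌋₊] ω) (Pi.single j 1) i *
          orbitIntegral T ε (fun s ω => Ftilde ν F (w s) ω j) s ω := by
      intro s
      rw [apply_eq_sum_single, Finset.sum_apply]
      refine Finset.sum_congr rfl fun j _ => ?_
      rw [Pi.smul_apply, smul_eq_mul, hIcoord, mul_comm]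
    simp_rw [e1]
    rw [intervalIntegral.integral_finsetSum fun j _ =>
      (hφ j).intervalIntegrable_iterated (hγ i j) hT ε ω 0 t]
    exact Finset.abs_sum_le_sum_abs _ _
  have := mul_le_mul_of_nonneg_left hI1 hh
  unfold errorDensity
  linarith

theorem continuous_errorDensity (hT : Measurable T)
    (hG : IsFluctuationApprox ν η M H h F G)
    (hφ : ∀ i, IsCenteredField ν η M H fun s ω => Ftilde ν F (w s) ω i) (hw : Continuous w)
    (ω : Ω) : Continuous fun t => errorDensity ν T F G w h ε t ω := by
  have hγ := fun i j => hG.isCenteredField hw i j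
  have h1 := fun i => (hφ i).continuous_orbitIntegral (ε := ε) hT ω
  have h2 := fun i j => (hγ i j).continuous_orbitIntegral (ε := ε) hT ω
  have h3 := fun i j => (hφ j).continuous_orbitIteratedIntegral (ε := ε) (hγ i j) hT ω
  unfold errorDensity
  refine (((continuous_finsetSum _ fun p _ => (h3 p.1 p.2).abs).add
    (continuous_const.mul (continuous_finsetSum _ fun p _ => (h2 p.1 p.2).pow 2))).add
    (continuous_const.mul (continuous_finsetSum _ fun i _ => (h1 i).pow 2))).add
    (continuous_const.mul (continuous_finsetSum _ fun i _ => (h1 i).abs))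

theorem measurable_errorDensity (hT : Measurable T)
    (hG : IsFluctuationApprox ν η M H h F G)
    (hφ : ∀ i, IsCenteredField ν η M H fun s ω => Ftilde ν F (w s) ω i) (hw : Continuous w) :
    Measurable (Function.uncurry fun t ω => errorDensity ν T F G w h ε t ω) := by
  have hγ := fun i j => hG.isCenteredField hw i j
  have h1 := fun i => (hφ i).measurable_orbitIntegral hT ε
  have h2 := fun i j => (hγ i j).measurable_orbitIntegral hT ε
  have h3 := fun i j => (hφ j).measurable_orbitIteratedIntegral (hγ i j) hT ε
  exact (((Finset.measurable_fun_sum _ fun p _ => (h3 p.1 p.2).abs).add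
    ((Finset.measurable_fun_sum _ fun p _ => (h2 p.1 p.2).pow_const 2).const_mul _)).add
    ((Finset.measurable_fun_sum _ fun i _ => (h1 i).pow_const 2).const_mul _)).add
    ((Finset.measurable_fun_sum _ fun i _ => (h1 i).abs).const_mul _)

variable [BorelSpace Ω]

/-- `L^p` bound for the linearization error. -/
theorem MultipleDecorrelation.exists_hasLpBound_errorDensity
    (hT : MeasurePreserving T ν ν) (hη : 0 < η) {r : ℝ}
    (hdec : MultipleDecorrelation ν T η r) (hr : 1 ≤ r) (hM : 1 ≤ M) {T₀ : ℝ} (hT₀ : 0 ≤ T₀)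
    {q : ℕ} (hq : 1 ≤ q) (d : ℕ) :
    ∃ C : ℝ, 0 ≤ C ∧ ∀ H : ℝ, 1 ≤ H → ∀ h : ℝ, 0 ≤ h → ∀ ε : ℝ, 0 < ε → ε ≤ 1 →
      ∀ (F : (Fin d → ℝ) → Ω → (Fin d → ℝ))
        (G : (Fin d → ℝ) → Ω → (Fin d → ℝ) →L[ℝ] (Fin d → ℝ)) (w : ℝ → Fin d → ℝ),
      IsFluctuationApprox ν η M H h F G → Continuous w →
      (∀ i, IsCenteredField ν η M 1 fun s ω => Ftilde ν F (w s) ω i) → ∀ t ∈ Icc 0 T₀,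
      HasLpBound ν (2 * q) (errorDensity ν T F G w h ε t) (C * (ε * H + h * √ε)) := by
  obtain ⟨C, hC0, hC⟩ := hdec.exists_eLpNorm_orbitIntegral_le hT hη hr hM hT₀ hq
  set D : ℝ := (d : ℝ) with hD
  have hD0 : 0 ≤ D := by positivity
  refine ⟨(D * D + (D * D) * (D * D) + D * D + D) * C, by positivity, ?_⟩
  intro H hH h hh ε hε hε1 F G w hG hw hφ t ht
  have hTm := hT.measurable
  have hM0 : 0 ≤ M := by linarith
  have hp : 1 ≤ 2 * q := by omega
  have hφH := fun i => (hφ i).mono_right hM0 hH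
  have hγ := fun i j => hG.isCenteredField hw i j
  have hεH : 0 ≤ C * (ε * H) := by positivity
  have m1 := fun i => ((hφ i).measurable_orbitIntegral hTm ε).comp (measurable_prodMk_left (x := t))
  have m2 := fun i j =>
    ((hγ i j).measurable_orbitIntegral hTm ε).comp (measurable_prodMk_left (x := t))
  have m3 := fun i j => ((hφH j).measurable_orbitIteratedIntegral (hγ i j) hTm ε).comp
    (measurable_prodMk_left (x := t))
  have b1 := HasLpBound.sum (ν := ν) hp (ι := Fin d × Fin d) hεH fun p =>
    HasLpBound.abs ⟨m3 p.1 p.2, hεH, (hC H hH ε hε hε1 t ht _ _ (hφH p.2) (hγ p.1 p.2)).2.2⟩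
  have b2 := (HasLpBound.sum (ν := ν) hp (ι := Fin d × Fin d) hεH fun p =>
    ⟨(m2 p.1 p.2).pow_const 2, hεH,
      (hC H hH ε hε hε1 t ht _ _ (hγ p.1 p.2) (hγ p.1 p.2)).2.1⟩).const_mul
    (c := (d * d : ℝ)) (by positivity)
  have b3 := (HasLpBound.sum (ν := ν) hp (ι := Fin d) hεH fun i =>
    ⟨(m1 i).pow_const 2, hεH, (hC H hH ε hε hε1 t ht _ _ (hφH i) (hφH i)).2.1⟩).const_mul hD0
  have hε0 : 0 ≤ C * √ε := by positivity
  have b4 := (HasLpBound.sum (ν := ν) hp (ι := Fin d) hε0 fun i => HasLpBound.abs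
    ⟨m1 i, hε0, by
      have h0 := (hC 1 le_rfl ε hε hε1 t ht _ _ (hφ i) (hφ i)).1
      rwa [mul_one] at h0⟩).const_mul hh
  have b := ((b1.add hp b2).add hp b3).add hp b4
  simp only [Fintype.card_prod, Fintype.card_fin, Nat.cast_mul, ← hD] at b
  refine HasLpBound.mono (X := errorDensity ν T F G w h ε t) b ?_
  have k1 : 0 ≤ h * √ε := by positivity
  have k2 : 0 ≤ ε * H := by positivity
  have k3 : 0 ≤ (D * D + D * D * (D * D) + D * D) * C * (h * √ε) := by positivity
  have k4 : 0 ≤ D * C * (ε * H) := by positivity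
  nlinarith

/-- The main estimate, for an arbitrary regular substitute of the fluctuating differential. -/
theorem MultipleDecorrelation.exists_eLpNorm_sub_yProc_le
    (hT : MeasurePreserving T ν ν) (hη : 0 < η) {r : ℝ}
    (hdec : MultipleDecorrelation ν T η r) (hr : 1 ≤ r) (hF : IsCbTwo F) (hL : IsCbTwoBound F L)
    (hL1 : 1 ≤ L) (hLM : 2 * L ≤ M) (hol : ∀ x ω ω', ‖F x ω - F x ω'‖ ≤ M * dist ω ω' ^ η)
    {T₀ : ℝ} (hT₀ : 0 ≤ T₀) (p : ℝ) :
    ∃ C : ℝ, ∀ H : ℝ, 1 ≤ H → ∀ h : ℝ, 0 ≤ h → ∀ ε : ℝ, 0 < ε → ε ≤ 1 →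
      ∀ (G : (Fin d → ℝ) → Ω → (Fin d → ℝ) →L[ℝ] (Fin d → ℝ)),
      IsFluctuationApprox ν η M H h F G →
      ∀ (x : Fin d → ℝ) (u : Ω → ℝ → Fin d → ℝ) (w : ℝ → Fin d → ℝ)
        (R : ℝ → ℝ → (Fin d → ℝ) →L[ℝ] (Fin d → ℝ)),
      (∀ ω, IsPerturbedSolution T F ε x ω (u ω)) → IsAveragedSolution ν F x w →
      IsResolvent (fun t => fderiv ℝ (Fbar ν F) (w t)) R → ∀ t ∈ Icc 0 T₀,
      eLpNorm (fun ω => (√ε)⁻¹ • (u ω t - w t) - yProc ν T F w R ε t ω) (ENNReal.ofReal p) ν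
        ≤ ENNReal.ofReal (C * (√ε * H + h)) := by
  have hM : 1 ≤ M := by linarith
  set q : ℕ := ⌈p⌉₊ + 1 with hq
  have hq1 : 1 ≤ q := by omega
  have hpq : ENNReal.ofReal p ≤ ((2 * q : ℕ) : ENNReal) := by
    rw [← ENNReal.ofReal_natCast]
    refine ENNReal.ofReal_le_ofReal ((Nat.le_ceil p).trans ?_)
    exact_mod_cast (by omega : ⌈p⌉₊ ≤ 2 * q)
  obtain ⟨C, hC0, hC⟩ := hdec.exists_hasLpBound_errorDensity hT hη hr hM hT₀ hq1 d
  set K : ℝ := linearizationConst L M T₀ with hK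
  have hK0 : 0 ≤ K := by
    have : 0 ≤ L := by linarith
    rw [hK]
    unfold linearizationConst
    positivity
  refine ⟨K * (1 + T₀) * C, ?_⟩
  intro H hH h hh ε hε hε1 G hG x u w R hu hw hR t ht
  have hwcon : ContinuousOn w (Ici 0) := fun t ht => (hw.deriv t ht).continuousWithinAt
  set w' : ℝ → Fin d → ℝ := fun s => w (max s 0) with hw'
  have hwc : Continuous w' := continuous_comp_max hwcon
  have hφ := fun i => hL.isCenteredField_Ftilde (ν := ν) hF hLM hol hwc i
  have hφH := fun i => (hφ i).mono_right (by linarith) hH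
  set Z : ℝ → Ω → ℝ := fun t ω => errorDensity ν T F G w' h ε t ω with hZ
  have hsε : 0 < √ε := Real.sqrt_pos.2 hε
  have ha0 : 0 ≤ C * (ε * H + h * √ε) := by positivity
  have hZb : ∀ s ∈ Icc 0 T₀, HasLpBound ν (2 * q) (Z s) (C * (ε * H + h * √ε)) := fun s hs =>
    hC H hH h hh ε hε hε1 F G w' hG hwc hφ s hs
  have hZm := measurable_errorDensity (ε := ε) hT.measurable hG hφH hwc
  have hbound := ((hZb t ht).add (by omega) (HasLpBound.intervalIntegral (by omega) hZm ht.1 ha0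
    fun s hs => hZb s ⟨hs.1, hs.2.trans ht.2⟩)).const_mul
      (c := (√ε)⁻¹ * K) (by positivity)
  have hpath : ∀ ω, ‖(√ε)⁻¹ • (u ω t - w t) - yProc ν T F w R ε t ω‖ ≤
      (√ε)⁻¹ * K * (Z t ω + ∫ s in (0 : ℝ)..t, Z s ω) := by
    intro ω
    unfold yProc
    rw [← smul_sub, norm_smul, norm_inv, Real.norm_of_nonneg hsε.le, mul_assoc]
    refine mul_le_mul_of_nonneg_left ?_ (inv_nonneg.2 hsε.le)
    set I : ℝ → Fin d → ℝ := fun t =>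
      ∫ s in (0 : ℝ)..t, Ftilde ν F (w' s) (T^[⌊s / ε⌋₊] ω) with hI
    have h1 := norm_sub_duhamel_le (T₀ := T₀) hh hL1 hF hL hG (hu ω) hw hR (I := I)
      (fun _ => rfl) t ht
    refine h1.trans (mul_le_mul_of_nonneg_left ?_ hK0)
    have h2 := fun s => le_errorDensity (ε := ε) hT.measurable hh hF hL hG hφH hwc ω
      (I := I) (fun _ => rfl) s
    refine add_le_add ?_ ?_
    · refine le_trans ?_ (h2 t)
      have k1 : 0 ≤ ‖I t‖ ^ 2 := by positivity
      have k2 : 0 ≤ h * ‖I t‖ := by positivity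
      linarith
    · rw [intervalIntegral.integral_of_le ht.1, intervalIntegral.integral_of_le ht.1]
      refine integral_mono_of_nonneg (ae_of_all _ fun s => by positivity) ?_ (ae_of_all _ h2)
      exact ((continuous_errorDensity hT.measurable hG hφH hwc ω).intervalIntegrable 0 t).1
  refine (eLpNorm_mono_real hpath).trans
    ((eLpNorm_le_eLpNorm_of_exponent_le hpq hbound.measurable.aestronglyMeasurable).trans
      (hbound.mono ?_).le)
  have e1 : (√ε)⁻¹ * K * (C * (ε * H + h * √ε) + t * (C * (ε * H + h * √ε)))
      = K * (1 + t) * C * (√ε * H + h) := by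
    have hs : ε = √ε * √ε := (Real.mul_self_sqrt hε.le).symm
    have hne := hsε.ne'
    generalize √ε = a at *
    subst hs
    field_simp
  rw [e1]
  have := ht.2
  gcongr

end Assembly

end Averaging

namespace Averaging

section Approximation

variable {d : ℕ} {Ω : Type*} [MeasurableSpace Ω] {ν : Measure Ω} [IsProbabilityMeasure ν]
  {F : (Fin d → ℝ) → Ω → (Fin d → ℝ)} {L : ℝ}

theorem IsCbTwo.hasFDerivAt_Ftilde (hF : IsCbTwo F) (x : Fin d → ℝ) (ω : Ω) :
    HasFDerivAt (fun x => Ftilde ν F x ω) (D₁ F x ω - fderiv ℝ (Fbar ν F) x) x :=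
  (hF.hasFDerivAt x ω).sub (hF.hasFDerivAt_Fbar x).differentiableAt.hasFDerivAt

theorem IsCbTwoBound.norm_fderiv_Ftilde_le (hL : IsCbTwoBound F L) (hF : IsCbTwo F)
    (x : Fin d → ℝ) (ω : Ω) : ‖D₁ F x ω - fderiv ℝ (Fbar ν F) x‖ ≤ 2 * L := by
  have h1 := _root_.norm_sub_le (D₁ F x ω) (fderiv ℝ (Fbar ν F) x)
  have h2 := hL.norm_D₁_le x ω
  have h3 := hL.norm_fderiv_Fbar_le (ν := ν) hF x
  linarith

theorem IsCbTwoBound.norm_Ftilde_sub_le (hL : IsCbTwoBound F L) (hF : IsCbTwo F)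
    (x y : Fin d → ℝ) (ω : Ω) : ‖Ftilde ν F y ω - Ftilde ν F x ω‖ ≤ 2 * L * ‖y - x‖ :=
  Convex.norm_image_sub_le_of_norm_hasFDerivWithin_le (f := fun x => Ftilde ν F x ω) (s := univ)
    (fun x _ => (hF.hasFDerivAt_Ftilde x ω).hasFDerivWithinAt)
    (fun x _ => hL.norm_fderiv_Ftilde_le hF x ω) convex_univ (mem_univ x) (mem_univ y)

theorem IsCbTwoBound.norm_Ftilde_sub_sub_le (hL : IsCbTwoBound F L) (hL0 : 0 ≤ L) (hF : IsCbTwo F)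
    (x y : Fin d → ℝ) (ω : Ω) :
    ‖Ftilde ν F y ω - Ftilde ν F x ω - (D₁ F x ω - fderiv ℝ (Fbar ν F) x) (y - x)‖
      ≤ 2 * L * ‖y - x‖ ^ 2 := by
  refine norm_sub_sub_le_of_lipschitz_fderiv (by positivity)
    (fun x => hF.hasFDerivAt_Ftilde (ν := ν) x ω) (fun x y => ?_) x y
  have h1 := hL.norm_D₁_sub_le hF x y ω
  have h2 := hL.norm_fderiv_Fbar_sub_le (ν := ν) hF x y
  rw [sub_sub_sub_comm]
  exact (_root_.norm_sub_le _ _).trans (by linarith)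

theorem IsCbTwo.integral_Ftilde (hF : IsCbTwo F) (x : Fin d → ℝ) :
    ∫ ω, Ftilde ν F x ω ∂ν = 0 := by
  unfold Ftilde
  rw [integral_sub (hF.integrable x) (integrable_const _)]
  simp [Fbar]

theorem IsCbTwo.integrable_Ftilde (hF : IsCbTwo F) (x : Fin d → ℝ) :
    Integrable (Ftilde ν F x) ν :=
  (hF.integrable x).sub (integrable_const _)

/-- The linear map with given columns. -/
noncomputable def ofColumns (d : ℕ) :
    (Fin d → Fin d → ℝ) →L[ℝ] ((Fin d → ℝ) →L[ℝ] (Fin d → ℝ)) :=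
  ∑ j, (ContinuousLinearMap.smulRightL ℝ (Fin d → ℝ) (Fin d → ℝ)
    (ContinuousLinearMap.proj j)).comp (ContinuousLinearMap.proj j)

theorem ofColumns_apply (c : Fin d → Fin d → ℝ) (v : Fin d → ℝ) :
    ofColumns d c v = ∑ j, v j • c j := by
  simp [ofColumns]

theorem ofColumns_apply_single (A : (Fin d → ℝ) →L[ℝ] (Fin d → ℝ)) :
    ofColumns d (fun j => A (Pi.single j 1)) = A := by
  ext1 v
  rw [ofColumns_apply, ← apply_eq_sum_single]

theorem norm_ofColumns_le {c : Fin d → Fin d → ℝ} {K : ℝ} (hK : 0 ≤ K) (h : ∀ j, ‖c j‖ ≤ K) :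
    ‖ofColumns d c‖ ≤ d * K := by
  refine ContinuousLinearMap.opNorm_le_bound _ (by positivity) fun v => ?_
  rw [ofColumns_apply]
  refine (norm_sum_le _ _).trans ((Finset.sum_le_sum fun j _ =>
    show ‖v j • c j‖ ≤ K * ‖v‖ from ?_).trans (by simp [mul_assoc]))
  rw [norm_smul, mul_comm]
  exact mul_le_mul (h j) (norm_le_pi_norm v j) (norm_nonneg _) hK

/-- The matrix of difference quotients of the centered vector field, with step `h`. -/
noncomputable def differenceQuotient (ν : Measure Ω) (F : (Fin d → ℝ) → Ω → (Fin d → ℝ)) (h : ℝ)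
    (x : Fin d → ℝ) (ω : Ω) : (Fin d → ℝ) →L[ℝ] (Fin d → ℝ) :=
  ofColumns d fun j => h⁻¹ • (Ftilde ν F (x + h • Pi.single j 1) ω - Ftilde ν F x ω)

end Approximation

variable {d : ℕ} {Ω : Type*} [MetricSpace Ω] [MeasurableSpace Ω] {ν : Measure Ω}
  [IsProbabilityMeasure ν] {F : (Fin d → ℝ) → Ω → (Fin d → ℝ)} {L M K η : ℝ}

theorem isFluctuationApprox_differenceQuotient (hF : IsCbTwo F) (hL : IsCbTwoBound F L)
    (hL0 : 0 ≤ L) (hK0 : 0 ≤ K) (hK : ∀ x ω ω', ‖F x ω - F x ω'‖ ≤ K * dist ω ω' ^ η)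
    (hLM : d * (2 * L) ≤ M) (hKM : d * (2 * K) ≤ M) {h : ℝ} (hh : 0 < h) :
    IsFluctuationApprox ν η M h⁻¹ h F (differenceQuotient ν F h) where
  measurable := by
    refine (ofColumns d).continuous.measurable.comp (measurable_pi_lambda _ fun j => ?_)
    have h1 := hF.measurable_Ftilde (ν := ν)
    exact ((h1.comp ((measurable_fst.add_const _).prodMk measurable_snd)).sub h1).const_smul h⁻¹
  norm_le x ω := by
    refine (norm_ofColumns_le (K := 2 * L) (by positivity) fun j => ?_).trans hLM
    have h1 := hL.norm_Ftilde_sub_le (ν := ν) hF x (x + h • Pi.single j 1) ω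
    rw [add_sub_cancel_left, norm_smul, Real.norm_of_nonneg hh.le] at h1
    rw [norm_smul, norm_inv, Real.norm_of_nonneg hh.le, inv_mul_le_iff₀ hh]
    refine h1.trans ?_
    have h2 := mul_le_mul_of_nonneg_left (norm_single_one_le j) hh.le
    have h3 := mul_le_mul_of_nonneg_left h2 (by positivity : 0 ≤ 2 * L)
    linarith
  holder x ω ω' := by
    rw [differenceQuotient, differenceQuotient, ← map_sub]
    have hd : 0 ≤ dist ω ω' ^ η := by positivity
    refine (norm_ofColumns_le (K := h⁻¹ * (2 * K * dist ω ω' ^ η)) (by positivity)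
      fun j => ?_).trans ?_
    · have h1 := hK (x + h • Pi.single j 1) ω ω'
      have h2 := hK x ω ω'
      have e : Ftilde ν F (x + h • Pi.single j 1) ω - Ftilde ν F x ω
          - (Ftilde ν F (x + h • Pi.single j 1) ω' - Ftilde ν F x ω')
          = (F (x + h • Pi.single j 1) ω - F (x + h • Pi.single j 1) ω') - (F x ω - F x ω') := by
        unfold Ftilde
        abel
      rw [Pi.sub_apply, ← smul_sub, norm_smul, norm_inv, Real.norm_of_nonneg hh.le, e]
      refine mul_le_mul_of_nonneg_left ((norm_sub_le _ _).trans ?_) (by positivity)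
      linarith
    · have h1 := mul_le_mul_of_nonneg_right hKM (by positivity : 0 ≤ h⁻¹ * dist ω ω' ^ η)
      linarith
  centered x := by
    have hi : ∀ j : Fin d, Integrable (fun ω =>
        h⁻¹ • (Ftilde ν F (x + h • Pi.single j 1) ω - Ftilde ν F x ω)) ν := fun j =>
      Integrable.smul h⁻¹ (f := fun ω => Ftilde ν F (x + h • Pi.single j 1) ω - Ftilde ν F x ω)
        ((hF.integrable_Ftilde _).sub (hF.integrable_Ftilde _))
    unfold differenceQuotient
    rw [(ofColumns d).integral_comp_comm (Integrable.of_eval hi)]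
    convert map_zero (ofColumns d)
    ext1 j
    rw [eval_integral hi, integral_smul,
      integral_sub (hF.integrable_Ftilde _) (hF.integrable_Ftilde _), hF.integral_Ftilde,
      hF.integral_Ftilde]
    simp
  approx x ω := by
    set A := D₁ F x ω - fderiv ℝ (Fbar ν F) x with hA
    rw [← ofColumns_apply_single A, differenceQuotient, ← map_sub]
    refine (norm_ofColumns_le (K := 2 * L * h) (by positivity) fun j => ?_).trans ?_
    · have h1 := hL.norm_Ftilde_sub_sub_le (ν := ν) hL0 hF x (x + h • Pi.single j 1) ω
      rw [← hA, add_sub_cancel_left, norm_smul, Real.norm_of_nonneg hh.le, map_smul] at h1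
      have e : A (Pi.single j 1) = h⁻¹ • h • A (Pi.single j 1) := by
        rw [inv_smul_smul₀ hh.ne']
      rw [Pi.sub_apply, e, ← smul_sub, norm_smul, norm_inv, Real.norm_of_nonneg hh.le,
        inv_mul_le_iff₀ hh, norm_sub_rev]
      refine h1.trans ?_
      have h2 : (h * ‖(Pi.single j 1 : Fin d → ℝ)‖) ^ 2 ≤ h ^ 2 :=
        pow_le_pow_left₀ (by positivity)
          (mul_le_of_le_one_right hh.le (norm_single_one_le j)) 2
      have h3 := mul_le_mul_of_nonneg_left h2 (by positivity : 0 ≤ 2 * L)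
      linarith
    · have h1 := mul_le_mul_of_nonneg_right hLM hh.le
      linarith

theorem isFluctuationApprox_sub (hF : IsCbTwo F) (hL : IsCbTwoBound F L) (hLM : 2 * L ≤ M)
    (hK : ∀ x ω ω', ‖D₁ F x ω - D₁ F x ω'‖ ≤ M * dist ω ω' ^ η) :
    IsFluctuationApprox ν η M 1 0 F fun x ω => D₁ F x ω - fderiv ℝ (Fbar ν F) x where
  measurable := hF.measurable_D₁.sub (hF.continuous_fderiv_Fbar.measurable.comp measurable_fst)
  norm_le x ω := (hL.norm_fderiv_Ftilde_le hF x ω).trans hLM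
  holder x ω ω' := by
    rw [sub_sub_sub_cancel_right, mul_one]
    exact hK x ω ω'
  centered x := by
    rw [integral_sub (hF.integrable_D₁ x) (integrable_const _), hF.fderiv_Fbar]
    simp
  approx x ω := by simp

end Averaging

theorem proposition3p5 {Ω : Type*} [MetricSpace Ω] [MeasurableSpace Ω] [BorelSpace Ω]
    (ν : Measure Ω) [IsProbabilityMeasure ν] (T : Ω → Ω) (hT : MeasurePreserving T ν ν)
    (η : ℝ) (hη₀ : 0 < η) (hη₁ : η ≤ 1)
    (d : ℕ) (F : (Fin d → ℝ) → Ω → (Fin d → ℝ))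
    (hyp : Averaging.Hypotheses ν T η F)
    -- the perturbed trajectories `X ε x ω t`
    (X : ℝ → (Fin d → ℝ) → Ω → ℝ → (Fin d → ℝ))
    (hX : ∀ ε : ℝ, 0 < ε → ∀ x ω, Averaging.IsPerturbedSolution T F ε x ω (X ε x ω))
    -- the averaged trajectories `w x t`
    (w : (Fin d → ℝ) → ℝ → (Fin d → ℝ))
    (hw : ∀ x, Averaging.IsAveragedSolution ν F x (w x))
    -- the resolvents `R x t s` of the equations linearized along the averaged trajectories
    (R : (Fin d → ℝ) → ℝ → ℝ → (Fin d → ℝ) →L[ℝ] (Fin d → ℝ))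
    (hR : ∀ x, Averaging.IsResolvent (fun t => fderiv ℝ (Averaging.Fbar ν F) (w x t)) (R x))
    (T₀ : ℝ) (hT₀ : 0 < T₀) :
    (∀ p : ℝ, 1 ≤ p → ∃ C : ℝ, ∀ᶠ ε in 𝓝[>] (0 : ℝ),
      (⨆ t ∈ Icc 0 T₀, ⨆ x : Fin d → ℝ,
        eLpNorm (fun ω => (Real.sqrt ε)⁻¹ • (X ε x ω t - w x t)
          - Averaging.yProc ν T F (w x) (R x) ε t ω) (ENNReal.ofReal p) ν)
        ≤ ENNReal.ofReal (C * ε ^ (1 / 4 : ℝ))) ∧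
    (Averaging.UniformlyHolderSnd η (Averaging.D₁ F) →
      ∀ p : ℝ, 1 ≤ p → ∃ C : ℝ, ∀ᶠ ε in 𝓝[>] (0 : ℝ),
        (⨆ t ∈ Icc 0 T₀, ⨆ x : Fin d → ℝ,
          eLpNorm (fun ω => (Real.sqrt ε)⁻¹ • (X ε x ω t - w x t)
            - Averaging.yProc ν T F (w x) (R x) ε t ω) (ENNReal.ofReal p) ν)
          ≤ ENNReal.ofReal (C * Real.sqrt ε)) := by
  obtain ⟨r, hr, hdec⟩ := hyp.decorrelation
  obtain ⟨K, hK⟩ := hyp.holder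
  have hF := hyp.cbTwo
  obtain ⟨L, -, hL1, hL⟩ := hF.exists_bound 0
  have hpow : ∀ ω ω' : Ω, 0 ≤ dist ω ω' ^ η := fun ω ω' => by positivity
  refine ⟨fun p _ => ?_, fun ⟨K', hK'⟩ p _ => ?_⟩
  · obtain ⟨K₁, hK₁, hKK₁⟩ : ∃ K₁, 0 ≤ K₁ ∧ K ≤ K₁ :=
      ⟨max 0 K, le_max_left _ _, le_max_right _ _⟩
    have hK₁' : ∀ x ω ω', ‖F x ω - F x ω'‖ ≤ K₁ * dist ω ω' ^ η := fun x ω ω' =>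
      (hK x ω ω').trans (mul_le_mul_of_nonneg_right hKK₁ (hpow ω ω'))
    set M : ℝ := (d + 1) * (2 * L + 2 * K₁) with hM
    have hd : (0 : ℝ) ≤ d := Nat.cast_nonneg d
    have hdL : 0 ≤ d * L := by positivity
    have hdK : 0 ≤ d * K₁ := by positivity
    obtain ⟨C, hC⟩ := hdec.exists_eLpNorm_sub_yProc_le hT hη₀ hr hF hL hL1
      (M := M) (by nlinarith) (fun x ω ω' => (hK₁' x ω ω').trans
        (mul_le_mul_of_nonneg_right (by nlinarith) (hpow ω ω'))) hT₀.le p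
    refine ⟨2 * C, ?_⟩
    filter_upwards [Ioo_mem_nhdsGT (zero_lt_one' ℝ)] with ε hε
    have hh : 0 < ε ^ (1 / 4 : ℝ) := Real.rpow_pos_of_pos hε.1 _
    refine iSup₂_le fun t ht => iSup_le fun x => (hC (ε ^ (1 / 4 : ℝ))⁻¹
      ((one_le_inv₀ hh).2 (Real.rpow_le_one hε.1.le hε.2.le (by norm_num))) _ hh.le ε hε.1 hε.2.le _
      (Averaging.isFluctuationApprox_differenceQuotient hF hL (by linarith) hK₁ hK₁'
        (by nlinarith) (by nlinarith) hh) x (fun ω => X ε x ω) (w x) (R x)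
      (hX ε hε.1 x) (hw x) (hR x) t ht).trans (le_of_eq ?_)
    have e : √ε = ε ^ (1 / 4 : ℝ) * ε ^ (1 / 4 : ℝ) := by
      rw [← Real.rpow_add hε.1, Real.sqrt_eq_rpow]
      norm_num
    rw [e, mul_inv_cancel_right₀ hh.ne']
    ring_nf
  · set M : ℝ := 2 * L + max 0 K + max 0 K' with hM
    have h1 := le_max_left 0 K
    have h2 := le_max_right 0 K
    have h3 := le_max_left 0 K'
    have h4 := le_max_right 0 K'
    obtain ⟨C, hC⟩ := hdec.exists_eLpNorm_sub_yProc_le hT hη₀ hr hF hL hL1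
      (M := M) (by linarith) (fun x ω ω' => (hK x ω ω').trans
        (mul_le_mul_of_nonneg_right (by linarith) (hpow ω ω'))) hT₀.le p
    refine ⟨C, ?_⟩
    filter_upwards [Ioo_mem_nhdsGT (zero_lt_one' ℝ)] with ε hε
    refine iSup₂_le fun t ht => iSup_le fun x => (hC 1 le_rfl 0 le_rfl ε hε.1 hε.2.le _
      (Averaging.isFluctuationApprox_sub hF hL (by linarith) fun x ω ω' => (hK' x ω ω').trans
        (mul_le_mul_of_nonneg_right (by linarith) (hpow ω ω'))) x (fun ω => X ε x ω) (w x) (R x)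
      (hX ε hε.1 x) (hw x) (hR x) t ht).trans (le_of_eq ?_)
    rw [mul_one, add_zero]
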